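/- **Notation.** For $s,h>0$, $\mathcal S_{s,h}(\mathbf R^d)$ is the Banach space of all $f\in C^\infty(\mathbf R^d)$ with $$\|f\|_{\mathcal S_{s,h}}=\sup_{\alpha,\beta\in\mathbf N^d,\;x\in\mathbf R^d}\frac{|x^\beta\partial^\alpha f(x)|}{h^{|\alpha|+|\beta|}(\alpha!\,\beta!)^s}<\infty ,$$ $\mathcal S_s=\bigcup_{h>0}\mathcal S_{s,h}$ with the inductive limit topology, and $\Sigma_s=\bigcap_{h>0}\mathcal S_{s,h}$. The distribution space $\mathcal S_s'$ is the dual of $\mathcal S_s$, with the projective limit topology of the Banach spaces $\mathcal S_{s,h}'$, $h>0$; $\mathscr S$ is the Schwartz space, and $(\,\cdot\,,\,\cdot\,)$ is the extension of the $L^2$ form. Functions in $\mathscr S$ are regarded as elements of $\mathcal S_{1/2}'$. A linear and continuous operator $T:\mathcal S_{1/2}(\mathbf R^{d_1})\to\mathcal S_{1/2}'(\mathbf R^{d_2})$ has kernel $K\in\mathcal S_{1/2}'(\mathbf R^{d_2+d_1})$ if $(Tf,g)=(K,g\otimes\overline f)$ for all $f\in \mathcal S_{1/2}(\mathbf R^{d_1})$,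 $g\in \mathcal S_{1/2}(\mathbf R^{d_2})$. The Hermite functions on $\mathbf R^d$ are $$h_\alpha(x)=\pi^{-d/4}(-1)^{|\alpha|}(2^{|\alpha|}\alpha!)^{-1/2}e^{|x|^2/2}\,\partial^\alpha e^{-|x|^2},\qquad \alpha\in\mathbf N^d$$ (on $\mathbf R^0$ the only one is the constant $1$). An operator $T:\mathcal S_{1/2}(\mathbf R^{d_1})\to\mathcal S_{1/2}'(\mathbf R^{d_2})$ with $d_2\ge d_1$ is a *positive Hermite diagonal operator* if $Tf=(T_0f)\otimes g$ for all $f$, where $T_0:\mathcal S_{1/2}(\mathbf R^{d_1})\to\mathcal S_{1/2}'(\mathbf R^{d_1})$ is linear and continuous, every Hermite function on $\mathbf R^{d_1}$ is an eigenfunction of $T_0$, $(T_0f,f)\ge0$ for every $f\in\mathcal S_{1/2}(\mathbf R^{d_1})$, and $g$ is a Hermite function on $\mathbf R^{d_2-d_1}$ (so $T=T_0$ if $d_2=d_1$). If $d_2<d_1$, then $T$ is called a positive Hermite diagonal operator if its adjoint $T^*:\mathcal S_{1/2}(\mathbf R^{d_2})\to\mathcal S_{1/2}'(\mathbf R^{d_1})$,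 given by $(Tf,g)=(f,T^*g)$, is one. **Theorem.** Let $T$ be a linear and continuous operator from $\mathcal S_{1/2}(\mathbf R^{d_1})$ to $\mathcal S_{1/2}'(\mathbf R^{d_2})$ with kernel $K$, and let $d_0\ge\min(d_1,d_2)$. Then the following is true. 1. If $K\in\mathscr S(\mathbf R^{d_2+d_1})$, then there are linear and continuous operators $T_1:\mathcal S_{1/2}(\mathbf R^{d_1})\to\mathcal S_{1/2}'(\mathbf R^{d_0})$ and $T_2:\mathcal S_{1/2}(\mathbf R^{d_0})\to\mathcal S_{1/2}'(\mathbf R^{d_2})$ with kernels $K_1\in\mathscr S(\mathbf R^{d_0+d_1})$ and $K_2\in\mathscr S(\mathbf R^{d_2+d_0})$ respectively such that $T=T_2\circ T_1$. 2. If $s\ge1/2$ and $K\in\mathcal S_s(\mathbf R^{d_2+d_1})$, then the same holds with $K_1\in\mathcal S_s(\mathbf R^{d_0+d_1})$ and $K_2\in\mathcal S_s(\mathbf R^{d_2+d_0})$. 3. If $s>1/2$ and $K\in\Sigma_s(\mathbf R^{d_2+d_1})$, then the same holds with $K_1\in\Sigma_s(\mathbf R^{d_0+d_1})$ and $K_2\in\Sigma_s(\mathbf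 R^{d_2+d_0})$. In each case at least one of $T_1$ and $T_2$ can be chosen as a positive Hermite diagonal operator: there is such a factorization with $T_1$ positive Hermite diagonal whenever $d_0\ge d_1$, and there is one with $T_2$ positive Hermite diagonal whenever $d_0\ge d_2$. Here $T=T_2\circ T_1$ means that $T_1$ maps $\mathcal S_{1/2}(\mathbf R^{d_1})$ into $\mathscr S(\mathbf R^{d_0})$, that $T_2$ extends to a (unique) continuous linear map $\mathscr S(\mathbf R^{d_0})\to\mathcal S_{1/2}'(\mathbf R^{d_2})$, and that $Tf=T_2(T_1f)$ for all $f\in\mathcal S_{1/2}(\mathbf R^{d_1})$, with the extended $T_2$. -/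

import Mathlib

open scoped SchwartzMap NNReal

noncomputable section

namespace GelfandShilov

/-! ### Multi-index derivatives on `ℝ^ι`

`ℝ^d` is `EuclideanSpace ℝ (Fin d)` and `ℝ^(d + d') = ℝ^d × ℝ^d'` is
`EuclideanSpace ℝ (Fin d ⊕ Fin d')`; general finite index types `ι` cover both. -/

section MultiIndex

variable {ι : Type} [Fintype ι]

/-- The partial derivative `∂_i` on the Schwartz space. -/
def pderiv (i : ι) : 𝓢(EuclideanSpace ℝ ι, ℂ) →L[ℂ] 𝓢(EuclideanSpace ℝ ι, ℂ) :=
  LineDeriv.lineDerivOpCLM ℂ 𝓢(EuclideanSpace ℝ ι, ℂ) (EuclideanSpace.basisFun ι ℝ i)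

theorem pderiv_apply (i : ι) (f : 𝓢(EuclideanSpace ℝ ι, ℂ)) (x : EuclideanSpace ℝ ι) :
    pderiv i f x = fderiv ℝ f x (EuclideanSpace.basisFun ι ℝ i) := rfl

theorem pderiv_commute (i j : ι) : Commute (pderiv i) (pderiv j) := by
  have key : ∀ (a b : ι) (f : 𝓢(EuclideanSpace ℝ ι, ℂ)) (x : EuclideanSpace ℝ ι),
      pderiv a (pderiv b f) x = fderiv ℝ (fderiv ℝ f) x (EuclideanSpace.basisFun ι ℝ a)
        (EuclideanSpace.basisFun ι ℝ b) := by
    intro a b f x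
    rw [pderiv_apply]
    have h1 : (⇑(pderiv b f) : EuclideanSpace ℝ ι → ℂ)
        = fun y => fderiv ℝ f y (EuclideanSpace.basisFun ι ℝ b) := rfl
    rw [h1]
    have hd : DifferentiableAt ℝ (fderiv ℝ f) x :=
      (SchwartzMap.fderivCLM ℝ (EuclideanSpace ℝ ι) ℂ f).differentiableAt
    rw [fderiv_clm_apply hd (differentiableAt_const _)]
    simp
  ext f x
  change pderiv i (pderiv j f) x = pderiv j (pderiv i f) x
  rw [key, key]
  have hs : IsSymmSndFDerivAt ℝ (⇑f) x :=
    ((f.smooth 2).contDiffAt).isSymmSndFDerivAt (by simp)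
  exact hs _ _

theorem pderiv_pow_pairwise (α : ι → ℕ) : ((Finset.univ : Finset ι) : Set ι).Pairwise
    (Function.onFun Commute fun i => pderiv i ^ α i) :=
  fun i _ j _ _ => (pderiv_commute i j).pow_pow (α i) (α j)

/-- The derivative `∂^α = ∏_i ∂_i^{α_i}`, for a multi-index `α`. -/
def mderiv (α : ι → ℕ) : 𝓢(EuclideanSpace ℝ ι, ℂ) →L[ℂ] 𝓢(EuclideanSpace ℝ ι, ℂ) :=
  Finset.univ.noncommProd (fun i => pderiv i ^ α i) (pderiv_pow_pairwise α)

/-- The monomial `x^β`. -/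
def monomial (β : ι → ℕ) (x : EuclideanSpace ℝ ι) : ℝ := ∏ i, x i ^ β i

/-- The length `|α|` of a multi-index. -/
def order (α : ι → ℕ) : ℕ := ∑ i, α i

/-- The factorial `α!` of a multi-index. -/
def mfactorial (α : ι → ℕ) : ℕ := ∏ i, (α i).factorial

@[simp] theorem mderiv_zero : mderiv (0 : ι → ℕ) = 1 := by
  unfold mderiv
  rw [Finset.noncommProd_eq_pow_card _ _ _ (1 : 𝓢(EuclideanSpace ℝ ι, ℂ) →L[ℂ] _)]
  · simp
  · simp

theorem mderiv_add (α β : ι → ℕ) : mderiv (α + β) = mderiv α * mderiv β := by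
  unfold mderiv
  rw [← Finset.noncommProd_mul_distrib]
  · refine Finset.noncommProd_congr rfl (fun i _ => ?_) _
    simp [pow_add]
  · intro i _ j _ _
    exact (pderiv_commute i j).pow_pow _ _

theorem mderiv_single [DecidableEq ι] (i : ι) : mderiv (Pi.single i 1) = pderiv i := by
  unfold mderiv
  have hp := pderiv_pow_pairwise (Pi.single i 1 : ι → ℕ)
  have hq : ((Finset.univ.erase i : Finset ι) : Set ι).Pairwise
      (Function.onFun Commute fun j => pderiv j ^ (Pi.single i 1 : ι → ℕ) j) :=
    hp.mono fun _ _ => Finset.mem_coe.2 (Finset.mem_univ _)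
  have h1 : (Finset.univ.erase i).noncommProd (fun j => pderiv j ^ (Pi.single i 1 : ι → ℕ) j)
      hq = 1 := by
    rw [Finset.noncommProd_eq_pow_card _ _ _ (1 : 𝓢(EuclideanSpace ℝ ι, ℂ) →L[ℂ] _)]
    · simp
    · intro j hj
      simp [Pi.single_eq_of_ne (Finset.ne_of_mem_erase hj)]
  refine (Finset.mul_noncommProd_erase _ (Finset.mem_univ i) _ hp hq).symm.trans ?_
  rw [h1]
  simp

theorem multiIndex_induction [DecidableEq ι] {p : (ι → ℕ) → Prop} (h0 : p 0)
    (hs : ∀ i α, p α → p (Pi.single i 1 + α)) (α : ι → ℕ) : p α := by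
  induction hn : ∑ i, α i generalizing α with
  | zero =>
    have : α = 0 := by
      funext i
      simpa using (Finset.sum_eq_zero_iff.1 hn) i (Finset.mem_univ i)
    exact this ▸ h0
  | succ n ih =>
    obtain ⟨i, -, hi⟩ : ∃ i ∈ Finset.univ, α i ≠ 0 := by
      apply Finset.exists_ne_zero_of_sum_ne_zero
      omega
    have hdec : α = Pi.single i 1 + (α - Pi.single i 1 : ι → ℕ) := by
      funext j
      by_cases hj : j = i
      · subst hj
        simp
        omega
      · simp [Pi.single_eq_of_ne hj]
    rw [hdec]
    refine hs i _ (ih _ ?_)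
    have h2 : ∑ j, α j = ∑ j, ((Pi.single i 1 : ι → ℕ) j + (α - Pi.single i 1 : ι → ℕ) j) := by
      conv_lhs => rw [hdec]
      rfl
    rw [Finset.sum_add_distrib, Finset.sum_pi_single'] at h2
    simp at h2 ⊢
    omega

end MultiIndex

/-! ### The Gelfand-Shilov spaces -/

section Spaces

variable {ι : Type} [Fintype ι]

/-- The quotient `|x^β ∂^α f(x)| / (h^{|α| + |β|} (α! β!)^s)`. -/
def quot (s : ℝ) (h : ℝ≥0) (f : 𝓢(EuclideanSpace ℝ ι, ℂ))
    (p : (ι → ℕ) × (ι → ℕ) × EuclideanSpace ℝ ι) : ℝ :=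
  ‖(monomial p.2.1 p.2.2 : ℂ) * mderiv p.1 f p.2.2‖ /
    ((h : ℝ) ^ (order p.1 + order p.2.1) *
      ((mfactorial p.1 * mfactorial p.2.1 : ℕ) : ℝ) ^ s)

theorem quot_nonneg (s : ℝ) (h : ℝ≥0) (f : 𝓢(EuclideanSpace ℝ ι, ℂ))
    (p : (ι → ℕ) × (ι → ℕ) × EuclideanSpace ℝ ι) : 0 ≤ quot s h f p := by
  unfold quot
  positivity

theorem quot_add_le (s : ℝ) (h : ℝ≥0) (f g : 𝓢(EuclideanSpace ℝ ι, ℂ))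
    (p : (ι → ℕ) × (ι → ℕ) × EuclideanSpace ℝ ι) :
    quot s h (f + g) p ≤ quot s h f p + quot s h g p := by
  unfold quot
  rw [← add_div]
  gcongr
  rw [map_add, add_apply, mul_add]
  exact norm_add_le _ _

theorem quot_smul (s : ℝ) (h : ℝ≥0) (c : ℂ) (f : 𝓢(EuclideanSpace ℝ ι, ℂ))
    (p : (ι → ℕ) × (ι → ℕ) × EuclideanSpace ℝ ι) :
    quot s h (c • f) p = ‖c‖ * quot s h f p := by
  unfold quot
  rw [map_smul, smul_apply, smul_eq_mul, mul_left_comm, norm_mul, mul_div_assoc]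

/-- `𝒮_{s,h}(ℝ^ι)`: the functions `f` with
`sup_{α,β,x} |x^β ∂^α f(x)| / (h^{|α| + |β|} (α! β!)^s) < ∞`. A smooth function with this
property is a Schwartz function when `h > 0`, so the space is cut out of the Schwartz space. -/
def spaceSH (s : ℝ) (h : ℝ≥0) (ι : Type) [Fintype ι] :
    Submodule ℂ 𝓢(EuclideanSpace ℝ ι, ℂ) where
  carrier := {f | BddAbove (Set.range (quot s h f))}
  zero_mem' := ⟨0, by rintro _ ⟨p, rfl⟩; simp [quot]⟩
  add_mem' := by
    rintro f g ⟨A, hA⟩ ⟨B, hB⟩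
    refine ⟨A + B, ?_⟩
    rintro _ ⟨p, rfl⟩
    exact (quot_add_le s h f g p).trans (add_le_add (hA ⟨p, rfl⟩) (hB ⟨p, rfl⟩))
  smul_mem' := by
    rintro c f ⟨A, hA⟩
    refine ⟨‖c‖ * A, ?_⟩
    rintro _ ⟨p, rfl⟩
    rw [quot_smul]
    exact mul_le_mul_of_nonneg_left (hA ⟨p, rfl⟩) (norm_nonneg c)

theorem spaceSH_mono (s : ℝ) {h h' : ℝ≥0} (h0 : 0 < h) (hh : h ≤ h') :
    spaceSH s h ι ≤ spaceSH s h' ι := by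
  rintro f ⟨A, hA⟩
  refine ⟨A, ?_⟩
  rintro _ ⟨p, rfl⟩
  refine le_trans ?_ (hA ⟨p, rfl⟩)
  have h0' : (0 : ℝ) < h := h0
  have hm : 0 < mfactorial p.1 * mfactorial p.2.1 :=
    Nat.mul_pos (Finset.prod_pos fun i _ => Nat.factorial_pos _)
      (Finset.prod_pos fun i _ => Nat.factorial_pos _)
  have hm' : (0 : ℝ) < ((mfactorial p.1 * mfactorial p.2.1 : ℕ) : ℝ) := by exact_mod_cast hm
  unfold quot
  gcongr

/-- `𝒮_s = ⋃_{h > 0} 𝒮_{s,h}`, as a set of functions. -/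
def spaceS (s : ℝ) (ι : Type) [Fintype ι] : Submodule ℂ 𝓢(EuclideanSpace ℝ ι, ℂ) where
  carrier := {f | ∃ h : ℝ≥0, 0 < h ∧ f ∈ spaceSH s h ι}
  zero_mem' := ⟨1, one_pos, zero_mem _⟩
  add_mem' := by
    rintro f g ⟨h, h0, hf⟩ ⟨h', h0', hg⟩
    exact ⟨max h h', lt_max_of_lt_left h0,
      add_mem (spaceSH_mono s h0 (le_max_left _ _) hf) (spaceSH_mono s h0' (le_max_right _ _) hg)⟩
  smul_mem' := by
    rintro c f ⟨h, h0, hf⟩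
    exact ⟨h, h0, Submodule.smul_mem _ c hf⟩

/-- `Σ_s = ⋂_{h > 0} 𝒮_{s,h}`, as a set of functions. -/
def spaceSigma (s : ℝ) (ι : Type) [Fintype ι] : Submodule ℂ 𝓢(EuclideanSpace ℝ ι, ℂ) :=
  ⨅ (h : ℝ≥0) (_ : 0 < h), spaceSH s h ι

/-- `𝒮_{s,h}(ℝ^ι)` as a normed space. -/
def NormedSH (s : ℝ) (h : ℝ≥0) (ι : Type) [Fintype ι] : Type := ↥(spaceSH s h ι)

instance (s : ℝ) (h : ℝ≥0) : AddCommGroup (NormedSH s h ι) :=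
  inferInstanceAs (AddCommGroup ↥(spaceSH s h ι))

instance (s : ℝ) (h : ℝ≥0) : Module ℂ (NormedSH s h ι) :=
  inferInstanceAs (Module ℂ ↥(spaceSH s h ι))

/-- `‖f‖ = sup_{α,β,x} |x^β ∂^α f(x)| / (h^{|α| + |β|} (α! β!)^s)`. -/
instance (s : ℝ) (h : ℝ≥0) : Norm (NormedSH s h ι) where
  norm f := ⨆ p, quot s h (f : ↥(spaceSH s h ι)).1 p

theorem NormedSH.quot_le {s : ℝ} {h : ℝ≥0} (f : NormedSH s h ι)
    (p : (ι → ℕ) × (ι → ℕ) × EuclideanSpace ℝ ι) : quot s h f.1 p ≤ ‖f‖ :=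
  le_ciSup f.2 p

theorem NormedSH.apply_le {s : ℝ} {h : ℝ≥0} (f : NormedSH s h ι) (x : EuclideanSpace ℝ ι) :
    ‖f.1 x‖ ≤ ‖f‖ := by
  have := f.quot_le (0, 0, x)
  simpa [quot, monomial, order, mfactorial] using this

theorem NormedSH.core (s : ℝ) (h : ℝ≥0) : NormedSpace.Core ℂ (NormedSH s h ι) where
  norm_nonneg f := (norm_nonneg (f.1 0)).trans (f.apply_le 0)
  norm_smul c f := by
    change (⨆ p, quot s h (c • f.1) p) = ‖c‖ * ⨆ p, quot s h f.1 p
    simp_rw [quot_smul]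
    exact (Real.mul_iSup_of_nonneg (norm_nonneg c) _).symm
  norm_triangle f g := by
    change (⨆ p, quot s h (f.1 + g.1) p) ≤ _
    exact ciSup_le fun p => (quot_add_le s h _ _ p).trans (add_le_add (f.quot_le p) (g.quot_le p))
  norm_eq_zero_iff f := by
    constructor
    · intro hf
      apply Subtype.ext
      ext x
      have := f.apply_le x
      rw [hf] at this
      exact norm_le_zero_iff.1 this
    · rintro rfl
      change (⨆ p, quot s h (0 : 𝓢(EuclideanSpace ℝ ι, ℂ)) p) = 0
      simp [quot]

instance (s : ℝ) (h : ℝ≥0) : NormedAddCommGroup (NormedSH s h ι) :=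
  NormedAddCommGroup.ofCore (NormedSH.core s h)

instance (s : ℝ) (h : ℝ≥0) : NormedSpace ℂ (NormedSH s h ι) :=
  NormedSpace.ofCore (NormedSH.core s h)

/-- The Gelfand-Shilov space `𝒮_s(ℝ^ι)` as a topological space: the inductive limit of the
`𝒮_{s,h}(ℝ^ι)`, `h > 0`. -/
def GS (s : ℝ) (ι : Type) [Fintype ι] : Type := ↥(spaceS s ι)

instance (s : ℝ) : AddCommGroup (GS s ι) := inferInstanceAs (AddCommGroup ↥(spaceS s ι))

instance (s : ℝ) : Module ℂ (GS s ι) := inferInstanceAs (Module ℂ ↥(spaceS s ι))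

/-- A Gelfand-Shilov function, as a Schwartz function. -/
def GS.toSchwartz {s : ℝ} : GS s ι →ₗ[ℂ] 𝓢(EuclideanSpace ℝ ι, ℂ) := (spaceS s ι).subtype

instance (s : ℝ) : CoeFun (GS s ι) (fun _ => EuclideanSpace ℝ ι → ℂ) :=
  ⟨fun f => f.toSchwartz⟩

/-- The inclusion of `𝒮_{s,h}` in `𝒮_s`, as a linear map. -/
def GS.inclₗ (s : ℝ) {h : ℝ≥0} (h0 : 0 < h) : NormedSH s h ι →ₗ[ℂ] GS s ι :=
  Submodule.inclusion (fun _ hf => ⟨h, h0, hf⟩ : spaceSH s h ι ≤ spaceS s ι)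

/-- The strongest topology for which all inclusions `𝒮_{s,h} → 𝒮_s` are continuous. -/
instance (s : ℝ) : TopologicalSpace (GS s ι) :=
  ⨆ (h : ℝ≥0) (h0 : 0 < h),
    TopologicalSpace.coinduced (GS.inclₗ s h0 : NormedSH s h ι → GS s ι) inferInstance

/-- The inclusion of `𝒮_{s,h}` in `𝒮_s`, as a continuous linear map. -/
def GS.incl (s : ℝ) {h : ℝ≥0} (h0 : 0 < h) : NormedSH s h ι →L[ℂ] GS s ι :=
  ⟨GS.inclₗ s h0, continuous_iff_coinduced_le.2
    (le_iSup₂_of_le (f := fun (h : ℝ≥0) (h0 : 0 < h) => TopologicalSpace.coinduced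
      (GS.inclₗ s h0 : NormedSH s h ι → GS s ι) inferInstance) h h0 le_rfl)⟩

theorem GS.continuous_iff {s : ℝ} {Y : Type*} [TopologicalSpace Y] (F : GS s ι → Y) :
    Continuous F ↔ ∀ (h : ℝ≥0) (h0 : 0 < h), Continuous fun f => F (GS.incl s h0 f) := by
  constructor
  · intro hF h h0
    exact hF.comp (GS.incl s h0).continuous
  · intro hF
    refine continuous_iSup_dom.2 fun h => continuous_iSup_dom.2 fun h0 =>
      continuous_coinduced_dom.2 (hF h h0)

/-- The Gelfand-Shilov distribution space `𝒮_s'(ℝ^ι)`. By the choice of the topology of `𝒮_s`,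
its elements are the linear forms on `𝒮_s` whose restrictions to all `𝒮_{s,h}` are continuous.
The pairing of `u` and `f` is bilinear. -/
def GSDual (s : ℝ) (ι : Type) [Fintype ι] : Type := GS s ι →L[ℂ] ℂ

instance (s : ℝ) : AddCommGroup (GSDual s ι) := inferInstanceAs (AddCommGroup (GS s ι →L[ℂ] ℂ))

instance (s : ℝ) : Module ℂ (GSDual s ι) := inferInstanceAs (Module ℂ (GS s ι →L[ℂ] ℂ))

instance (s : ℝ) : FunLike (GSDual s ι) (GS s ι) ℂ :=
  inferInstanceAs (FunLike (GS s ι →L[ℂ] ℂ) (GS s ι) ℂ)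

/-- The restriction of a Gelfand-Shilov distribution to `𝒮_{s,h}`, an element of the Banach
space `𝒮_{s,h}'`. -/
def GSDual.restrict {s : ℝ} {h : ℝ≥0} (h0 : 0 < h) (u : GSDual s ι) :
    NormedSH s h ι →L[ℂ] ℂ :=
  ContinuousLinearMap.comp (show GS s ι →L[ℂ] ℂ from u) (GS.incl s h0)

/-- `𝒮_s'` is the projective limit of the Banach spaces `𝒮_{s,h}'`, `h > 0`. -/
instance (s : ℝ) : TopologicalSpace (GSDual s ι) :=
  ⨅ (h : ℝ≥0) (h0 : 0 < h),
    TopologicalSpace.induced (GSDual.restrict h0 : GSDual s ι → (NormedSH s h ι →L[ℂ] ℂ))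
      inferInstance

/-- A Schwartz function `φ` as the Gelfand-Shilov distribution `f ↦ ∫ φ f`. -/
def toDual (s : ℝ) (φ : 𝓢(EuclideanSpace ℝ ι, ℂ)) : GSDual s ι :=
  show GS s ι →L[ℂ] ℂ from
  { toFun := fun f => ∫ x, φ x * f x
    map_add' := by
      intro f g
      have hi : ∀ k : GS s ι, MeasureTheory.Integrable (fun x => φ x * k x) := fun k =>
        (SchwartzMap.pairing (ContinuousLinearMap.mul ℂ ℂ) φ k.toSchwartz).integrable
      rw [← MeasureTheory.integral_add (hi f) (hi g)]
      simp [mul_add]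
    map_smul' := by
      intro c f
      simp only [map_smul, smul_apply, smul_eq_mul, RingHom.id_apply]
      rw [← MeasureTheory.integral_const_mul]
      congr 1
      funext x
      ring
    cont := by
      rw [GS.continuous_iff]
      intro h h0
      let L : NormedSH s h ι →ₗ[ℂ] ℂ :=
        { toFun := fun f => ∫ x, φ x * f.1 x
          map_add' := by
            intro f g
            have hi : ∀ k : NormedSH s h ι,
                MeasureTheory.Integrable (fun x => φ x * k.1 x) := fun k =>
              (SchwartzMap.pairing (ContinuousLinearMap.mul ℂ ℂ) φ k.1).integrable
            rw [← MeasureTheory.integral_add (hi f) (hi g)]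
            congr 1
            funext x
            exact mul_add _ _ _
          map_smul' := by
            intro c f
            rw [RingHom.id_apply, smul_eq_mul, ← MeasureTheory.integral_const_mul]
            congr 1
            funext x
            exact mul_left_comm _ _ _ }
      refine (L.mkContinuous (∫ x, ‖φ x‖) fun f => ?_).continuous
      change ‖∫ x, φ x * f.1 x‖ ≤ _
      rw [← MeasureTheory.integral_mul_const]
      refine MeasureTheory.norm_integral_le_of_norm_le (φ.integrable.norm.mul_const _)
        (Filter.Eventually.of_forall fun x => ?_)
      rw [norm_mul]
      exact mul_le_mul_of_nonneg_left (f.apply_le x) (norm_nonneg _) }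

end Spaces

/-! ### Complex conjugates and tensor products -/

section Conj

variable {ι : Type} [Fintype ι]

/-- The complex conjugate of a Schwartz function. -/
def sconj (f : 𝓢(EuclideanSpace ℝ ι, ℂ)) : 𝓢(EuclideanSpace ℝ ι, ℂ) :=
  SchwartzMap.postcompCLM (𝕜 := ℝ) (Complex.conjCLE : ℂ →L[ℝ] ℂ) f

theorem sconj_apply (f : 𝓢(EuclideanSpace ℝ ι, ℂ)) (x : EuclideanSpace ℝ ι) :
    sconj f x = (starRingEnd ℂ) (f x) := rfl

theorem pderiv_sconj (i : ι) (f : 𝓢(EuclideanSpace ℝ ι, ℂ)) :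
    pderiv i (sconj f) = sconj (pderiv i f) := by
  ext x
  rw [sconj_apply, pderiv_apply, pderiv_apply]
  have h1 := ((Complex.conjCLE : ℂ →L[ℝ] ℂ).hasFDerivAt.comp x
    (f.differentiableAt (x := x)).hasFDerivAt)
  have h2 : (⇑(sconj f) : EuclideanSpace ℝ ι → ℂ) = (Complex.conjCLE : ℂ →L[ℝ] ℂ) ∘ f := rfl
  rw [h2, h1.fderiv]
  rfl

theorem mderiv_sconj (α : ι → ℕ) (f : 𝓢(EuclideanSpace ℝ ι, ℂ)) :
    mderiv α (sconj f) = sconj (mderiv α f) := by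
  classical
  induction α using multiIndex_induction with
  | h0 => simp
  | hs i α ih =>
    rw [mderiv_add, mderiv_single]
    change pderiv i (mderiv α (sconj f)) = sconj (pderiv i (mderiv α f))
    rw [ih, pderiv_sconj]

theorem quot_sconj (s : ℝ) (h : ℝ≥0) (f : 𝓢(EuclideanSpace ℝ ι, ℂ)) :
    quot s h (sconj f) = quot s h f := by
  funext p
  unfold quot
  rw [mderiv_sconj, sconj_apply, norm_mul, norm_mul, RCLike.norm_conj]

/-- The complex conjugate of a Gelfand-Shilov function. -/
def GS.conj {s : ℝ} (f : GS s ι) : GS s ι :=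
  ⟨sconj f.1, by
    obtain ⟨h, h0, hf⟩ := f.2
    refine ⟨h, h0, ?_⟩
    change BddAbove (Set.range (quot s h (sconj f.1)))
    rw [quot_sconj]
    exact hf⟩

end Conj

section Tensor

variable {ι κ τ : Type} [Fintype ι] [Fintype κ] [Fintype τ]

/-- The coordinate map `x ↦ (x_{a i})_i` from `ℝ^τ` to `ℝ^ι`, for `a : ι → τ`. -/
def coords (a : ι → τ) : EuclideanSpace ℝ τ →L[ℝ] EuclideanSpace ℝ ι :=
  LinearMap.toContinuousLinearMap
    { toFun := fun x => WithLp.toLp 2 fun i => x (a i)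
      map_add' := fun _ _ => rfl
      map_smul' := fun _ _ => rfl }

theorem coords_apply (a : ι → τ) (x : EuclideanSpace ℝ τ) (i : ι) : coords a x i = x (a i) := rfl

/-- The first component of `x ∈ ℝ^τ` under `ℝ^τ ≅ ℝ^ι × ℝ^κ`. -/
def fstE (e : ι ⊕ κ ≃ τ) : EuclideanSpace ℝ τ →L[ℝ] EuclideanSpace ℝ ι := coords fun i => e (.inl i)

/-- The second component of `x ∈ ℝ^τ` under `ℝ^τ ≅ ℝ^ι × ℝ^κ`. -/
def sndE (e : ι ⊕ κ ≃ τ) : EuclideanSpace ℝ τ →L[ℝ] EuclideanSpace ℝ κ := coords fun j => e (.inr j)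

theorem norm_le_fst_add_snd (e : ι ⊕ κ ≃ τ) (x : EuclideanSpace ℝ τ) :
    ‖x‖ ≤ ‖fstE e x‖ + ‖sndE e x‖ := by
  have hsq : ‖x‖ ^ 2 = ‖fstE e x‖ ^ 2 + ‖sndE e x‖ ^ 2 := by
    rw [EuclideanSpace.real_norm_sq_eq, EuclideanSpace.real_norm_sq_eq,
      EuclideanSpace.real_norm_sq_eq, ← e.sum_comp, Fintype.sum_sum_type]
    rfl
  refine (pow_le_pow_iff_left₀ (norm_nonneg _) (by positivity) two_ne_zero).1 ?_
  nlinarith [mul_nonneg (norm_nonneg (fstE e x)) (norm_nonneg (sndE e x))]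

theorem norm_iteratedFDeriv_comp_le {E F : Type*} [NormedAddCommGroup E] [NormedSpace ℝ E]
    [NormedAddCommGroup F] [NormedSpace ℝ F] (L : E →L[ℝ] F) (f : 𝓢(F, ℂ)) (n : ℕ) (x : E) :
    ‖iteratedFDeriv ℝ n (f ∘ L) x‖ ≤ ‖L‖ ^ n * ‖iteratedFDeriv ℝ n f (L x)‖ := by
  rw [L.iteratedFDeriv_comp_right (f.smooth ⊤) x (i := n) (by exact_mod_cast le_top)]
  refine (ContinuousMultilinearMap.norm_compContinuousLinearMap_le _ _).trans ?_
  simp [mul_comm]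

/-- The tensor product `(f ⊗ g)(x, y) = f(x) g(y)` on `ℝ^τ ≅ ℝ^ι × ℝ^κ`. -/
def stensor (e : ι ⊕ κ ≃ τ) (f : 𝓢(EuclideanSpace ℝ ι, ℂ)) (g : 𝓢(EuclideanSpace ℝ κ, ℂ)) :
    𝓢(EuclideanSpace ℝ τ, ℂ) where
  toFun := fun x => f (fstE e x) * g (sndE e x)
  smooth' := ((f.smooth ⊤).comp (fstE e).contDiff).mul ((g.smooth ⊤).comp (sndE e).contDiff)
  decay' := by
    intro k n
    have hf : ∀ i, ∃ C, ∀ y, (1 + ‖y‖) ^ k * ‖iteratedFDeriv ℝ i f y‖ ≤ C := fun i =>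
      ⟨_, fun y => SchwartzMap.one_add_le_sup_seminorm_apply (𝕜 := ℝ) (m := (k, i)) le_rfl le_rfl f y⟩
    have hg : ∀ i, ∃ C, ∀ y, (1 + ‖y‖) ^ k * ‖iteratedFDeriv ℝ i g y‖ ≤ C := fun i =>
      ⟨_, fun y => SchwartzMap.one_add_le_sup_seminorm_apply (𝕜 := ℝ) (m := (k, i)) le_rfl le_rfl g y⟩
    choose A hA using hf
    choose B hB using hg
    refine ⟨∑ i ∈ Finset.range (n + 1), (n.choose i : ℝ) * (‖fstE e‖ ^ i * A i) *
      (‖sndE e‖ ^ (n - i) * B (n - i)), fun x => ?_⟩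
    have h1 := norm_iteratedFDeriv_mul_le (𝕜 := ℝ) (n := n) (N := (⊤ : ℕ∞))
      ((f.smooth ⊤).comp (fstE e).contDiff) ((g.smooth ⊤).comp (sndE e).contDiff) x
      (by exact_mod_cast le_top)
    have hk : ‖x‖ ^ k ≤ (1 + ‖fstE e x‖) ^ k * (1 + ‖sndE e x‖) ^ k := by
      rw [← mul_pow]
      refine pow_le_pow_left₀ (norm_nonneg _) ((norm_le_fst_add_snd e x).trans ?_) k
      nlinarith [mul_nonneg (norm_nonneg (fstE e x)) (norm_nonneg (sndE e x))]
    refine (mul_le_mul hk h1 (norm_nonneg _) (by positivity)).trans ?_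
    rw [Finset.mul_sum]
    refine Finset.sum_le_sum fun i _ => ?_
    have a1 := norm_iteratedFDeriv_comp_le (fstE e) f i x
    have a2 := norm_iteratedFDeriv_comp_le (sndE e) g (n - i) x
    have hA0 : 0 ≤ A i := le_trans (by positivity) (hA i 0)
    calc _ ≤ (1 + ‖fstE e x‖) ^ k * (1 + ‖sndE e x‖) ^ k * ((n.choose i : ℝ) *
          (‖fstE e‖ ^ i * ‖iteratedFDeriv ℝ i f (fstE e x)‖) *
          (‖sndE e‖ ^ (n - i) * ‖iteratedFDeriv ℝ (n - i) g (sndE e x)‖)) := by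
            gcongr
      _ = (n.choose i : ℝ) *
          (‖fstE e‖ ^ i * ((1 + ‖fstE e x‖) ^ k * ‖iteratedFDeriv ℝ i f (fstE e x)‖)) *
          (‖sndE e‖ ^ (n - i) *
            ((1 + ‖sndE e x‖) ^ k * ‖iteratedFDeriv ℝ (n - i) g (sndE e x)‖)) := by ring
      _ ≤ _ := by
            have b1 := hA i (fstE e x)
            have b2 := hB (n - i) (sndE e x)
            gcongr

theorem stensor_apply (e : ι ⊕ κ ≃ τ) (f : 𝓢(EuclideanSpace ℝ ι, ℂ))
    (g : 𝓢(EuclideanSpace ℝ κ, ℂ)) (x : EuclideanSpace ℝ τ) :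
    stensor e f g x = f (fstE e x) * g (sndE e x) := rfl

theorem fderiv_stensor (e : ι ⊕ κ ≃ τ) (f : 𝓢(EuclideanSpace ℝ ι, ℂ))
    (g : 𝓢(EuclideanSpace ℝ κ, ℂ)) (x v : EuclideanSpace ℝ τ) :
    fderiv ℝ (stensor e f g) x v = f (fstE e x) * fderiv ℝ g (sndE e x) (sndE e v) +
      fderiv ℝ f (fstE e x) (fstE e v) * g (sndE e x) := by
  have h1 := (f.differentiableAt (x := fstE e x)).hasFDerivAt.comp x (fstE e).hasFDerivAt
  have h2 := (g.differentiableAt (x := sndE e x)).hasFDerivAt.comp x (sndE e).hasFDerivAt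
  have h3 := (h1.mul h2).fderiv
  have h4 : (⇑(stensor e f g) : EuclideanSpace ℝ τ → ℂ) = (f ∘ fstE e) * (g ∘ sndE e) := rfl
  rw [h4, h3]
  simp [mul_comm]

theorem pderiv_stensor_inl (e : ι ⊕ κ ≃ τ) (f : 𝓢(EuclideanSpace ℝ ι, ℂ))
    (g : 𝓢(EuclideanSpace ℝ κ, ℂ)) (i : ι) :
    pderiv (e (.inl i)) (stensor e f g) = stensor e (pderiv i f) g := by
  classical
  ext x
  have h1 : fstE e (EuclideanSpace.basisFun τ ℝ (e (.inl i))) = EuclideanSpace.basisFun ι ℝ i := by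
    ext j
    simp [fstE, coords_apply]
  have h2 : sndE e (EuclideanSpace.basisFun τ ℝ (e (.inl i))) = 0 := by
    ext j
    simp [sndE, coords_apply]
  rw [pderiv_apply, fderiv_stensor, h1, h2, stensor_apply, pderiv_apply]
  simp

theorem pderiv_stensor_inr (e : ι ⊕ κ ≃ τ) (f : 𝓢(EuclideanSpace ℝ ι, ℂ))
    (g : 𝓢(EuclideanSpace ℝ κ, ℂ)) (j : κ) :
    pderiv (e (.inr j)) (stensor e f g) = stensor e f (pderiv j g) := by
  classical
  ext x
  have h1 : sndE e (EuclideanSpace.basisFun τ ℝ (e (.inr j))) = EuclideanSpace.basisFun κ ℝ j := by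
    ext j
    simp [sndE, coords_apply]
  have h2 : fstE e (EuclideanSpace.basisFun τ ℝ (e (.inr j))) = 0 := by
    ext j
    simp [fstE, coords_apply]
  rw [pderiv_apply, fderiv_stensor, h1, h2, stensor_apply, pderiv_apply]
  simp

theorem mderiv_stensor (e : ι ⊕ κ ≃ τ) (f : 𝓢(EuclideanSpace ℝ ι, ℂ))
    (g : 𝓢(EuclideanSpace ℝ κ, ℂ)) (α : τ → ℕ) :
    mderiv α (stensor e f g) =
      stensor e (mderiv (fun i => α (e (.inl i))) f) (mderiv (fun j => α (e (.inr j))) g) := by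
  classical
  induction α using multiIndex_induction with
  | h0 =>
    have hz : ∀ (ρ : Type) [Fintype ρ], (mderiv fun _ : ρ => 0) = 1 := fun ρ _ => mderiv_zero
    simp [hz]
  | hs t α ih =>
    rw [mderiv_add, mderiv_single]
    change pderiv t (mderiv α (stensor e f g)) = _
    rw [ih]
    obtain ⟨q, rfl⟩ := e.surjective t
    rcases q with i | j
    · rw [pderiv_stensor_inl]
      congr 1
      · have : (fun i' => (Pi.single (e (.inl i)) 1 + α : τ → ℕ) (e (.inl i'))) =
            Pi.single i 1 + fun i' => α (e (.inl i')) := by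
          funext i'
          simp [Pi.single_apply]
        rw [this, mderiv_add, mderiv_single]
        rfl
      · have : (fun j' => (Pi.single (e (.inl i)) 1 + α : τ → ℕ) (e (.inr j'))) =
            fun j' => α (e (.inr j')) := by
          funext j'
          simp
        rw [this]
    · rw [pderiv_stensor_inr]
      congr 1
      · have : (fun i' => (Pi.single (e (.inr j)) 1 + α : τ → ℕ) (e (.inl i'))) =
            fun i' => α (e (.inl i')) := by
          funext i'
          simp
        rw [this]
      · have : (fun j' => (Pi.single (e (.inr j)) 1 + α : τ → ℕ) (e (.inr j'))) =
            Pi.single j 1 + fun j' => α (e (.inr j')) := by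
          funext j'
          simp [Pi.single_apply]
        rw [this, mderiv_add, mderiv_single]
        rfl

theorem quot_stensor (s : ℝ) (h : ℝ≥0) (e : ι ⊕ κ ≃ τ) (f : 𝓢(EuclideanSpace ℝ ι, ℂ))
    (g : 𝓢(EuclideanSpace ℝ κ, ℂ)) (p : (τ → ℕ) × (τ → ℕ) × EuclideanSpace ℝ τ) :
    quot s h (stensor e f g) p =
      quot s h f (fun i => p.1 (e (.inl i)), fun i => p.2.1 (e (.inl i)), fstE e p.2.2) *
      quot s h g (fun j => p.1 (e (.inr j)), fun j => p.2.1 (e (.inr j)), sndE e p.2.2) := by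
  obtain ⟨α, β, x⟩ := p
  have ho : ∀ γ : τ → ℕ, order γ = order (fun i => γ (e (.inl i))) +
      order (fun j => γ (e (.inr j))) := fun γ => by
    rw [order, ← e.sum_comp, Fintype.sum_sum_type]; rfl
  have hm : ∀ γ : τ → ℕ, mfactorial γ = mfactorial (fun i => γ (e (.inl i))) *
      mfactorial (fun j => γ (e (.inr j))) := fun γ => by
    rw [mfactorial, ← e.prod_comp, Fintype.prod_sum_type]; rfl
  have hx : monomial β x = monomial (fun i => β (e (.inl i))) (fstE e x) *
      monomial (fun j => β (e (.inr j))) (sndE e x) := by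
    rw [monomial, ← e.prod_comp, Fintype.prod_sum_type]; rfl
  simp only [quot]
  rw [mderiv_stensor, stensor_apply, ho α, ho β, hm α, hm β, hx, div_mul_div_comm, ← norm_mul]
  congr 1
  · congr 1
    push_cast
    ring
  · rw [mul_mul_mul_comm ((h : ℝ) ^ _), ← pow_add,
      ← Real.mul_rpow (by positivity) (by positivity)]
    congr 2
    · ring
    · push_cast
      ring

/-- The tensor product of Gelfand-Shilov functions. -/
def GS.tensor {s : ℝ} (e : ι ⊕ κ ≃ τ) (f : GS s ι) (g : GS s κ) : GS s τ :=
  ⟨stensor e f.1 g.1, by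
    obtain ⟨h, h0, hf⟩ := f.2
    obtain ⟨h', h0', hg⟩ := g.2
    obtain ⟨A, hA⟩ := spaceSH_mono s h0 (le_max_left h h') hf
    obtain ⟨B, hB⟩ := spaceSH_mono s h0' (le_max_right h h') hg
    refine ⟨max h h', lt_max_of_lt_left h0, A * B, ?_⟩
    rintro _ ⟨p, rfl⟩
    rw [quot_stensor]
    exact mul_le_mul (hA ⟨_, rfl⟩) (hB ⟨_, rfl⟩) (quot_nonneg _ _ _ _)
      ((quot_nonneg _ _ _ _).trans (hA ⟨(0, 0, 0), rfl⟩))⟩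

end Tensor

/-! ### Hermite functions -/

/-- The Hermite function `h_n` on `ℝ`. -/
def hermiteOne (n : ℕ) (t : ℝ) : ℝ :=
  Real.pi ^ (-(1 / 4) : ℝ) * (-1) ^ n * ((2 : ℝ) ^ n * n.factorial) ^ (-(1 / 2) : ℝ) *
    Real.exp (t ^ 2 / 2) * iteratedDeriv n (fun u => Real.exp (-u ^ 2)) t

/-- The Hermite function
`h_α(x) = π^{-d/4} (-1)^{|α|} (2^{|α|} α!)^{-1/2} e^{|x|²/2} ∂^α e^{-|x|²}` on `ℝ^d`, which is
the product of the `h_{α_i}(x_i)` since `e^{-|x|²}` is the product of the `e^{-x_i²}`. -/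
def hermiteFun {ι : Type} [Fintype ι] (α : ι → ℕ) (x : EuclideanSpace ℝ ι) : ℝ :=
  ∏ i, hermiteOne (α i) (x i)

/-- The element `f` of `𝒮_{1/2}` is the Hermite function `h_α`. -/
def IsHermite {ι : Type} [Fintype ι] (α : ι → ℕ) (f : GS (1 / 2) ι) : Prop :=
  ∀ x, f x = (hermiteFun α x : ℂ)

/-! ### Operators -/

section Operators

/-- The linear and continuous operators from `𝒮_{1/2}(ℝ^{d₁})` to `𝒮_{1/2}'(ℝ^{d₂})`. -/
abbrev Op (d₁ d₂ : ℕ) : Type := GS (1 / 2) (Fin d₁) →L[ℂ] GSDual (1 / 2) (Fin d₂)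

variable {d₀ d₁ d₂ : ℕ}

/-- `T` has the distribution kernel `K ∈ 𝒮_{1/2}'(ℝ^{d₂ + d₁})`: `⟨Tf, g⟩ = ⟨K, g ⊗ f⟩` for the
bilinear pairing, which is `(Tf, g)_{L²} = (K, g ⊗ f̄)_{L²}`. -/
def HasKernel (T : Op d₁ d₂) (K : GSDual (1 / 2) (Fin d₂ ⊕ Fin d₁)) : Prop :=
  ∀ (f : GS (1 / 2) (Fin d₁)) (g : GS (1 / 2) (Fin d₂)),
    T f g = K (GS.tensor (Equiv.refl _) g f)

/-- `T = T₂ ∘ T₁`, where `T₂` acts on the range of `T₁` through its continuous extension to the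
Schwartz space. The extension is unique, as `𝒮_{1/2}` is dense in the Schwartz space. -/
def IsComposition (T : Op d₁ d₂) (T₂ : Op d₀ d₂) (T₁ : Op d₁ d₀) : Prop :=
  ∃ T₂' : 𝓢(EuclideanSpace ℝ (Fin d₀), ℂ) →L[ℂ] GSDual (1 / 2) (Fin d₂),
    (∀ f : GS (1 / 2) (Fin d₀), T₂' f.toSchwartz = T₂ f) ∧
    ∀ f : GS (1 / 2) (Fin d₁), ∃ φ : 𝓢(EuclideanSpace ℝ (Fin d₀), ℂ),
      T₁ f = toDual (1 / 2) φ ∧ T f = T₂' φ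

/-- `T ≥ 0`, that is, `(Tf, f)_{L²} ≥ 0` for every `f ∈ 𝒮_{1/2}`. -/
def IsPosSemidef {d : ℕ} (T : Op d d) : Prop :=
  ∀ f : GS (1 / 2) (Fin d), 0 ≤ (T f f.conj).re ∧ (T f f.conj).im = 0

/-- All Hermite functions are eigenfunctions of `T`. -/
def HermiteEigen {d : ℕ} (T : Op d d) : Prop :=
  ∀ α : Fin d → ℕ, ∃ (h : GS (1 / 2) (Fin d)) (c : ℂ), IsHermite α h ∧
    T h = c • toDual (1 / 2) h.toSchwartz

/-- `T = T₀ ⊗ g : f ↦ (T₀ f) ⊗ g` from `𝒮_{1/2}(ℝ^{d₁})` to `𝒮_{1/2}'(ℝ^{d₂})`, where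
`d₂ = d₁ + d`. -/
def IsTensorWith {d : ℕ} (hd : d₁ + d = d₂) (T : Op d₁ d₂) (T₀ : Op d₁ d₁)
    (g : GSDual (1 / 2) (Fin d)) : Prop :=
  ∀ (f φ : GS (1 / 2) (Fin d₁)) (ψ : GS (1 / 2) (Fin d)),
    T f (GS.tensor (finSumFinEquiv.trans (finCongr hd)) φ ψ) = T₀ f φ * g ψ

/-- Positive Hermite diagonal operators in the case `d₂ ≥ d₁`: `T = T₀ ⊗ g`, where the Hermite
functions are eigenfunctions of `T₀`, `T₀ ≥ 0`, and `g` is a Hermite function on `ℝ^{d₂ - d₁}`.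
When `d₂ = d₁`, the only Hermite function on `ℝ^0` is the constant `1`, and `T = T₀`. -/
def IsPosHermiteDiagonal' (T : Op d₁ d₂) : Prop :=
  ∃ (d : ℕ) (hd : d₁ + d = d₂) (T₀ : Op d₁ d₁) (γ : Fin d → ℕ) (g : GS (1 / 2) (Fin d)),
    HermiteEigen T₀ ∧ IsPosSemidef T₀ ∧ IsHermite γ g ∧
      IsTensorWith hd T T₀ (toDual (1 / 2) g.toSchwartz)

/-- `S` is the adjoint of `T`: `(Tf, g)_{L²} = (f, Sg)_{L²}`. -/
def IsAdjoint (T : Op d₁ d₂) (S : Op d₂ d₁) : Prop :=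
  ∀ (f : GS (1 / 2) (Fin d₁)) (g : GS (1 / 2) (Fin d₂)),
    T f g.conj = (starRingEnd ℂ) (S g f.conj)

/-- Positive Hermite diagonal operators from `𝒮_{1/2}(ℝ^{d₁})` to `𝒮_{1/2}'(ℝ^{d₂})`. When
`d₂ < d₁`, this means that the adjoint of `T` is a positive Hermite diagonal operator from
`𝒮_{1/2}(ℝ^{d₂})` to `𝒮_{1/2}'(ℝ^{d₁})`. -/
def IsPosHermiteDiagonal (T : Op d₁ d₂) : Prop :=
  (d₁ ≤ d₂ ∧ IsPosHermiteDiagonal' T) ∨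
    (d₂ < d₁ ∧ ∃ S : Op d₂ d₁, IsAdjoint T S ∧ IsPosHermiteDiagonal' S)

/-- `T = T₂ ∘ T₁`, where `T₁` and `T₂` have kernels in the classes `X₁` and `X₂` of functions on
`ℝ^{d₀ + d₁}` and `ℝ^{d₂ + d₀}`. -/
def IsFactorization (X₁ : Submodule ℂ 𝓢(EuclideanSpace ℝ (Fin d₀ ⊕ Fin d₁), ℂ))
    (X₂ : Submodule ℂ 𝓢(EuclideanSpace ℝ (Fin d₂ ⊕ Fin d₀), ℂ))
    (T : Op d₁ d₂) (T₁ : Op d₁ d₀) (T₂ : Op d₀ d₂) : Prop :=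
  (∃ K₁ ∈ X₁, HasKernel T₁ (toDual (1 / 2) K₁)) ∧
    (∃ K₂ ∈ X₂, HasKernel T₂ (toDual (1 / 2) K₂)) ∧ IsComposition T T₂ T₁

/-- `T = T₂ ∘ T₁` with kernels in `X₁` and `X₂`, where at least one of `T₁` and `T₂` can be chosen
as a positive Hermite diagonal operator: `T₁` whenever `d₀ ≥ d₁`, and `T₂` whenever `d₀ ≥ d₂`. -/
def HasFactorizations (X₁ : Submodule ℂ 𝓢(EuclideanSpace ℝ (Fin d₀ ⊕ Fin d₁), ℂ))
    (X₂ : Submodule ℂ 𝓢(EuclideanSpace ℝ (Fin d₂ ⊕ Fin d₀), ℂ)) (T : Op d₁ d₂) : Prop :=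
  (∃ (T₁ : Op d₁ d₀) (T₂ : Op d₀ d₂), IsFactorization X₁ X₂ T T₁ T₂ ∧
    (IsPosHermiteDiagonal T₁ ∨ IsPosHermiteDiagonal T₂)) ∧
  (d₁ ≤ d₀ → ∃ (T₁ : Op d₁ d₀) (T₂ : Op d₀ d₂), IsFactorization X₁ X₂ T T₁ T₂ ∧
    IsPosHermiteDiagonal T₁) ∧
  (d₂ ≤ d₀ → ∃ (T₁ : Op d₁ d₀) (T₂ : Op d₀ d₂), IsFactorization X₁ X₂ T T₁ T₂ ∧
    IsPosHermiteDiagonal T₂)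

end Operators

end GelfandShilov

end

open GelfandShilov

noncomputable section

namespace GelfandShilov

/-! ### Hermite functions on the line -/

section Line

/-! Expand the kernel in Hermite functions, `K = ∑ k(β,α) h_β ⊗ h_α`. Membership of `K` in each of
the three classes depends only on the decay of `|k(β,α)|`, and rapidly decaying coefficients can be
split by a square root. Put `μ(α) = (sup_β |k(β,α)|)^(1/2)` and `ν(β,α) = k(β,α)/μ(α)`, so that `|ν|
≤ |k|^(1/2)`. When `d₀ ≥ d₁`, extend `α` by zeros to a multi-index `(α,0)` of length `d₀`; the
kernels `∑ μ(α) h_(α,0) ⊗ h_α` and `∑ ν(β,α) h_β ⊗ h_(α,0)` then compose to `K` by orthonormality.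
The first one is Hermite diagonal and nonnegative because `h_(α,0) = h_α ⊗ h_0` and `μ ≥ 0`. When
`d₀ ≥ d₂`, exchange the roles of `α` and `β` (`exists_sqrt_factor`,
`pair_stensor_eq_of_diagonal_right`, `pair_stensor_eq_of_diagonal_left`).

The analytic core is the description of the classes by bounds `|c_γ| (1+|γ|)^N ≤ B(N)`: `B` is
arbitrary for the Schwartz space, `B(N) ≤ C h^N N!^(2s)` for some `h` for `𝒮_s`, and for every `h`
for `Σ_s` (`mem_spaceS_iff`, `mem_spaceSigma_iff`). Each class of bounds is stable under `B(N) ↦ 2^N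
√B(2N)`, which is the price of the square root.

For the decay of coefficients, apply powers of the number operator, with eigenvalue `1 + 2|γ|` at
`h_γ`, to `f`. Its `N`-th power involves `2N` creation and annihilation operators, and bounds of the
form `C h^m (m+n)!^s` are reproduced by each of them with `n` raised by one (`ladderBound_le`). For
the converse, `x^β ∂^α h_γ` is estimated by repeated use of the ladder relations, and the Hermite
series is summed (`exists_norm_isWord_apply_le`). This produces a term `√n!` that no decay of
coefficients removes; it is the reason for `s ≥ 1/2`, and for the strict inequality in the case of
`Σ_s`. -/

theorem hasDerivAt_iteratedDeriv_gauss (n : ℕ) (t : ℝ) :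
    HasDerivAt (iteratedDeriv n fun u : ℝ => Real.exp (-u ^ 2))
      (iteratedDeriv (n + 1) (fun u : ℝ => Real.exp (-u ^ 2)) t) t := by
  have hc : ContDiff ℝ (n + 1) (fun u : ℝ => Real.exp (-u ^ 2)) := by fun_prop
  rw [iteratedDeriv_succ]
  exact (hc.differentiable_iteratedDeriv n (by exact_mod_cast n.lt_succ_self) t).hasDerivAt

/-- Differentiating the recurrence at `n` gives the one at `n + 1`. At `n = 0` the truncated index
`n - 1` is harmless because its coefficient vanishes; the same holds in all the ladder formulas
below. -/
theorem iteratedDeriv_gauss_succ (n : ℕ) (t : ℝ) :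
    iteratedDeriv (n + 1) (fun u : ℝ => Real.exp (-u ^ 2)) t =
      -2 * t * iteratedDeriv n (fun u : ℝ => Real.exp (-u ^ 2)) t -
        2 * n * iteratedDeriv (n - 1) (fun u : ℝ => Real.exp (-u ^ 2)) t := by
  induction n generalizing t with
  | zero =>
    have h : HasDerivAt (fun u : ℝ => Real.exp (-u ^ 2)) (Real.exp (-t ^ 2) * -(2 * t)) t := by
      have := ((hasDerivAt_pow 2 t).neg).exp
      simpa using this
    simp only [zero_add, iteratedDeriv_one, iteratedDeriv_zero, h.deriv]
    simp; ring
  | succ n ih =>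
    have h1 := hasDerivAt_iteratedDeriv_gauss (n + 1) t
    have h2 := (((hasDerivAt_id t).const_mul (-2 : ℝ)).mul
      (hasDerivAt_iteratedDeriv_gauss n t)).sub
      ((hasDerivAt_iteratedDeriv_gauss (n - 1) t).const_mul (2 * n : ℝ))
    have h3 := h1.unique (h2.congr_of_eventuallyEq (Filter.Eventually.of_forall ih))
    rw [h3]
    rcases n with _ | n
    · simp; ring
    · simp
      ring

/-- The normalizing factor of the Hermite function `h_n`. -/
def hermiteCoeff (n : ℕ) : ℝ :=
  Real.pi ^ (-(1 / 4) : ℝ) * (-1) ^ n * ((2 : ℝ) ^ n * n.factorial) ^ (-(1 / 2) : ℝ)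

theorem hermiteOne_eq (n : ℕ) (t : ℝ) : hermiteOne n t = hermiteCoeff n * Real.exp (t ^ 2 / 2) *
    iteratedDeriv n (fun u : ℝ => Real.exp (-u ^ 2)) t := rfl

theorem hermiteCoeff_succ (n : ℕ) :
    hermiteCoeff n = -(√2 * √(n + 1)) * hermiteCoeff (n + 1) := by
  unfold hermiteCoeff
  have h1 : ((2 : ℝ) ^ (n + 1) * (n + 1).factorial) ^ (-(1 / 2) : ℝ) =
      (√2 * √(n + 1))⁻¹ * ((2 : ℝ) ^ n * n.factorial) ^ (-(1 / 2) : ℝ) := by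
    rw [← Real.sqrt_mul (by norm_num), Real.sqrt_eq_rpow, ← Real.rpow_neg (by positivity),
      ← Real.mul_rpow (by positivity) (by positivity), Nat.factorial_succ]
    congr 1
    push_cast
    ring
  have h2 : √2 * √(n + 1 : ℝ) ≠ 0 := by positivity
  rw [h1]
  field_simp
  ring

/-- The left side is `h_n' - t h_n`, the part of the derivative that does not fall on `exp (t ^ 2 /
2)`; this is the creation relation on the line. -/
theorem hermiteOne_deriv_aux (n : ℕ) (t : ℝ) :
    hermiteCoeff n * Real.exp (t ^ 2 / 2) *
      iteratedDeriv (n + 1) (fun u : ℝ => Real.exp (-u ^ 2)) t =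
      -(√2 * √(n + 1)) * hermiteOne (n + 1) t := by
  rw [hermiteOne_eq, hermiteCoeff_succ n]
  ring

theorem mul_hermiteOne (n : ℕ) (t : ℝ) :
    t * hermiteOne n t =
      (√(n + 1) * hermiteOne (n + 1) t + √n * hermiteOne (n - 1) t) / √2 := by
  have h1 := hermiteOne_deriv_aux n t
  rw [iteratedDeriv_gauss_succ] at h1
  have hs : √2 * √2 = (2 : ℝ) := Real.mul_self_sqrt (by norm_num)
  have h2 : (2 * n : ℝ) * (hermiteCoeff n * Real.exp (t ^ 2 / 2) *
      iteratedDeriv (n - 1) (fun u : ℝ => Real.exp (-u ^ 2)) t) =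
      -(√2 * √n) * hermiteOne (n - 1) t := by
    rcases n with _ | n
    · simp
    · have hn : √((n + 1 : ℕ) : ℝ) * √((n + 1 : ℕ) : ℝ) = ((n + 1 : ℕ) : ℝ) :=
        Real.mul_self_sqrt (by positivity)
      have h3 := hermiteCoeff_succ n
      have hc : ((n : ℝ) + 1) = ((n + 1 : ℕ) : ℝ) := by push_cast; ring
      rw [hc] at h3
      rw [Nat.add_sub_cancel, hermiteOne_eq, h3]
      linear_combination (-2 * (hermiteCoeff (n + 1) * Real.exp (t ^ 2 / 2) *
        iteratedDeriv n (fun u : ℝ => Real.exp (-u ^ 2)) t)) * hn +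
        (-(√((n + 1 : ℕ) : ℝ) * √((n + 1 : ℕ) : ℝ)) * (hermiteCoeff (n + 1) * Real.exp (t ^ 2 / 2) *
        iteratedDeriv n (fun u : ℝ => Real.exp (-u ^ 2)) t)) * hs
  have h4 := hermiteOne_eq n t
  have : √2 ≠ 0 := by positivity
  field_simp
  have h5 : 2 * t * hermiteOne n t =
      √2 * (√(n + 1) * hermiteOne (n + 1) t + √n * hermiteOne (n - 1) t) := by
    rw [h4]
    linear_combination -h1 - h2
  apply mul_left_cancel₀ this
  linear_combination h5 + t * hermiteOne n t * hs

theorem hasDerivAt_hermiteOne (n : ℕ) (t : ℝ) :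
    HasDerivAt (hermiteOne n)
      ((√n * hermiteOne (n - 1) t - √(n + 1) * hermiteOne (n + 1) t) / √2) t := by
  have h1 : HasDerivAt (fun u : ℝ => Real.exp (u ^ 2 / 2)) (Real.exp (t ^ 2 / 2) * t) t := by
    have := ((hasDerivAt_pow 2 t).div_const 2).exp
    simpa using this
  have h2 := (h1.const_mul (hermiteCoeff n)).mul (hasDerivAt_iteratedDeriv_gauss n t)
  refine h2.congr_deriv ?_
  rw [hermiteOne_deriv_aux]
  have h3 := mul_hermiteOne n t
  have h4 := hermiteOne_eq n t
  have hs : √2 * √2 = (2 : ℝ) := Real.mul_self_sqrt (by norm_num)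
  have : √2 ≠ 0 := by positivity
  have h5 : hermiteCoeff n * (Real.exp (t ^ 2 / 2) * t) *
      iteratedDeriv n (fun u : ℝ => Real.exp (-u ^ 2)) t = t * hermiteOne n t := by
    rw [h4]; ring
  rw [h5, h3]
  field_simp
  linear_combination (-√(n + 1) * hermiteOne (n + 1) t) * hs

theorem hermiteOne_zero (t : ℝ) :
    hermiteOne 0 t = Real.pi ^ (-(1 / 4) : ℝ) * Real.exp (-t ^ 2 / 2) := by
  rw [hermiteOne_eq, hermiteCoeff]
  simp only [iteratedDeriv_zero, mul_assoc, ← Real.exp_add]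
  rw [show t ^ 2 / 2 + -t ^ 2 = -t ^ 2 / 2 by ring]
  simp

theorem exists_hermiteOne_eq (n : ℕ) : ∃ p : ℝ → ℝ, p.HasTemperateGrowth ∧
    ∀ t, hermiteOne n t = p t * Real.exp (-t ^ 2 / 2) := by
  suffices H : ∀ n, (∃ p : ℝ → ℝ, p.HasTemperateGrowth ∧
      ∀ t, hermiteOne n t = p t * Real.exp (-t ^ 2 / 2)) ∧
      ∃ p : ℝ → ℝ, p.HasTemperateGrowth ∧
        ∀ t, hermiteOne (n + 1) t = p t * Real.exp (-t ^ 2 / 2) from (H n).1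
  have step : ∀ (n : ℕ) (t : ℝ), hermiteOne (n + 1) t =
      (√2 * t * hermiteOne n t - √n * hermiteOne (n - 1) t) / √(n + 1) := fun n t => by
    have h := mul_hermiteOne n t
    have h2 : √2 ≠ 0 := by positivity
    have h3 : √(n + 1 : ℝ) ≠ 0 := by positivity
    field_simp at h ⊢
    linear_combination -h
  -- The recurrence has three terms, so two consecutive indices are carried along. The alternative
  -- `√n = 0` starts it at `n = 0`, where there is no predecessor.
  have nxt : ∀ (n : ℕ) (p q : ℝ → ℝ), p.HasTemperateGrowth → q.HasTemperateGrowth →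
      (∀ t, hermiteOne n t = p t * Real.exp (-t ^ 2 / 2)) →
      (√n = 0 ∨ ∀ t, hermiteOne (n - 1) t = q t * Real.exp (-t ^ 2 / 2)) →
      ∃ p : ℝ → ℝ, p.HasTemperateGrowth ∧
        ∀ t, hermiteOne (n + 1) t = p t * Real.exp (-t ^ 2 / 2) := fun n p q hp hq h1 h2 => by
    refine ⟨fun t => (√(n + 1))⁻¹ * (√2 * t * p t - √n * q t), by fun_prop, fun t => ?_⟩
    rw [step, h1]
    rcases h2 with h2 | h2
    · rw [h2]; ring
    · rw [h2]; ring
  intro n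
  induction n with
  | zero =>
    have h0 : ∃ p : ℝ → ℝ, p.HasTemperateGrowth ∧
        ∀ t, hermiteOne 0 t = p t * Real.exp (-t ^ 2 / 2) :=
      ⟨fun _ => Real.pi ^ (-(1 / 4) : ℝ), by fun_prop, fun t => hermiteOne_zero t⟩
    obtain ⟨p, hp, h⟩ := h0
    exact ⟨⟨p, hp, h⟩, nxt 0 p p hp hp h (Or.inl (by simp))⟩
  | succ n ih =>
    obtain ⟨⟨q, hq, h'⟩, ⟨p, hp, h⟩⟩ := ih
    exact ⟨⟨p, hp, h⟩, nxt (n + 1) p q hp hq h (Or.inr h')⟩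

end Line

/-! ### Hermite functions as Schwartz functions -/

section Gaussian

variable {E : Type} [NormedAddCommGroup E] [InnerProductSpace ℝ E]

theorem _root_.Function.HasTemperateGrowth.fderiv' {F : Type} [NormedAddCommGroup F]
    [NormedSpace ℝ F] {p : E → F} (hp : p.HasTemperateGrowth) :
    (fun x => fderiv ℝ p x).HasTemperateGrowth := by
  refine ⟨hp.1.fderiv_right (by simp), fun n => ?_⟩
  obtain ⟨k, C, h⟩ := hp.2 (n + 1)
  refine ⟨k, C, fun x => ?_⟩
  rw [norm_iteratedFDeriv_fderiv]
  exact h x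

theorem exists_one_add_norm_pow_mul_exp_le {E : Type} [NormedAddCommGroup E] (k : ℕ) :
    ∃ C : ℝ, ∀ x : E, (1 + ‖x‖) ^ k * Real.exp (-‖x‖ ^ 2 / 2) ≤ C := by
  -- From `t^k ≤ k! e^t` with `t = 1 + ‖x‖`, and `1 + ‖x‖ - ‖x‖²/2 ≤ 3/2`.
  refine ⟨k.factorial * Real.exp (3 / 2), fun x => ?_⟩
  have h1 := Real.pow_div_factorial_le_exp (1 + ‖x‖) (by positivity) k
  have hk : (0 : ℝ) < k.factorial := by positivity
  rw [div_le_iff₀ hk] at h1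
  calc (1 + ‖x‖) ^ k * Real.exp (-‖x‖ ^ 2 / 2)
      ≤ (Real.exp (1 + ‖x‖) * k.factorial) * Real.exp (-‖x‖ ^ 2 / 2) := by gcongr
    _ = k.factorial * Real.exp (1 + ‖x‖ + -‖x‖ ^ 2 / 2) := by
      rw [Real.exp_add (1 + ‖x‖)]; ring
    _ ≤ _ := by
      gcongr
      nlinarith [sq_nonneg (‖x‖ - 1)]

/-- The derivative of `e^(-‖x‖²/2) p` is `e^(-‖x‖²/2) (p' - ⟨x,·⟩ p)`, of the same form with values
in `E →L[ℝ] F`. Hence `F` and `p` must vary in the induction. -/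
theorem decay_smul_gauss (n : ℕ) : ∀ {F : Type} [NormedAddCommGroup F] [NormedSpace ℝ F]
    (p : E → F), p.HasTemperateGrowth → ∀ k : ℕ, ∃ C : ℝ, ∀ x : E,
      ‖x‖ ^ k * ‖iteratedFDeriv ℝ n (fun y => Real.exp (-‖y‖ ^ 2 / 2) • p y) x‖ ≤ C := by
  induction n with
  | zero =>
    intro F _ _ p hp k
    obtain ⟨m, C, h⟩ := hp.2 0
    obtain ⟨C', h'⟩ := exists_one_add_norm_pow_mul_exp_le (E := E) (k + m)
    have hC : 0 ≤ C := by
      have := (norm_nonneg _).trans (h 0)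
      simpa using this
    refine ⟨C * C', fun x => ?_⟩
    have h1 := h x
    rw [norm_iteratedFDeriv_zero] at h1 ⊢
    rw [norm_smul, Real.norm_of_nonneg (Real.exp_pos _).le]
    calc ‖x‖ ^ k * (Real.exp (-‖x‖ ^ 2 / 2) * ‖p x‖)
        ≤ (1 + ‖x‖) ^ k * (Real.exp (-‖x‖ ^ 2 / 2) * (C * (1 + ‖x‖) ^ m)) := by
          gcongr; linarith
      _ = C * ((1 + ‖x‖) ^ (k + m) * Real.exp (-‖x‖ ^ 2 / 2)) := by rw [pow_add]; ring
      _ ≤ _ := by gcongr; exact h' x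
  | succ n ih =>
    intro F _ _ p hp k
    have hq : (fun x => fderiv ℝ p x - (innerSL ℝ x).smulRight (p x)).HasTemperateGrowth := by
      refine hp.fderiv'.sub ?_
      exact (ContinuousLinearMap.smulRightL ℝ E F).bilinear_hasTemperateGrowth
        (innerSL ℝ (E := E)).hasTemperateGrowth hp
    obtain ⟨C, h⟩ := ih _ hq k
    refine ⟨C, fun x => ?_⟩
    rw [← norm_iteratedFDeriv_fderiv]
    have hd : fderiv ℝ (fun y => Real.exp (-‖y‖ ^ 2 / 2) • p y) = fun x =>
        Real.exp (-‖x‖ ^ 2 / 2) • (fderiv ℝ p x - (innerSL ℝ x).smulRight (p x)) := by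
      funext x
      have h1 : HasFDerivAt (fun y : E => Real.exp (-‖y‖ ^ 2 / 2))
          (-(Real.exp (-‖x‖ ^ 2 / 2)) • innerSL ℝ x) x := by
        have h2 := ((((hasStrictFDerivAt_norm_sq x).hasFDerivAt).const_mul (-(1 / 2) : ℝ))).exp
        refine (h2.congr_of_eventuallyEq (Filter.Eventually.of_forall fun y => ?_)).congr_fderiv ?_
        · change _ = Real.exp _
          congr 1; ring
        · ext v
          simp
          rw [show -(2⁻¹ * ‖x‖ ^ 2) = -‖x‖ ^ 2 / 2 by ring]
          simp
      have h3 := (hp.1.differentiable (by simp) x).hasFDerivAt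
      refine (h1.smul h3).fderiv.trans ?_
      ext v
      simp [smul_smul, sub_eq_add_neg]
    rw [hd]
    exact h x

end Gaussian

/-! ### Hermite functions in several variables and their ladder operators. -/

section HermiteSchwartz

variable {ι : Type} [Fintype ι]

theorem exists_hermiteFun_eq (γ : ι → ℕ) : ∃ p : EuclideanSpace ℝ ι → ℂ, p.HasTemperateGrowth ∧
    ∀ x, (hermiteFun γ x : ℂ) = Real.exp (-‖x‖ ^ 2 / 2) • p x := by
  choose p hp h using fun i => exists_hermiteOne_eq (γ i)
  have hq : ∀ s : Finset ι, Function.HasTemperateGrowth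
      (fun x : EuclideanSpace ℝ ι => ∏ i ∈ s, p i (x i)) := by
    classical
    intro s
    induction s using Finset.induction_on with
    | empty => simp only [Finset.prod_empty]; fun_prop
    | insert i s hi ih =>
      simp only [Finset.prod_insert hi]
      exact ((hp i).comp (EuclideanSpace.proj (𝕜 := ℝ) i).hasTemperateGrowth).mul ih
  refine ⟨fun x => ((∏ i, p i (x i) : ℝ) : ℂ),
    Function.Complex.hasTemperateGrowth_ofReal.comp (hq Finset.univ), fun x => ?_⟩
  rw [hermiteFun, Finset.prod_congr rfl fun i _ => h i (x i), Finset.prod_mul_distrib,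
    ← Real.exp_sum, EuclideanSpace.real_norm_sq_eq, Complex.real_smul, ← Complex.ofReal_mul,
    mul_comm, ← Finset.sum_div, Finset.sum_neg_distrib]

/-- The Hermite function `h_γ`, as a Schwartz function. -/
def hermite (γ : ι → ℕ) : 𝓢(EuclideanSpace ℝ ι, ℂ) where
  toFun := fun x => (hermiteFun γ x : ℂ)
  smooth' := by
    obtain ⟨p, hp, h⟩ := exists_hermiteFun_eq γ
    simp_rw [h]
    exact (((contDiff_norm_sq ℝ).neg.div_const 2).exp).smul hp.1
  decay' := by
    intro k n
    obtain ⟨p, hp, h⟩ := exists_hermiteFun_eq γ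
    simp_rw [h]
    exact decay_smul_gauss n p hp k

theorem hermite_apply (γ : ι → ℕ) (x : EuclideanSpace ℝ ι) :
    hermite γ x = (hermiteFun γ x : ℂ) := rfl

/-- The multiplication operator `f ↦ x_i f`. -/
def posOp (i : ι) : 𝓢(EuclideanSpace ℝ ι, ℂ) →L[ℂ] 𝓢(EuclideanSpace ℝ ι, ℂ) :=
  SchwartzMap.smulLeftCLM ℂ fun x => (x i : ℂ)

theorem posOp_apply (i : ι) (f : 𝓢(EuclideanSpace ℝ ι, ℂ)) (x : EuclideanSpace ℝ ι) :
    posOp i f x = x i * f x :=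
  SchwartzMap.smulLeftCLM_apply_apply (Function.Complex.hasTemperateGrowth_ofReal.comp
    (EuclideanSpace.proj (𝕜 := ℝ) i).hasTemperateGrowth) f x

theorem hermiteFun_eq_mul [DecidableEq ι] (i : ι) (γ : ι → ℕ) (x : EuclideanSpace ℝ ι) :
    hermiteFun γ x =
      hermiteOne (γ i) (x i) * ∏ j ∈ Finset.univ.erase i, hermiteOne (γ j) (x j) :=
  (Finset.mul_prod_erase _ _ (Finset.mem_univ i)).symm

theorem hermiteFun_update [DecidableEq ι] (i : ι) {γ δ : ι → ℕ} (h : ∀ j ≠ i, δ j = γ j)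
    (x : EuclideanSpace ℝ ι) : hermiteFun δ x =
      hermiteOne (δ i) (x i) * ∏ j ∈ Finset.univ.erase i, hermiteOne (γ j) (x j) := by
  rw [hermiteFun_eq_mul i]
  congr 1
  exact Finset.prod_congr rfl fun j hj => by rw [h j (Finset.ne_of_mem_erase hj)]

variable [DecidableEq ι]

theorem posOp_hermite (i : ι) (γ : ι → ℕ) : posOp i (hermite γ) =
    ((√(γ i + 1) / √2 : ℝ) : ℂ) • hermite (γ + Pi.single i 1) +
      ((√(γ i) / √2 : ℝ) : ℂ) • hermite (γ - Pi.single i 1) := by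
  ext x
  simp only [posOp_apply, add_apply, smul_apply, smul_eq_mul, hermite_apply]
  rw [hermiteFun_eq_mul i,
    hermiteFun_update i (γ := γ) (δ := γ + Pi.single i 1) fun j hj => by simp [hj],
    hermiteFun_update i (γ := γ) (δ := γ - Pi.single i 1) fun j hj => by simp [hj]]
  have h := mul_hermiteOne (γ i) (x i)
  simp only [Pi.add_apply, Pi.sub_apply, Pi.single_eq_same]
  norm_cast
  push_cast
  rw [← mul_assoc, h]
  ring

theorem pderiv_hermite (i : ι) (γ : ι → ℕ) : pderiv i (hermite γ) =
    ((√(γ i) / √2 : ℝ) : ℂ) • hermite (γ - Pi.single i 1) -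
      ((√(γ i + 1) / √2 : ℝ) : ℂ) • hermite (γ + Pi.single i 1) := by
  ext x
  simp only [pderiv_apply, sub_apply, smul_apply, smul_eq_mul, hermite_apply]
  have h1 := ((hermite γ).differentiableAt (x := x)).hasFDerivAt.hasLineDerivAt
    (EuclideanSpace.basisFun ι ℝ i)
  unfold HasLineDerivAt at h1
  have h2 : (fun t : ℝ => hermite γ (x + t • EuclideanSpace.basisFun ι ℝ i)) = fun t =>
      ((hermiteOne (γ i) (x i + t) *
        ∏ j ∈ Finset.univ.erase i, hermiteOne (γ j) (x j) : ℝ) : ℂ) := by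
    funext t
    rw [hermite_apply, hermiteFun_eq_mul i]
    congr 2
    · simp
    · refine Finset.prod_congr rfl fun j hj => ?_
      simp [Finset.ne_of_mem_erase hj]
  rw [h2] at h1
  have h3 := (((hasDerivAt_hermiteOne (γ i) (x i + 0)).comp_const_add (x i) 0).mul_const
    (∏ j ∈ Finset.univ.erase i, hermiteOne (γ j) (x j))).ofReal_comp
  rw [h1.unique h3,
    hermiteFun_update i (γ := γ) (δ := γ + Pi.single i 1) fun j hj => by simp [hj],
    hermiteFun_update i (γ := γ) (δ := γ - Pi.single i 1) fun j hj => by simp [hj]]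
  simp only [Pi.add_apply, Pi.sub_apply, Pi.single_eq_same, add_zero]
  push_cast
  ring

/-- The annihilation operator `x_i + ∂_i`. -/
def annOp (i : ι) : 𝓢(EuclideanSpace ℝ ι, ℂ) →L[ℂ] 𝓢(EuclideanSpace ℝ ι, ℂ) :=
  posOp i + pderiv i

/-- The creation operator `x_i - ∂_i`. -/
def creOp (i : ι) : 𝓢(EuclideanSpace ℝ ι, ℂ) →L[ℂ] 𝓢(EuclideanSpace ℝ ι, ℂ) :=
  posOp i - pderiv i

theorem annOp_hermite (i : ι) (γ : ι → ℕ) :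
    annOp i (hermite γ) = ((√2 * √(γ i) : ℝ) : ℂ) • hermite (γ - Pi.single i 1) := by
  have h2 : ((√2 * √(γ i) : ℝ) : ℂ) = ((√(γ i) / √2 : ℝ) : ℂ) + ((√(γ i) / √2 : ℝ) : ℂ) := by
    norm_cast
    have hs : √2 * √2 = (2 : ℝ) := Real.mul_self_sqrt (by norm_num)
    field_simp
    linear_combination √(γ i) * hs
  rw [annOp, add_apply, posOp_hermite, pderiv_hermite, h2, add_smul]
  abel

theorem creOp_hermite (i : ι) (γ : ι → ℕ) :
    creOp i (hermite γ) = ((√2 * √(γ i + 1) : ℝ) : ℂ) • hermite (γ + Pi.single i 1) := by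
  have h2 : ((√2 * √(γ i + 1) : ℝ) : ℂ) =
      ((√(γ i + 1) / √2 : ℝ) : ℂ) + ((√(γ i + 1) / √2 : ℝ) : ℂ) := by
    norm_cast
    have hs : √2 * √2 = (2 : ℝ) := Real.mul_self_sqrt (by norm_num)
    field_simp
    linear_combination hs
  rw [creOp, sub_apply, posOp_hermite, pderiv_hermite, h2, add_smul]
  abel

omit [Fintype ι] in
theorem sub_single_add_single (i : ι) {γ : ι → ℕ} (h : γ i ≠ 0) :
    γ - Pi.single i 1 + Pi.single i 1 = γ := by
  funext j
  by_cases hj : j = i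
  · subst hj
    simp
    omega
  · simp [hj]

/-- Lowering and then raising multiplies by `√(2γ_i)` twice. These eigenvalues tell the indices
apart, which gives orthogonality, and they sum to those of the number operator. -/
theorem creOp_annOp_hermite (i : ι) (γ : ι → ℕ) :
    creOp i (annOp i (hermite γ)) = (2 * γ i : ℂ) • hermite γ := by
  rw [annOp_hermite, map_smul]
  by_cases h : γ i = 0
  · simp [h]
  · rw [creOp_hermite, sub_single_add_single i h, smul_smul]
    congr 1
    have h1 : (((γ - Pi.single i 1 : ι → ℕ) i : ℝ) + 1) = γ i := by
      have : (γ - Pi.single i 1 : ι → ℕ) i + 1 = γ i := by simp; omega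
      exact_mod_cast this
    rw [h1, ← Complex.ofReal_mul]
    have h2 : √2 * √2 = (2 : ℝ) := Real.mul_self_sqrt (by norm_num)
    have h3 : √(γ i) * √(γ i) = (γ i : ℝ) := Real.mul_self_sqrt (by positivity)
    have : √2 * √(γ i) * (√2 * √(γ i)) = 2 * (γ i : ℝ) := by
      linear_combination (√(γ i) * √(γ i)) * h2 + 2 * h3
    rw [this]
    push_cast
    ring

end HermiteSchwartz

/-! ### The bilinear pairing and orthonormality -/

section Pair

variable {ι : Type} [Fintype ι]

/-- The bilinear pairing `∫ g f`, as a continuous linear form in `f`. -/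
def pair (g : 𝓢(EuclideanSpace ℝ ι, ℂ)) : 𝓢(EuclideanSpace ℝ ι, ℂ) →L[ℂ] ℂ :=
  (SchwartzMap.integralCLM ℂ MeasureTheory.volume).comp
    (SchwartzMap.pairing (ContinuousLinearMap.mul ℂ ℂ) g)

theorem pair_apply (g f : 𝓢(EuclideanSpace ℝ ι, ℂ)) : pair g f = ∫ x, g x * f x := rfl

theorem pair_comm (g f : 𝓢(EuclideanSpace ℝ ι, ℂ)) : pair g f = pair f g := by
  simp only [pair_apply, mul_comm]

theorem pair_posOp (i : ι) (g f : 𝓢(EuclideanSpace ℝ ι, ℂ)) :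
    pair (posOp i g) f = pair g (posOp i f) := by
  simp only [pair_apply, posOp_apply]
  congr 1
  funext x
  ring

theorem pair_pderiv (i : ι) (g f : 𝓢(EuclideanSpace ℝ ι, ℂ)) :
    pair (pderiv i g) f = -pair g (pderiv i f) := by
  have := SchwartzMap.integral_mul_lineDerivOp_right_eq_neg_left (μ := MeasureTheory.volume) g f
    (EuclideanSpace.basisFun ι ℝ i)
  rw [pair_apply, pair_apply]
  exact (neg_eq_iff_eq_neg.2 this).symm

theorem pair_creOp (i : ι) (g f : 𝓢(EuclideanSpace ℝ ι, ℂ)) :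
    pair (creOp i g) f = pair g (annOp i f) := by
  rw [pair_comm, creOp, annOp, sub_apply, add_apply, map_sub, map_add, pair_comm, pair_posOp,
    pair_comm f, pair_pderiv, sub_neg_eq_add]

theorem pair_annOp (i : ι) (g f : 𝓢(EuclideanSpace ℝ ι, ℂ)) :
    pair (annOp i g) f = pair g (creOp i f) := by
  rw [pair_comm, ← pair_creOp, pair_comm]

variable [DecidableEq ι]

/-- If `γ` and `δ` differ in coordinate `i`, the two Hermite functions are eigenvectors of `creOp i
∘ annOp i`, symmetric for the pairing, with distinct eigenvalues `2γ_i` and `2δ_i`. -/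
theorem pair_hermite_of_ne {γ δ : ι → ℕ} (h : γ ≠ δ) : pair (hermite γ) (hermite δ) = 0 := by
  obtain ⟨i, hi⟩ := Function.ne_iff.1 h
  have h1 : pair (creOp i (annOp i (hermite γ))) (hermite δ) =
      pair (hermite γ) (creOp i (annOp i (hermite δ))) := by
    rw [pair_creOp, pair_annOp]
  rw [creOp_annOp_hermite, creOp_annOp_hermite, pair_comm, map_smul, map_smul, pair_comm,
    smul_eq_mul, smul_eq_mul, ← sub_eq_zero, ← sub_mul, mul_eq_zero] at h1
  refine h1.resolve_left ?_
  rw [← mul_sub, mul_eq_zero, sub_eq_zero]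
  push Not
  exact ⟨two_ne_zero, by exact_mod_cast hi⟩

omit [DecidableEq ι] in
theorem pair_hermite_zero : pair (hermite (0 : ι → ℕ)) (hermite 0) = 1 := by
  rw [pair_apply]
  have h1 : ∀ x : EuclideanSpace ℝ ι, hermite (0 : ι → ℕ) x * hermite 0 x =
      ((Real.pi ^ (-(1 / 2) * Fintype.card ι : ℝ) * Real.exp (-1 * ‖x‖ ^ 2) : ℝ) : ℂ) := by
    intro x
    rw [hermite_apply, ← Complex.ofReal_mul, hermiteFun, ← Finset.prod_mul_distrib]
    congr 1
    have h2 : ∀ i, hermiteOne ((0 : ι → ℕ) i) (x i) * hermiteOne ((0 : ι → ℕ) i) (x i) =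
        Real.pi ^ (-(1 / 2) : ℝ) * Real.exp (-(x i) ^ 2) := fun i => by
      rw [Pi.zero_apply, hermiteOne_zero, mul_mul_mul_comm, ← Real.rpow_add Real.pi_pos,
        ← Real.exp_add]
      congr 2
      · norm_num
      · ring
    rw [Finset.prod_congr rfl fun i _ => h2 i, Finset.prod_mul_distrib, ← Real.exp_sum,
      Finset.sum_neg_distrib, ← EuclideanSpace.real_norm_sq_eq, Finset.prod_const,
      ← Real.rpow_mul_natCast Real.pi_pos.le, Finset.card_univ, neg_one_mul]
  simp_rw [h1]
  rw [integral_complex_ofReal, MeasureTheory.integral_const_mul,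
    GaussianFourier.integral_rexp_neg_mul_sq_norm one_pos, div_one, ← Real.rpow_add Real.pi_pos,
    finrank_euclideanSpace]
  rw [show (-(1 / 2) * Fintype.card ι + Fintype.card ι / 2 : ℝ) = 0 by ring]
  simp

/-- Moving a creation operator across the pairing turns it into an annihilation operator; both
produce the same nonzero factor `√2 √(γ_i + 1)`, so the norm is unchanged from `γ` to `γ + e_i`. -/
theorem pair_hermite_self (γ : ι → ℕ) : pair (hermite γ) (hermite γ) = 1 := by
  induction γ using multiIndex_induction with
  | h0 => exact pair_hermite_zero
  | hs i γ ih =>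
    rw [add_comm]
    have h1 := pair_creOp i (hermite γ) (hermite (γ + Pi.single i 1))
    have h2 : (γ + Pi.single i 1 : ι → ℕ) - Pi.single i 1 = γ := by
      funext j; simp
    have h3 : ((γ + Pi.single i 1 : ι → ℕ) i : ℝ) = γ i + 1 := by simp
    rw [creOp_hermite, annOp_hermite, h2, h3, pair_comm, map_smul, map_smul, ih] at h1
    refine smul_right_injective _ ?_ h1
    rw [Complex.ofReal_ne_zero]
    positivity

theorem pair_hermite (γ δ : ι → ℕ) :
    pair (hermite γ) (hermite δ) = if γ = δ then 1 else 0 := by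
  split_ifs with h
  · rw [h, pair_hermite_self]
  · exact pair_hermite_of_ne h

end Pair

/-! ### Uniform bounds for Hermite functions -/

section SupBound

theorem continuous_hermiteOne (n : ℕ) : Continuous (hermiteOne n) :=
  continuous_iff_continuousAt.2 fun t => (hasDerivAt_hermiteOne n t).continuousAt

theorem integral_hermiteOne_sq (n : ℕ) : ∫ t, hermiteOne n t * hermiteOne n t = 1 := by
  have h1 := pair_hermite_self (ι := Unit) fun _ => n
  have h2 : ∀ x : EuclideanSpace ℝ Unit, hermite (fun _ => n) x * hermite (fun _ => n) x =
      ((∏ i, hermiteOne n (WithLp.ofLp x i) * hermiteOne n (WithLp.ofLp x i) : ℝ) : ℂ) := by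
    intro x
    rw [hermite_apply, ← Complex.ofReal_mul, hermiteFun, ← Finset.prod_mul_distrib]
  rw [pair_apply] at h1
  simp_rw [h2] at h1
  rw [integral_complex_ofReal, (PiLp.volume_preserving_ofLp Unit).integral_comp
    (MeasurableEquiv.toLp 2 (Unit → ℝ)).symm.measurableEmbedding
    (fun y : Unit → ℝ => ∏ i, hermiteOne n (y i) * hermiteOne n (y i)),
    MeasureTheory.integral_fintype_prod_volume_eq_prod
      (fun (_ : Unit) t => hermiteOne n t * hermiteOne n t)] at h1
  simpa using h1

/-- The integral of a non-integrable function is 0 by convention, whereas this one is 1. -/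
theorem integrable_hermiteOne_sq (n : ℕ) :
    MeasureTheory.Integrable fun t => hermiteOne n t * hermiteOne n t := by
  by_contra h
  have := integral_hermiteOne_sq n
  rw [MeasureTheory.integral_undef h] at this
  exact zero_ne_one this

/-- Write `h_n²(t)` as the integral of its derivative over `(-∞, t]` and use `2 |h_n h_n'| ≤ h_n² +
h_n'²`. As `h_n'` combines `h_(n-1)` and `h_(n+1)`, the integral of the majorant is `1 + n + (n +
1)` by normalization. -/
theorem hermiteOne_sq_le (n : ℕ) (t : ℝ) : hermiteOne n t ^ 2 ≤ 2 * (n + 1) := by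
  set f : ℝ → ℝ := fun u => hermiteOne n u * hermiteOne n u
  set d : ℝ → ℝ := fun u =>
    (√n * hermiteOne (n - 1) u - √(n + 1) * hermiteOne (n + 1) u) / √2
  set f' : ℝ → ℝ := fun u => d u * hermiteOne n u + hermiteOne n u * d u
  set g : ℝ → ℝ := fun u => hermiteOne n u * hermiteOne n u +
    (n * (hermiteOne (n - 1) u * hermiteOne (n - 1) u) +
      (n + 1) * (hermiteOne (n + 1) u * hermiteOne (n + 1) u))
  have hd : ∀ u, HasDerivAt f (f' u) u := fun u =>
    (hasDerivAt_hermiteOne n u).mul (hasDerivAt_hermiteOne n u)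
  have hg : MeasureTheory.Integrable g :=
    (integrable_hermiteOne_sq n).add (((integrable_hermiteOne_sq (n - 1)).const_mul _).add
      ((integrable_hermiteOne_sq (n + 1)).const_mul _))
  have hle : ∀ u, ‖f' u‖ ≤ g u := by
    intro u
    have hs : √2 * √2 = (2 : ℝ) := Real.mul_self_sqrt (by norm_num)
    have hn : √n * √n = (n : ℝ) := Real.mul_self_sqrt (by positivity)
    have hn1 : √(n + 1) * √(n + 1) = (n + 1 : ℝ) := Real.mul_self_sqrt (by positivity)
    have hd2 : d u * d u ≤ n * (hermiteOne (n - 1) u * hermiteOne (n - 1) u) +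
        (n + 1) * (hermiteOne (n + 1) u * hermiteOne (n + 1) u) := by
      simp only [d]
      rw [div_mul_div_comm, hs, div_le_iff₀ (by norm_num)]
      nlinarith [sq_nonneg (√n * hermiteOne (n - 1) u + √(n + 1) * hermiteOne (n + 1) u)]
    rw [Real.norm_eq_abs, abs_le]
    simp only [f', g]
    constructor
    · nlinarith [sq_nonneg (d u + hermiteOne n u)]
    · nlinarith [sq_nonneg (d u - hermiteOne n u)]
  have hc : Continuous f' := by
    have := continuous_hermiteOne
    simp only [f', d]
    fun_prop
  have hf' : MeasureTheory.Integrable f' :=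
    hg.mono' hc.aestronglyMeasurable (Filter.Eventually.of_forall hle)
  have h0 : Filter.Tendsto f Filter.atBot (nhds 0) :=
    MeasureTheory.tendsto_zero_of_hasDerivAt_of_integrableOn_Iic (a := t) (fun x _ => hd x)
      hf'.integrableOn (integrable_hermiteOne_sq n).integrableOn
  have h1 := MeasureTheory.integral_Iic_of_hasDerivAt_of_tendsto (a := t)
    (hd t).continuousAt.continuousWithinAt (fun x _ => hd x) hf'.integrableOn h0
  rw [sub_zero] at h1
  have hgi : ∫ u, g u = 2 * (n + 1) := by
    simp only [g]
    have i1 := (integrable_hermiteOne_sq (n - 1)).const_mul (n : ℝ)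
    have i2 := (integrable_hermiteOne_sq (n + 1)).const_mul (n + 1 : ℝ)
    refine (MeasureTheory.integral_add (integrable_hermiteOne_sq n) (i1.add i2)).trans ?_
    refine (congrArg _ (MeasureTheory.integral_add i1 i2)).trans ?_
    rw [MeasureTheory.integral_const_mul, MeasureTheory.integral_const_mul, integral_hermiteOne_sq,
      integral_hermiteOne_sq, integral_hermiteOne_sq]
    ring
  calc hermiteOne n t ^ 2 = ∫ u in Set.Iic t, f' u := by rw [h1, pow_two]
    _ ≤ ∫ u in Set.Iic t, g u := MeasureTheory.integral_mono hf'.integrableOn hg.integrableOn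
        fun u => (le_abs_self _).trans (hle u)
    _ ≤ ∫ u, g u := MeasureTheory.setIntegral_le_integral hg
        (Filter.Eventually.of_forall fun u => (norm_nonneg _).trans (hle u))
    _ = _ := hgi

theorem abs_hermiteOne_le (n : ℕ) (t : ℝ) : |hermiteOne n t| ≤ 2 * (n + 1) := by
  refine abs_le_of_sq_le_sq (a := hermiteOne n t) ?_ (by positivity)
  nlinarith [hermiteOne_sq_le n t, (Nat.cast_nonneg n : (0 : ℝ) ≤ n)]

variable {ι : Type} [Fintype ι]

theorem le_order (γ : ι → ℕ) (i : ι) : γ i ≤ order γ :=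
  Finset.single_le_sum (f := γ) (fun _ _ => Nat.zero_le _) (Finset.mem_univ i)

theorem norm_hermite_le (γ : ι → ℕ) (x : EuclideanSpace ℝ ι) :
    ‖hermite γ x‖ ≤ (2 * (order γ + 1)) ^ Fintype.card ι := by
  rw [hermite_apply, Complex.norm_real, Real.norm_eq_abs, hermiteFun, Finset.abs_prod]
  refine (Finset.prod_le_prod (fun i _ => abs_nonneg _) fun i _ =>
    (abs_hermiteOne_le (γ i) (x i)).trans ?_).trans_eq
    ((Finset.prod_const _).trans (by rw [Finset.card_univ]))
  have : (γ i : ℝ) ≤ order γ := by exact_mod_cast le_order γ i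
  linarith

theorem summable_one_add_order_pow :
    ∃ M : ℕ, Summable fun γ : ι → ℕ => ((1 + (order γ : ℝ)) ^ M)⁻¹ := by
  have h1 : Summable fun n : ℕ => ((1 + (n : ℝ)) ^ 2)⁻¹ := by
    have := (summable_nat_add_iff 1).2 (Real.summable_nat_pow_inv.2 one_lt_two)
    refine this.congr fun n => ?_
    push_cast
    rw [add_comm]
  refine ⟨2 * Fintype.card ι, ?_⟩
  have h2 : ∀ γ : ι → ℕ, ((1 + (order γ : ℝ)) ^ (2 * Fintype.card ι))⁻¹ ≤
      ∏ i, ((1 + (γ i : ℝ)) ^ 2)⁻¹ := by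
    intro γ
    rw [pow_mul, ← inv_pow, ← Finset.card_univ, ← Finset.prod_const]
    refine Finset.prod_le_prod (fun i _ => by positivity) fun i _ => ?_
    have : (γ i : ℝ) ≤ order γ := by exact_mod_cast le_order γ i
    gcongr
  refine Summable.of_nonneg_of_le (fun γ => by positivity) h2 ?_
  refine summable_of_sum_le (c := (∑' n : ℕ, ((1 + (n : ℝ)) ^ 2)⁻¹) ^ Fintype.card ι)
    (fun γ => by positivity) fun u => ?_
  classical
  set t : ι → Finset ℕ := fun i => u.image fun γ => γ i
  have hu : u ⊆ Fintype.piFinset t := fun γ hγ =>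
    Fintype.mem_piFinset.2 fun i => Finset.mem_image_of_mem _ hγ
  calc ∑ γ ∈ u, ∏ i, ((1 + (γ i : ℝ)) ^ 2)⁻¹
      ≤ ∑ γ ∈ Fintype.piFinset t, ∏ i, ((1 + (γ i : ℝ)) ^ 2)⁻¹ :=
        Finset.sum_le_sum_of_subset_of_nonneg hu fun _ _ _ => by positivity
    _ = ∏ i, ∑ n ∈ t i, ((1 + (n : ℝ)) ^ 2)⁻¹ :=
        (Finset.prod_univ_sum t fun _ n => ((1 + (n : ℝ)) ^ 2)⁻¹).symm
    _ ≤ ∏ _i : ι, ∑' n : ℕ, ((1 + (n : ℝ)) ^ 2)⁻¹ :=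
        Finset.prod_le_prod (fun i _ => Finset.sum_nonneg fun _ _ => by positivity)
          fun i _ => h1.sum_le_tsum _ fun _ _ => by positivity
    _ = _ := by rw [Finset.prod_const, Finset.card_univ]

end SupBound

/-! ### Words in the position and derivative operators -/

section Words

variable {ι : Type} [Fintype ι]

/-- `IsWord n W` says that `W` is a product of `n` operators `f ↦ x_i f` and `f ↦ ∂_i f`. -/
inductive IsWord : ℕ → (𝓢(EuclideanSpace ℝ ι, ℂ) →L[ℂ] 𝓢(EuclideanSpace ℝ ι, ℂ)) → Prop
  | one : IsWord 0 1
  | mul_posOp {n : ℕ} {W : 𝓢(EuclideanSpace ℝ ι, ℂ) →L[ℂ] 𝓢(EuclideanSpace ℝ ι, ℂ)} (i : ι) :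
      IsWord n W → IsWord (n + 1) (W * posOp i)
  | mul_pderiv {n : ℕ} {W : 𝓢(EuclideanSpace ℝ ι, ℂ) →L[ℂ] 𝓢(EuclideanSpace ℝ ι, ℂ)} (i : ι) :
      IsWord n W → IsWord (n + 1) (W * pderiv i)

theorem IsWord.mul {m n : ℕ} {V W : 𝓢(EuclideanSpace ℝ ι, ℂ) →L[ℂ] 𝓢(EuclideanSpace ℝ ι, ℂ)}
    (hV : IsWord m V) (hW : IsWord n W) : IsWord (m + n) (V * W) := by
  induction hW with
  | one => simpa using hV
  | mul_posOp i _ ih => rw [← mul_assoc]; exact ih.mul_posOp i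
  | mul_pderiv i _ ih => rw [← mul_assoc]; exact ih.mul_pderiv i

theorem order_add (α β : ι → ℕ) : order (α + β) = order α + order β := Finset.sum_add_distrib

theorem order_single [DecidableEq ι] (i : ι) : order (Pi.single i 1 : ι → ℕ) = 1 := by
  simp [order]

theorem monomial_add (α β : ι → ℕ) (x : EuclideanSpace ℝ ι) :
    monomial (α + β) x = monomial α x * monomial β x := by
  simp [monomial, pow_add, Finset.prod_mul_distrib]

theorem monomial_single [DecidableEq ι] (i : ι) (x : EuclideanSpace ℝ ι) :
    monomial (Pi.single i 1 : ι → ℕ) x = x i := by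
  rw [monomial, Finset.prod_eq_single i]
  · simp
  · intro j _ hj
    simp [hj]
  · simp

theorem isWord_mderiv (α : ι → ℕ) : IsWord (order α) (mderiv α) := by
  classical
  induction α using multiIndex_induction with
  | h0 => simpa [order] using IsWord.one
  | hs i α ih =>
    rw [mderiv_add, order_add, mderiv_single, order_single]
    have := (IsWord.one (ι := ι)).mul_pderiv i
    rw [one_mul] at this
    exact this.mul ih

theorem exists_isWord_monomial (β : ι → ℕ) :
    ∃ V : 𝓢(EuclideanSpace ℝ ι, ℂ) →L[ℂ] 𝓢(EuclideanSpace ℝ ι, ℂ), IsWord (order β) V ∧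
      ∀ f x, V f x = monomial β x * f x := by
  classical
  induction β using multiIndex_induction with
  | h0 => exact ⟨1, by simpa [order] using IsWord.one, by simp [monomial]⟩
  | hs i β ih =>
    obtain ⟨V, hV, h⟩ := ih
    have := (IsWord.one (ι := ι)).mul_posOp i
    rw [one_mul] at this
    refine ⟨posOp i * V, ?_, fun f x => ?_⟩
    · rw [order_add, order_single]
      exact this.mul hV
    · change posOp i (V f) x = _
      rw [posOp_apply, h, monomial_add, monomial_single]
      push_cast
      ring

theorem exists_isWord_monomial_mderiv (α β : ι → ℕ) :
    ∃ V : 𝓢(EuclideanSpace ℝ ι, ℂ) →L[ℂ] 𝓢(EuclideanSpace ℝ ι, ℂ), IsWord (order α + order β) V ∧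
      ∀ f x, V f x = monomial β x * mderiv α f x := by
  obtain ⟨V, hV, h⟩ := exists_isWord_monomial β
  refine ⟨V * mderiv α, ?_, fun f x => h (mderiv α f) x⟩
  rw [add_comm]
  exact hV.mul (isWord_mderiv α)

/-- A bound for words of length `n` applied to Hermite functions of order `g` on `ℝ^d`. -/
def hermiteBound (d n g : ℕ) : ℝ := 2 ^ n * √(g + n) ^ n * (2 * (g + n + 1)) ^ d

theorem hermiteBound_mono (d n : ℕ) {g g' : ℕ} (h : g ≤ g') :
    hermiteBound d n g ≤ hermiteBound d n g' := by
  unfold hermiteBound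
  have : (g : ℝ) ≤ g' := by exact_mod_cast h
  gcongr

/-- Peeling one letter off a word replaces `h_γ` by two Hermite functions of order at most `g + 1`,
with factors at most `√(g + 1)`. The bound absorbs this because it depends on `g + n` otherwise, and
`(g + 1) + n = g + (n + 1)`. -/
theorem hermiteBound_succ_le (d n g : ℕ) :
    2 * (√(g + 1) * hermiteBound d n (g + 1)) ≤ hermiteBound d (n + 1) g := by
  unfold hermiteBound
  have h : √((g : ℝ) + 1) ≤ √(g + (n + 1)) :=
    Real.sqrt_le_sqrt (by linarith [(Nat.cast_nonneg n : (0 : ℝ) ≤ n)])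
  push_cast
  calc 2 * (√((g : ℝ) + 1) * (2 ^ n * √((g : ℝ) + 1 + n) ^ n * (2 * ((g : ℝ) + 1 + n + 1)) ^ d))
      = 2 ^ (n + 1) * (√((g : ℝ) + (n + 1)) ^ n * √((g : ℝ) + 1)) *
          (2 * ((g : ℝ) + (n + 1) + 1)) ^ d := by
        rw [pow_succ, show (g : ℝ) + 1 + n = g + (n + 1) by ring]; ring
    _ ≤ 2 ^ (n + 1) * (√((g : ℝ) + (n + 1)) ^ n * √(g + (n + 1))) *
          (2 * ((g : ℝ) + (n + 1) + 1)) ^ d := by gcongr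
    _ = _ := by rw [← pow_succ]

theorem IsWord.norm_apply_hermite_le {n : ℕ}
    {W : 𝓢(EuclideanSpace ℝ ι, ℂ) →L[ℂ] 𝓢(EuclideanSpace ℝ ι, ℂ)} (hW : IsWord n W)
    (γ : ι → ℕ) (x : EuclideanSpace ℝ ι) :
    ‖W (hermite γ) x‖ ≤ hermiteBound (Fintype.card ι) n (order γ) := by
  classical
  induction hW generalizing γ with
  | one =>
    refine (norm_hermite_le γ x).trans_eq ?_
    simp [hermiteBound]
  | @mul_posOp n W i _ ih =>
    change ‖W (posOp i (hermite γ)) x‖ ≤ _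
    rw [posOp_hermite, map_add, map_smul, map_smul, add_apply, smul_apply, smul_apply]
    refine (norm_add_le _ _).trans (le_trans ?_ (hermiteBound_succ_le _ n _))
    exact two_smul_bound ih γ i
  | @mul_pderiv n W i _ ih =>
    change ‖W (pderiv i (hermite γ)) x‖ ≤ _
    rw [pderiv_hermite, map_sub, map_smul, map_smul, sub_apply, smul_apply, smul_apply]
    refine (norm_sub_le _ _).trans (le_trans ?_ (hermiteBound_succ_le _ n _))
    rw [add_comm]
    exact two_smul_bound ih γ i
where
  two_smul_bound [DecidableEq ι] {n : ℕ} {x : EuclideanSpace ℝ ι}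
      {W : 𝓢(EuclideanSpace ℝ ι, ℂ) →L[ℂ] 𝓢(EuclideanSpace ℝ ι, ℂ)}
      (ih : ∀ γ, ‖W (hermite γ) x‖ ≤ hermiteBound (Fintype.card ι) n (order γ)) (γ : ι → ℕ)
      (i : ι) : ‖((√(γ i + 1) / √2 : ℝ) : ℂ) • W (hermite (γ + Pi.single i 1)) x‖ +
        ‖((√(γ i) / √2 : ℝ) : ℂ) • W (hermite (γ - Pi.single i 1)) x‖ ≤
        2 * (√(order γ + 1) * hermiteBound (Fintype.card ι) n (order γ + 1)) := by
    have h2 : 1 ≤ √(2 : ℝ) := Real.one_le_sqrt.2 (by norm_num)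
    have hγ : (γ i : ℝ) ≤ order γ := by exact_mod_cast le_order γ i
    have h3 : √((γ i : ℝ) + 1) / √2 ≤ √(order γ + 1) :=
      (div_le_self (by positivity) h2).trans (Real.sqrt_le_sqrt (by linarith))
    have h4 : √(γ i : ℝ) / √2 ≤ √(order γ + 1) :=
      (div_le_self (by positivity) h2).trans (Real.sqrt_le_sqrt (by linarith))
    have h5 : order (γ + Pi.single i 1) = order γ + 1 := by rw [order_add, order_single]
    have h6 : order (γ - Pi.single i 1 : ι → ℕ) ≤ order γ + 1 :=
      (Finset.sum_le_sum fun j _ => Nat.sub_le _ _).trans (Nat.le_succ _)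
    have e1 := ih (γ + Pi.single i 1)
    have e2 := (ih (γ - Pi.single i 1)).trans (hermiteBound_mono _ n h6)
    rw [h5] at e1
    rw [norm_smul, norm_smul, Complex.norm_real, Complex.norm_real,
      Real.norm_of_nonneg (by positivity), Real.norm_of_nonneg (by positivity), two_mul]
    gcongr

/-- The Schwartz seminorms are controlled by the sup norms of words applied to the function. -/
theorem exists_pow_mul_iteratedFDeriv_le (k n : ℕ) : ∃ C : ℝ, 0 ≤ C ∧
    ∀ (f : 𝓢(EuclideanSpace ℝ ι, ℂ)) (B : ℝ),
      (∀ W, IsWord (k + n) W → ∀ x, ‖W f x‖ ≤ B) →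
        ∀ x, ‖x‖ ^ k * ‖iteratedFDeriv ℝ n f x‖ ≤ C * B := by
  induction n with
  | zero =>
    induction k with
    | zero =>
      refine ⟨1, zero_le_one, fun f B h x => ?_⟩
      have := h 1 IsWord.one x
      simpa using this
    | succ k ih =>
      obtain ⟨C, hC, ih⟩ := ih
      -- As `‖x‖ ≤ ∑ |x_i|`, one power of `‖x‖` is exchanged for one multiplication letter, at the
      -- cost of a sum over the coordinates.
      refine ⟨Fintype.card ι * C, by positivity, fun f B h x => ?_⟩
      have hx : ‖x‖ ≤ ∑ i, |x i| := by
        have h0 : x = ∑ i, x i • EuclideanSpace.basisFun ι ℝ i := by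
          simpa using ((EuclideanSpace.basisFun ι ℝ).sum_repr x).symm
        conv_lhs => rw [h0]
        refine (norm_sum_le _ _).trans_eq (Finset.sum_congr rfl fun i _ => ?_)
        rw [norm_smul, (EuclideanSpace.basisFun ι ℝ).norm_eq_one, mul_one, Real.norm_eq_abs]
      rw [norm_iteratedFDeriv_zero, pow_succ]
      calc ‖x‖ ^ k * ‖x‖ * ‖f x‖ ≤ ‖x‖ ^ k * (∑ i, |x i|) * ‖f x‖ := by gcongr
        _ = ∑ i, ‖x‖ ^ k * ‖iteratedFDeriv ℝ 0 (posOp i f) x‖ := by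
          rw [mul_assoc, Finset.sum_mul, Finset.mul_sum]
          refine Finset.sum_congr rfl fun i _ => ?_
          rw [norm_iteratedFDeriv_zero, posOp_apply, norm_mul, Complex.norm_real,
            Real.norm_eq_abs]
        _ ≤ ∑ _i : ι, C * B := Finset.sum_le_sum fun i _ => ih (posOp i f) B (fun W hW y =>
            h (W * posOp i) (hW.mul_posOp i) y) x
        _ = _ := by rw [Finset.sum_const, Finset.card_univ, nsmul_eq_mul, mul_assoc]
  | succ n ih =>
    obtain ⟨C, hC, ih⟩ := ih
    -- `L i z` is the form `z dx_i`, so that `df = ∑ L i (∂_i f)` and one order of Fréchet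
    -- derivative becomes one derivative letter.
    set L : ι → ℂ →L[ℝ] (EuclideanSpace ℝ ι →L[ℝ] ℂ) := fun i =>
      ContinuousLinearMap.smulRightL ℝ (EuclideanSpace ℝ ι) ℂ (EuclideanSpace.proj (𝕜 := ℝ) i)
      with hL
    refine ⟨∑ i, ‖L i‖ * C, by positivity, fun f B h x => ?_⟩
    have hf : fderiv ℝ f = fun y => ∑ i, L i (pderiv i f y) := by
      funext y
      ext v
      have h0 : v = ∑ i, v i • EuclideanSpace.basisFun ι ℝ i := by
        simpa using ((EuclideanSpace.basisFun ι ℝ).sum_repr v).symm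
      conv_lhs => rw [h0]
      simp [hL, pderiv_apply, map_sum]
    have hsm : ∀ i, ContDiff ℝ n fun y => L i (pderiv i f y) := fun i =>
      (L i).contDiff.comp ((pderiv i f).smooth n)
    rw [← norm_iteratedFDeriv_fderiv, hf, iteratedFDeriv_sum (fun i _ => hsm i)]
    calc ‖x‖ ^ k * ‖(∑ i, iteratedFDeriv ℝ n fun y => L i (pderiv i f y)) x‖
        ≤ ‖x‖ ^ k * ∑ i, ‖L i‖ * ‖iteratedFDeriv ℝ n (pderiv i f) x‖ := by
          gcongr
          rw [Finset.sum_apply]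
          refine (norm_sum_le _ _).trans (Finset.sum_le_sum fun i _ => ?_)
          exact (L i).norm_iteratedFDeriv_comp_left ((pderiv i f).smooth n).contDiffAt le_rfl
      _ = ∑ i, ‖L i‖ * (‖x‖ ^ k * ‖iteratedFDeriv ℝ n (pderiv i f) x‖) := by
          rw [Finset.mul_sum]
          exact Finset.sum_congr rfl fun i _ => by ring
      _ ≤ ∑ i, ‖L i‖ * (C * B) := by
          refine Finset.sum_le_sum fun i _ => mul_le_mul_of_nonneg_left ?_ (norm_nonneg (L i))
          exact ih (pderiv i f) B (fun W hW y => h (W * pderiv i) (hW.mul_pderiv i) y) x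
      _ = _ := by rw [Finset.sum_mul]; exact Finset.sum_congr rfl fun i _ => by ring

/-- For fixed `k` and `n` only words of the fixed length `k + n` occur, and `hermiteBound` with that
length is polynomial in the order of the index. -/
theorem exists_seminorm_hermite_le (k n : ℕ) : ∃ (C : ℝ) (M : ℕ), 0 ≤ C ∧ ∀ γ : ι → ℕ,
    SchwartzMap.seminorm ℂ k n (hermite γ) ≤ C * (1 + (order γ : ℝ)) ^ M := by
  obtain ⟨C, hC, h⟩ := exists_pow_mul_iteratedFDeriv_le (ι := ι) k n
  set m := k + n
  set d := Fintype.card ι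
  refine ⟨C * (2 ^ m * (1 + m) ^ m * (2 * (1 + m)) ^ d), m + d, by positivity, fun γ => ?_⟩
  have h1 : hermiteBound d m (order γ) ≤
      2 ^ m * (1 + m) ^ m * (2 * (1 + m)) ^ d * (1 + (order γ : ℝ)) ^ (m + d) := by
    unfold hermiteBound
    set g : ℝ := (order γ : ℝ)
    have hg : 0 ≤ g := Nat.cast_nonneg _
    have hm : (0 : ℝ) ≤ m := Nat.cast_nonneg _
    have e1 : √(g + m) ≤ (1 + m) * (1 + g) := by
      rw [Real.sqrt_le_left (by positivity)]
      nlinarith [mul_nonneg hg hm, mul_nonneg (mul_nonneg hg hm) hg,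
        mul_nonneg (mul_nonneg hg hm) hm, sq_nonneg (g * m), sq_nonneg g, sq_nonneg (m : ℝ)]
    have e2 : g + m + 1 ≤ (1 + m) * (1 + g) := by nlinarith [mul_nonneg hg hm]
    calc 2 ^ m * √(g + m) ^ m * (2 * (g + m + 1)) ^ d
        ≤ 2 ^ m * ((1 + m) * (1 + g)) ^ m * (2 * ((1 + m) * (1 + g))) ^ d := by gcongr
      _ = _ := by simp only [mul_pow, pow_add]; ring
  refine SchwartzMap.seminorm_le_bound ℂ k n _ (by positivity) fun x => ?_
  refine (h (hermite γ) _ (fun W hW y => hW.norm_apply_hermite_le γ y) x).trans ?_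
  rw [mul_assoc]
  exact mul_le_mul_of_nonneg_left h1 hC

end Words

/-! ### Series of Schwartz functions -/

section Series

variable {E : Type} [NormedAddCommGroup E] [NormedSpace ℝ E]

/-- Summability of the seminorms of order `(0, n)` allows termwise differentiation, and the weighted
seminorms then control both the decay of the sum and the remainders. -/
theorem exists_hasSum_schwartzMap {I : Type} (f : I → 𝓢(E, ℂ))
    (hs : ∀ k n, Summable fun i => SchwartzMap.seminorm ℂ k n (f i)) :
    ∃ g : 𝓢(E, ℂ), HasSum f g := by
  have hb : ∀ n i x, ‖iteratedFDeriv ℝ n (f i) x‖ ≤ SchwartzMap.seminorm ℂ 0 n (f i) :=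
    fun n i x => SchwartzMap.norm_iteratedFDeriv_le_seminorm ℂ (f i) n x
  have hsm : ∀ i, ContDiff ℝ ((⊤ : ℕ∞) : WithTop ℕ∞) (f i) := fun i => (f i).smooth ⊤
  have hd : ∀ (n : ℕ) (x : E), iteratedFDeriv ℝ n (fun y => ∑' i, f i y) x =
      ∑' i, iteratedFDeriv ℝ n (f i) x := fun n x =>
    iteratedFDeriv_tsum_apply hsm (fun n _ => hs 0 n) (fun n i x _ => hb n i x) le_top x
  have hsum : ∀ (n : ℕ) (x : E), Summable fun i => iteratedFDeriv ℝ n (f i) x := fun n x =>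
    Summable.of_norm_bounded (hs 0 n) fun i => hb n i x
  -- An arbitrary set of indices serves twice: the full set gives the decay of the sum, the
  -- complement of a finite set gives convergence in the Schwartz topology.
  have htail : ∀ (k n : ℕ) (x : E) (s : Set I),
      ‖x‖ ^ k * ‖∑' i : s, iteratedFDeriv ℝ n (f i) x‖ ≤
        ∑' i : s, SchwartzMap.seminorm ℂ k n (f i) := by
    intro k n x s
    have h1 : Summable fun i : s => ‖iteratedFDeriv ℝ n (f i) x‖ :=
      ((hs 0 n).subtype s).of_nonneg_of_le (fun _ => norm_nonneg _) fun i => hb n i x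
    calc ‖x‖ ^ k * ‖∑' i : s, iteratedFDeriv ℝ n (f i) x‖
        ≤ ‖x‖ ^ k * ∑' i : s, ‖iteratedFDeriv ℝ n (f i) x‖ := by
          gcongr
          exact norm_tsum_le_tsum_norm h1
      _ = ∑' i : s, ‖x‖ ^ k * ‖iteratedFDeriv ℝ n (f i) x‖ := (tsum_mul_left).symm
      _ ≤ _ := (h1.mul_left _).tsum_le_tsum
          (fun i => SchwartzMap.le_seminorm ℂ k n (f i) x) ((hs k n).subtype s)
  let g : 𝓢(E, ℂ) :=
    { toFun := fun y => ∑' i, f i y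
      smooth' := contDiff_tsum hsm (fun n _ => hs 0 n) (fun n i x _ => hb n i x)
      decay' := fun k n => ⟨∑' i : (Set.univ : Set I), SchwartzMap.seminorm ℂ k n (f i),
        fun x => by
          rw [hd]
          have := htail k n x Set.univ
          rwa [tsum_univ fun i => iteratedFDeriv ℝ n (f i) x] at this⟩ }
  refine ⟨g, ((schwartz_withSeminorms ℂ E ℂ).tendsto_nhds _ _).2 fun p ε hε => ?_⟩
  have h0 := tendsto_tsum_compl_atTop_zero fun i => SchwartzMap.seminorm ℂ p.1 p.2 (f i)
  filter_upwards [h0.eventually (gt_mem_nhds hε)] with s hlt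
  refine lt_of_le_of_lt ?_ hlt
  refine SchwartzMap.seminorm_le_bound ℂ p.1 p.2 _
    (tsum_nonneg fun i => apply_nonneg _ _) fun x => ?_
  have h1 : (⇑(∑ i ∈ s, f i - g) : E → ℂ) = (fun y => ∑ i ∈ s, f i y) - ⇑g := by
    funext y
    simp
  have hsn : ∀ i ∈ s, ContDiff ℝ p.2 (f i) := fun i _ => (f i).smooth p.2
  have hg : ⇑g = fun y => ∑' i, f i y := rfl
  rw [h1, iteratedFDeriv_sub_apply (ContDiff.sum hsn).contDiffAt (g.smooth p.2).contDiffAt,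
    iteratedFDeriv_sum hsn, Finset.sum_apply, hg, hd,
    ← (hsum p.2 x).sum_add_tsum_compl (s := s), sub_add_cancel_left, norm_neg]
  exact htail p.1 p.2 x (↑s)ᶜ

end Series

/-! ### Hermite expansions of Schwartz functions -/

section Expansion

variable {ι : Type} [Fintype ι]

/-- The coefficients `c` decay as prescribed by `B`, in terms of the orders of the multi-indices. -/
def Decay (B : ℕ → ℝ) (c : (ι → ℕ) → ℂ) : Prop :=
  ∀ N γ, ‖c γ‖ * (1 + (order γ : ℝ)) ^ N ≤ B N

theorem exists_hasSum_smul_hermite {B : ℕ → ℝ} {c : (ι → ℕ) → ℂ} (hc : Decay B c) :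
    ∃ f : 𝓢(EuclideanSpace ℝ ι, ℂ), HasSum (fun γ => c γ • hermite γ) f := by
  refine exists_hasSum_schwartzMap _ fun k n => ?_
  obtain ⟨C, M, hC, h⟩ := exists_seminorm_hermite_le (ι := ι) k n
  obtain ⟨M', hM'⟩ := summable_one_add_order_pow (ι := ι)
  -- In the exponent `M + M'`, the part `M` compensates the growth of the seminorms of `h_γ` and
  -- `M'` makes the series over all multi-indices converge.
  refine Summable.of_nonneg_of_le (fun γ => apply_nonneg _ _) (fun γ => ?_)
    (hM'.mul_left (C * B (M + M')))
  rw [map_smul_eq_mul]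
  have h1 := hc (M + M') γ
  rw [← div_eq_mul_inv, le_div_iff₀ (by positivity)]
  calc ‖c γ‖ * SchwartzMap.seminorm ℂ k n (hermite γ) * (1 + (order γ : ℝ)) ^ M'
      ≤ ‖c γ‖ * (C * (1 + (order γ : ℝ)) ^ M) * (1 + (order γ : ℝ)) ^ M' := by
        gcongr; exact h γ
    _ = C * (‖c γ‖ * (1 + (order γ : ℝ)) ^ (M + M')) := by rw [pow_add]; ring
    _ ≤ _ := by gcongr

variable [DecidableEq ι]

theorem pair_hermite_of_hasSum {c : (ι → ℕ) → ℂ} {f : 𝓢(EuclideanSpace ℝ ι, ℂ)}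
    (h : HasSum (fun γ => c γ • hermite γ) f) (δ : ι → ℕ) : pair (hermite δ) f = c δ := by
  have h1 := h.mapL (pair (hermite δ))
  simp only [map_smul, smul_eq_mul, pair_hermite, mul_ite, mul_one, mul_zero] at h1
  have h2 := hasSum_single (f := fun b => if δ = b then c b else 0) δ fun b hb => if_neg hb.symm
  rw [if_pos rfl] at h2
  exact h1.unique h2

omit [DecidableEq ι] in
/-- The number operator `1 + ∑ (x_i - ∂_i)(x_i + ∂_i)`, with eigenvalue `1 + 2|γ|` at `h_γ`. -/
def numOp : 𝓢(EuclideanSpace ℝ ι, ℂ) →L[ℂ] 𝓢(EuclideanSpace ℝ ι, ℂ) :=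
  1 + ∑ i, creOp i * annOp i

theorem pair_hermite_numOp (γ : ι → ℕ) (f : 𝓢(EuclideanSpace ℝ ι, ℂ)) :
    pair (hermite γ) (numOp f) = (1 + 2 * order γ : ℂ) * pair (hermite γ) f := by
  have h : ∀ i, pair (hermite γ) (creOp i (annOp i f)) = (2 * γ i : ℂ) * pair (hermite γ) f :=
    fun i => by
      rw [← pair_annOp, ← pair_creOp, creOp_annOp_hermite, pair_comm, map_smul, pair_comm,
        smul_eq_mul]
  have h1 : numOp f = f + ∑ i, creOp i (annOp i f) := by
    simp [numOp, sum_apply]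
  rw [h1, map_add, map_sum, Finset.sum_congr rfl fun i _ => h i, ← Finset.sum_mul,
    ← Finset.mul_sum, order]
  push_cast
  ring

theorem pair_hermite_numOp_pow (γ : ι → ℕ) (f : 𝓢(EuclideanSpace ℝ ι, ℂ)) (N : ℕ) :
    pair (hermite γ) ((numOp ^ N) f) = (1 + 2 * order γ : ℂ) ^ N * pair (hermite γ) f := by
  induction N with
  | zero => simp
  | succ N ih =>
    rw [pow_succ', mul_apply_eq_comp, pair_hermite_numOp, ih, pow_succ]
    ring

omit [DecidableEq ι] in
theorem exists_integral_norm_le : ∃ C : ℝ, 0 ≤ C ∧ ∃ m : ℕ, ∀ f : 𝓢(EuclideanSpace ℝ ι, ℂ),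
    ∫ x, ‖f x‖ ≤ C * (SchwartzMap.seminorm ℂ 0 0 f + SchwartzMap.seminorm ℂ m 0 f) := by
  let μ : MeasureTheory.Measure (EuclideanSpace ℝ ι) := MeasureTheory.volume
  refine ⟨2 ^ μ.integrablePower * ∫ x, (1 + ‖x‖) ^ (-(μ.integrablePower : ℝ)) ∂μ, by positivity,
    μ.integrablePower, fun f => ?_⟩
  have := SchwartzMap.integral_pow_mul_iteratedFDeriv_le ℂ μ f 0 0
  simpa using this

omit [DecidableEq ι] in
theorem exists_integral_norm_hermite_le : ∃ (C : ℝ) (M : ℕ), 0 ≤ C ∧ ∀ γ : ι → ℕ,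
    ∫ x, ‖hermite γ x‖ ≤ C * (1 + (order γ : ℝ)) ^ M := by
  obtain ⟨C, hC, m, h⟩ := exists_integral_norm_le (ι := ι)
  obtain ⟨C₁, M₁, hC₁, h₁⟩ := exists_seminorm_hermite_le (ι := ι) 0 0
  obtain ⟨C₂, M₂, hC₂, h₂⟩ := exists_seminorm_hermite_le (ι := ι) m 0
  refine ⟨C * (C₁ + C₂), M₁ + M₂, by positivity, fun γ => (h _).trans ?_⟩
  have hg : (1 : ℝ) ≤ 1 + order γ := by linarith [(Nat.cast_nonneg (order γ) : (0 : ℝ) ≤ _)]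
  rw [mul_assoc, add_mul]
  gcongr
  · refine (h₁ γ).trans ?_
    exact mul_le_mul_of_nonneg_left (pow_le_pow_right₀ hg (by omega)) (by assumption)
  · refine (h₂ γ).trans ?_
    exact mul_le_mul_of_nonneg_left (pow_le_pow_right₀ hg (by omega)) (by assumption)

omit [DecidableEq ι] in
theorem norm_pair_le {g f : 𝓢(EuclideanSpace ℝ ι, ℂ)} {B : ℝ} (h : ∀ x, ‖f x‖ ≤ B) :
    ‖pair g f‖ ≤ (∫ x, ‖g x‖) * B := by
  rw [pair_apply, ← MeasureTheory.integral_mul_const]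
  refine MeasureTheory.norm_integral_le_of_norm_le (g.integrable.norm.mul_const _)
    (Filter.Eventually.of_forall fun x => ?_)
  rw [norm_mul]
  exact mul_le_mul_of_nonneg_left (h x) (norm_nonneg _)

/-- The decay of Hermite coefficients, in terms of powers of the number operator. -/
theorem exists_norm_pair_hermite_mul_le (ι : Type) [Fintype ι] :
    ∃ (C : ℝ) (M : ℕ), 0 ≤ C ∧ ∀ (f : 𝓢(EuclideanSpace ℝ ι, ℂ)) (N : ℕ) (B : ℝ),
      (∀ x, ‖(numOp ^ (N + M)) f x‖ ≤ B) →
        ∀ γ, ‖pair (hermite γ) f‖ * (1 + (order γ : ℝ)) ^ N ≤ C * B := by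
  classical
  obtain ⟨C, M, hC, h⟩ := exists_integral_norm_hermite_le (ι := ι)
  refine ⟨C, M, hC, fun f N B hB γ => ?_⟩
  have hB0 : 0 ≤ B := (norm_nonneg _).trans (hB 0)
  have h1 := norm_pair_le (g := hermite γ) hB
  rw [pair_hermite_numOp_pow, norm_mul, norm_pow] at h1
  set g : ℝ := (order γ : ℝ) with hg
  have hg0 : 0 ≤ g := Nat.cast_nonneg _
  have h2 : ‖(1 + 2 * order γ : ℂ)‖ = 1 + 2 * g := by
    have : (1 + 2 * order γ : ℂ) = ((1 + 2 * g : ℝ) : ℂ) := by rw [hg]; push_cast; ring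
    rw [this, Complex.norm_real, Real.norm_of_nonneg (by positivity)]
  rw [h2] at h1
  -- The `M` extra powers of the number operator pay for the growth of the `L¹` norm of `h_γ`, and
  -- the factor `(1 + g) ^ M` cancels.
  have h3 : (1 + g) ^ M * (‖pair (hermite γ) f‖ * (1 + g) ^ N) ≤ (1 + g) ^ M * (C * B) := by
    calc (1 + g) ^ M * (‖pair (hermite γ) f‖ * (1 + g) ^ N)
        = (1 + g) ^ (N + M) * ‖pair (hermite γ) f‖ := by rw [pow_add]; ring
      _ ≤ (1 + 2 * g) ^ (N + M) * ‖pair (hermite γ) f‖ := by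
        gcongr; linarith
      _ ≤ (∫ x, ‖hermite γ x‖) * B := h1
      _ ≤ (C * (1 + g) ^ M) * B := by gcongr; exact h γ
      _ = _ := by ring
  exact le_of_mul_le_mul_left h3 (by positivity)

omit [DecidableEq ι] in
theorem exists_decay_pair_hermite (f : 𝓢(EuclideanSpace ℝ ι, ℂ)) :
    ∃ B, Decay B fun γ => pair (hermite γ) f := by
  obtain ⟨C, M, _, h⟩ := exists_norm_pair_hermite_mul_le ι
  exact ⟨fun N => C * SchwartzMap.seminorm ℂ 0 0 ((numOp ^ (N + M)) f), fun N γ =>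
    h f N _ (SchwartzMap.norm_le_seminorm ℂ _) γ⟩

theorem posOp_mem_span_hermite (i : ι) {g : 𝓢(EuclideanSpace ℝ ι, ℂ)}
    (hg : g ∈ Submodule.span ℂ (Set.range (hermite (ι := ι)))) :
    posOp i g ∈ Submodule.span ℂ (Set.range (hermite (ι := ι))) := by
  induction hg using Submodule.span_induction with
  | mem g hg =>
    obtain ⟨γ, rfl⟩ := hg
    rw [posOp_hermite]
    exact add_mem (Submodule.smul_mem _ _ (Submodule.subset_span ⟨_, rfl⟩))
      (Submodule.smul_mem _ _ (Submodule.subset_span ⟨_, rfl⟩))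
  | zero => rw [map_zero]; exact zero_mem _
  | add g g' _ _ h h' => rw [map_add]; exact add_mem h h'
  | smul c g _ h => rw [map_smul]; exact Submodule.smul_mem _ _ h

theorem exists_mem_span_hermite_inner_pow (ξ : EuclideanSpace ℝ ι) (n : ℕ) :
    ∃ g ∈ Submodule.span ℂ (Set.range (hermite (ι := ι))),
      ∀ x, g x = (inner ℝ x ξ : ℂ) ^ n * hermite 0 x := by
  induction n with
  | zero => exact ⟨hermite 0, Submodule.subset_span ⟨_, rfl⟩, by simp⟩
  | succ n ih =>
    obtain ⟨g, hg, h⟩ := ih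
    refine ⟨∑ i, (ξ i : ℂ) • posOp i g, Submodule.sum_mem _ fun i _ =>
      Submodule.smul_mem _ _ (posOp_mem_span_hermite i hg), fun x => ?_⟩
    have h1 : ((inner ℝ x ξ : ℝ) : ℂ) = ∑ i, (ξ i : ℂ) * x i := by
      simp [PiLp.inner_apply]
    simp only [sum_apply, smul_apply, posOp_apply, h, smul_eq_mul]
    rw [pow_succ', mul_assoc, h1, Finset.sum_mul]
    exact Finset.sum_congr rfl fun i _ => by ring

omit [DecidableEq ι] in
theorem hermiteFun_zero (x : EuclideanSpace ℝ ι) : hermiteFun (0 : ι → ℕ) x =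
    (Real.pi ^ (-(1 / 4) : ℝ)) ^ Fintype.card ι * Real.exp (-‖x‖ ^ 2 / 2) := by
  have h : ∀ i, hermiteOne ((0 : ι → ℕ) i) (x i) =
      Real.pi ^ (-(1 / 4) : ℝ) * Real.exp (-(x i) ^ 2 / 2) := fun i => hermiteOne_zero (x i)
  rw [hermiteFun, Finset.prod_congr rfl fun i _ => h i, Finset.prod_mul_distrib,
    ← Real.exp_sum, ← Finset.sum_div, Finset.sum_neg_distrib, ← EuclideanSpace.real_norm_sq_eq,
    Finset.prod_const, Finset.card_univ]

omit [DecidableEq ι] in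
theorem exists_exp_norm_mul_hermite_zero_le (c : ℝ) : ∃ C : ℝ, ∀ x : EuclideanSpace ℝ ι,
    Real.exp (c * ‖x‖) * ‖hermite 0 x‖ ≤ C := by
  refine ⟨(Real.pi ^ (-(1 / 4) : ℝ)) ^ Fintype.card ι * Real.exp (c ^ 2 / 2), fun x => ?_⟩
  rw [hermite_apply, hermiteFun_zero, Complex.norm_real, Real.norm_of_nonneg (by positivity),
    mul_left_comm, ← Real.exp_add]
  gcongr
  nlinarith [sq_nonneg (c - ‖x‖)]

/-- The Hermite functions are complete. -/
theorem eq_zero_of_pair_hermite_eq_zero {f : 𝓢(EuclideanSpace ℝ ι, ℂ)}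
    (hf : ∀ γ, pair (hermite γ) f = 0) : f = 0 := by
  have hspan : ∀ g ∈ Submodule.span ℂ (Set.range (hermite (ι := ι))), pair f g = 0 := by
    intro g hg
    induction hg using Submodule.span_induction with
    | mem g hg =>
      obtain ⟨γ, rfl⟩ := hg
      rw [pair_comm, hf]
    | zero => rw [map_zero]
    | add g g' _ _ h h' => rw [map_add, h, h', add_zero]
    | smul c g _ h => rw [map_smul, h, smul_zero]
  -- Polynomials times `h_0` lie in the span of the Hermite functions, so all moments of `F = h_0 f`
  -- vanish. The Gaussian factor makes the Fourier transform of `F` the sum of its moment series.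
  set F : 𝓢(EuclideanSpace ℝ ι, ℂ) :=
    SchwartzMap.pairing (ContinuousLinearMap.mul ℂ ℂ) (hermite 0) f with hF
  have hFx : ∀ x, F x = hermite 0 x * f x := fun x => rfl
  have hmom : ∀ (ξ : EuclideanSpace ℝ ι) (n : ℕ), ∫ x, (inner ℝ x ξ : ℂ) ^ n * F x = 0 := by
    intro ξ n
    obtain ⟨g, hg, h⟩ := exists_mem_span_hermite_inner_pow ξ n
    rw [← hspan g hg, pair_apply]
    congr 1
    funext x
    rw [h, hFx]
    ring
  have hfour : FourierTransform.fourier F = 0 := by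
    ext ξ
    rw [SchwartzMap.fourier_coe, Real.fourier_eq', zero_apply]
    have key : HasSum (fun n : ℕ => ∫ x : EuclideanSpace ℝ ι,
        ((-2 * Real.pi * Complex.I) ^ n / n.factorial) * ((inner ℝ x ξ : ℂ) ^ n * F x))
        (∫ x, Complex.exp (↑(-2 * Real.pi * inner ℝ x ξ) * Complex.I) • F x) := by
      refine MeasureTheory.hasSum_integral_of_dominated_convergence
        (fun n x => (2 * Real.pi * |inner ℝ x ξ|) ^ n / n.factorial * ‖F x‖) (fun n => ?_)
        (fun n => Filter.Eventually.of_forall fun x => le_of_eq ?_)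
        (Filter.Eventually.of_forall fun x => ?_) ?_ (Filter.Eventually.of_forall fun x => ?_)
      · have : Continuous F := F.continuous
        fun_prop
      · rw [norm_mul, norm_mul, norm_div, norm_pow, norm_pow, Complex.norm_real, norm_mul, norm_mul,
          norm_neg, Complex.norm_I, Complex.norm_natCast, Complex.norm_real, Complex.norm_ofNat,
          Real.norm_of_nonneg Real.pi_pos.le, mul_pow _ |inner ℝ x ξ|, Real.norm_eq_abs]
        ring
      · exact (Real.summable_pow_div_factorial _).mul_right _
      -- The majorants sum to `e^(2π|⟨x,ξ⟩|) |F|`, and `e^(2π‖ξ‖‖x‖) |h_0|` is bounded, so a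
      -- multiple of `|f|` dominates.
      · obtain ⟨C, hC⟩ := exists_exp_norm_mul_hermite_zero_le (ι := ι) (2 * Real.pi * ‖ξ‖)
        have he : (fun x => ∑' n : ℕ, (2 * Real.pi * |inner ℝ x ξ|) ^ n / n.factorial * ‖F x‖) =
            fun x => Real.exp (2 * Real.pi * |inner ℝ x ξ|) * ‖F x‖ := by
          funext x
          rw [tsum_mul_right, Real.exp_eq_exp_ℝ, NormedSpace.exp_eq_tsum_div]
        rw [he]
        refine (f.integrable.norm.const_mul C).mono' ?_ (Filter.Eventually.of_forall fun x => ?_)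
        · have : Continuous F := F.continuous
          fun_prop
        · rw [norm_mul, Real.norm_of_nonneg (Real.exp_pos _).le, norm_norm, hFx, norm_mul,
            ← mul_assoc]
          gcongr
          refine le_trans (mul_le_mul_of_nonneg_right (Real.exp_le_exp.2 ?_) (norm_nonneg _)) (hC x)
          rw [mul_assoc _ ‖ξ‖, mul_comm ‖ξ‖]
          exact mul_le_mul_of_nonneg_left (abs_real_inner_le_norm x ξ)
            (mul_nonneg zero_le_two Real.pi_pos.le)
      · have h1 : HasSum (fun n : ℕ => (((-2 * Real.pi * inner ℝ x ξ : ℝ) : ℂ) * Complex.I) ^ n /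
            n.factorial) (Complex.exp (↑(-2 * Real.pi * inner ℝ x ξ) * Complex.I)) := by
          rw [Complex.exp_eq_exp_ℂ]
          exact NormedSpace.expSeries_div_hasSum_exp _
        refine (h1.mul_right (F x)).congr_fun ?_
        intro n
        push_cast
        rw [mul_right_comm, mul_pow]
        ring
    have h0 : ∀ n : ℕ, ∫ x : EuclideanSpace ℝ ι,
        ((-2 * Real.pi * Complex.I) ^ n / n.factorial) * ((inner ℝ x ξ : ℂ) ^ n * F x) = 0 :=
      fun n => by rw [MeasureTheory.integral_const_mul, hmom, mul_zero]
    simp only [h0] at key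
    exact key.unique hasSum_zero
  have hF0 : F = 0 := by
    have := FourierTransform.fourierInv_fourier_eq (F := 𝓢(EuclideanSpace ℝ ι, ℂ)) F
    rw [hfour] at this
    rw [← this]
    exact map_zero (FourierTransform.fourierInvCLM ℂ 𝓢(EuclideanSpace ℝ ι, ℂ))
  ext x
  have hx : hermite 0 x * f x = 0 := by rw [← hFx, hF0, zero_apply]
  refine (mul_eq_zero.1 hx).resolve_left ?_
  rw [hermite_apply, hermiteFun_zero, Complex.ofReal_eq_zero]
  positivity

/-- The series converges by the decay of the coefficients, and its sum has the same coefficients as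
`f`; completeness identifies the two. -/
theorem hasSum_pair_hermite_smul (f : 𝓢(EuclideanSpace ℝ ι, ℂ)) :
    HasSum (fun γ => pair (hermite γ) f • hermite γ) f := by
  obtain ⟨B, hB⟩ := exists_decay_pair_hermite f
  obtain ⟨g, hg⟩ := exists_hasSum_smul_hermite hB
  have : f - g = 0 := eq_zero_of_pair_hermite_eq_zero fun γ => by
    rw [map_sub, pair_hermite_of_hasSum hg, sub_self]
  rwa [← sub_eq_zero.1 this] at hg

end Expansion

/-! ### Decay of the Hermite coefficients of Gelfand-Shilov functions -/

section FactorialBounds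

theorem factorial_add_le (m n : ℕ) :
    (m + n).factorial ≤ 2 ^ (m + n) * (m.factorial * n.factorial) := by
  rw [← Nat.add_choose_mul_factorial_mul_factorial, mul_assoc]
  exact Nat.mul_le_mul_right _ (Nat.choose_le_two_pow _ _)

/-- The exponent `2 * s` in the coefficient bounds arises here: the `N`-th power of the number
operator has order `2N`, and `(2N)!^s` is comparable to `N!^(2s)`. -/
theorem factorial_two_mul_rpow_le {s : ℝ} (hs : 0 ≤ s) (n : ℕ) :
    ((2 * n).factorial : ℝ) ^ s ≤ ((4 : ℝ) ^ s) ^ n * (n.factorial : ℝ) ^ (2 * s) := by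
  have h : ((2 * n).factorial : ℝ) ≤ 4 ^ n * (n.factorial : ℝ) ^ 2 := by
    have := factorial_add_le n n
    rw [← two_mul, pow_mul] at this
    rw [pow_two]
    exact_mod_cast this
  refine (Real.rpow_le_rpow (by positivity) h hs).trans_eq ?_
  rw [Real.mul_rpow (by positivity) (by positivity), ← Real.rpow_natCast_mul (by positivity),
    ← Real.rpow_natCast_mul (by positivity), ← Real.rpow_mul_natCast (by positivity), mul_comm s]
  norm_num

theorem factorial_add_rpow_le {s : ℝ} (hs : 0 ≤ s) (m n : ℕ) :
    ((m + n).factorial : ℝ) ^ s ≤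
      ((2 : ℝ) ^ s) ^ (m + n) * ((m.factorial : ℝ) ^ s * (n.factorial : ℝ) ^ s) := by
  have h : ((m + n).factorial : ℝ) ≤ 2 ^ (m + n) * (m.factorial * n.factorial) := by
    exact_mod_cast factorial_add_le m n
  refine (Real.rpow_le_rpow (by positivity) h hs).trans_eq ?_
  rw [Real.mul_rpow (by positivity) (by positivity), Real.mul_rpow (by positivity) (by positivity),
    ← Real.rpow_natCast_mul (by positivity), ← Real.rpow_mul_natCast (by positivity), mul_comm s]

end FactorialBounds

/-! ### Effect of the ladder operators on bounds for derivatives. -/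

section Commutators

variable {ι : Type} [Fintype ι]

theorem pderiv_posOp [DecidableEq ι] (i j : ι) (f : 𝓢(EuclideanSpace ℝ ι, ℂ)) :
    pderiv j (posOp i f) = posOp i (pderiv j f) + (if j = i then (1 : ℂ) else 0) • f := by
  ext x
  have h1 : HasFDerivAt (fun y : EuclideanSpace ℝ ι => ((y i : ℝ) : ℂ))
      (Complex.ofRealCLM.comp (EuclideanSpace.proj (𝕜 := ℝ) i)) x :=
    (Complex.ofRealCLM.comp (EuclideanSpace.proj (𝕜 := ℝ) i)).hasFDerivAt
  have h2 := h1.mul (f.differentiableAt (x := x)).hasFDerivAt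
  have h3 : (⇑(posOp i f) : EuclideanSpace ℝ ι → ℂ) = (fun y => ((y i : ℝ) : ℂ)) * ⇑f := by
    funext y
    exact posOp_apply i f y
  rw [pderiv_apply, h3, h2.fderiv]
  simp only [add_apply, smul_apply, posOp_apply, pderiv_apply]
  by_cases hj : j = i
  · subst hj
    simp
  · have hj' : i ≠ j := fun h => hj h.symm
    simp [hj, hj']

/-- Iterating the relation `[∂_j, x_i] = δ_ij` gives the Leibniz rule. Where `α - e_i` is truncated,
the coefficient `α i` is 0. -/
theorem mderiv_posOp [DecidableEq ι] (i : ι) (α : ι → ℕ) (f : 𝓢(EuclideanSpace ℝ ι, ℂ)) :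
    mderiv α (posOp i f) = posOp i (mderiv α f) + (α i : ℂ) • mderiv (α - Pi.single i 1) f := by
  induction α using multiIndex_induction with
  | h0 => simp
  | hs j α ih =>
    rw [mderiv_add, mderiv_single, mul_apply_eq_comp, mul_apply_eq_comp, ih, map_add, map_smul,
      pderiv_posOp, add_assoc]
    congr 1
    by_cases hj : j = i
    · subst hj
      have h1 : (Pi.single j 1 + α : ι → ℕ) - Pi.single j 1 = α := by
        funext k
        simp
      rw [h1, if_pos rfl, one_smul]
      by_cases hα : α j = 0
      · simp [hα]
      · have h2 := sub_single_add_single j hα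
        have h3 : pderiv j (mderiv (α - Pi.single j 1) f) = mderiv α f := by
          conv_rhs => rw [← h2, add_comm, mderiv_add, mderiv_single]
          rfl
        rw [h3]
        simp only [Pi.add_apply, Pi.single_eq_same, Nat.cast_add, Nat.cast_one, add_smul, one_smul]
    · have hj' : i ≠ j := fun h => hj h.symm
      have h1 : (Pi.single j 1 + α : ι → ℕ) - Pi.single i 1 =
          Pi.single j 1 + (α - Pi.single i 1) := by
        funext k
        by_cases hk : k = i
        · subst hk; simp [hj']
        · simp [hk]
      rw [h1, if_neg hj, zero_smul, zero_add, mderiv_add, mderiv_single]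
      simp [hj']

/-- The sup norms of `x^β ∂^α f` are bounded by `b (|α| + |β|)`. -/
def DerivBound (b : ℕ → ℝ) (f : 𝓢(EuclideanSpace ℝ ι, ℂ)) : Prop :=
  ∀ (α β : ι → ℕ) (x : EuclideanSpace ℝ ι),
    ‖(monomial β x : ℂ) * mderiv α f x‖ ≤ b (order α + order β)

theorem DerivBound.mono {b b' : ℕ → ℝ} {f : 𝓢(EuclideanSpace ℝ ι, ℂ)} (h : DerivBound b f)
    (hb : ∀ m, b m ≤ b' m) : DerivBound b' f := fun α β x => (h α β x).trans (hb _)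

/-- Without coordinates every multi-index has order 0 and `b m` is unconstrained for `m > 0`; hence
`Nonempty`. -/
theorem DerivBound.nonneg [Nonempty ι] {b : ℕ → ℝ} {f : 𝓢(EuclideanSpace ℝ ι, ℂ)}
    (h : DerivBound b f) (m : ℕ) : 0 ≤ b m := by
  classical
  have := (norm_nonneg _).trans (h (Pi.single (Classical.arbitrary ι) m) 0 0)
  simpa [order] using this

theorem DerivBound.add {b b' : ℕ → ℝ} {f g : 𝓢(EuclideanSpace ℝ ι, ℂ)} (hf : DerivBound b f)
    (hg : DerivBound b' g) : DerivBound (fun m => b m + b' m) (f + g) := fun α β x => by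
  rw [map_add, add_apply, mul_add]
  exact (norm_add_le _ _).trans (add_le_add (hf α β x) (hg α β x))

theorem DerivBound.neg {b : ℕ → ℝ} {f : 𝓢(EuclideanSpace ℝ ι, ℂ)} (hf : DerivBound b f) :
    DerivBound b (-f) := fun α β x => by
  rw [map_neg, neg_apply, mul_neg, norm_neg]
  exact hf α β x

theorem DerivBound.sum {κ : Type} {b : ℕ → ℝ} {f : κ → 𝓢(EuclideanSpace ℝ ι, ℂ)} (s : Finset κ)
    (hf : ∀ i ∈ s, DerivBound b (f i)) : DerivBound (fun m => s.card * b m) (∑ i ∈ s, f i) :=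
  fun α β x => by
    rw [map_sum, sum_apply, Finset.mul_sum]
    refine (norm_sum_le _ _).trans ((Finset.sum_le_sum fun i hi => hf i hi α β x).trans_eq ?_)
    rw [Finset.sum_const, nsmul_eq_mul]

theorem DerivBound.pderiv {b : ℕ → ℝ} {f : 𝓢(EuclideanSpace ℝ ι, ℂ)} (hf : DerivBound b f)
    (i : ι) : DerivBound (fun m => b (m + 1)) (GelfandShilov.pderiv i f) := fun α β x => by
  classical
  have h := hf (α + Pi.single i 1) β x
  rw [mderiv_add, mderiv_single, mul_apply_eq_comp, order_add, order_single,
    add_right_comm] at h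
  exact h

/-- The term `m * b (m - 1)` bounds the commutator of `∂^α` and `x_i`, which is `α_i ∂^(α - e_i)`
with `α_i ≤ |α| + |β| = m`. -/
theorem DerivBound.posOp {b : ℕ → ℝ} {f : 𝓢(EuclideanSpace ℝ ι, ℂ)} (hf : DerivBound b f)
    (i : ι) : DerivBound (fun m => b (m + 1) + m * b (m - 1)) (GelfandShilov.posOp i f) :=
  fun α β x => by
    classical
    rw [mderiv_posOp, add_apply, mul_add]
    refine (norm_add_le _ _).trans (add_le_add ?_ ?_)
    · have h := hf α (Pi.single i 1 + β) x
      rw [order_add, order_single, monomial_add, monomial_single, add_comm 1, ← add_assoc] at h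
      rw [posOp_apply]
      refine le_trans (le_of_eq ?_) h
      congr 1
      push_cast
      ring
    · by_cases hα : α i = 0
      · have : 0 ≤ b (order α + order β - 1) := by
          have : Nonempty ι := ⟨i⟩
          exact hf.nonneg _
        simp only [hα, Nat.cast_zero, zero_smul, zero_apply, mul_zero, norm_zero]
        positivity
      · have h := hf (α - Pi.single i 1) β x
        have h1 : order α = order (α - Pi.single i 1 : ι → ℕ) + 1 := by
          conv_lhs => rw [← sub_single_add_single i hα, order_add, order_single]
        have h2 : order α + order β - 1 = order (α - Pi.single i 1 : ι → ℕ) + order β := by omega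
        rw [h2, smul_apply, smul_eq_mul, mul_left_comm, norm_mul, Complex.norm_natCast]
        have h3 : (α i : ℝ) ≤ ((order α + order β : ℕ) : ℝ) := by
          exact_mod_cast (le_order α i).trans (Nat.le_add_right _ _)
        exact mul_le_mul h3 h (norm_nonneg _) (Nat.cast_nonneg _)

/-- The effect of a creation or annihilation operator on bounds for derivatives. -/
def ladderBound (b : ℕ → ℝ) (m : ℕ) : ℝ := 2 * b (m + 1) + m * b (m - 1)

theorem ladderBound_mono {b b' : ℕ → ℝ} (h : ∀ m, b m ≤ b' m) (m : ℕ) :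
    ladderBound b m ≤ ladderBound b' m := by
  unfold ladderBound
  have h1 := h (m + 1)
  have h2 := h (m - 1)
  gcongr

theorem DerivBound.annOp {b : ℕ → ℝ} {f : 𝓢(EuclideanSpace ℝ ι, ℂ)} (hf : DerivBound b f)
    (i : ι) : DerivBound (ladderBound b) (GelfandShilov.annOp i f) :=
  ((hf.posOp i).add (hf.pderiv i)).mono fun m => by unfold ladderBound; linarith

theorem DerivBound.creOp {b : ℕ → ℝ} {f : 𝓢(EuclideanSpace ℝ ι, ℂ)} (hf : DerivBound b f)
    (i : ι) : DerivBound (ladderBound b) (GelfandShilov.creOp i f) := by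
  have h : GelfandShilov.creOp i f = GelfandShilov.posOp i f + -GelfandShilov.pderiv i f := by
    rw [GelfandShilov.creOp, sub_apply, sub_eq_add_neg]
  rw [h]
  exact ((hf.posOp i).add (hf.pderiv i).neg).mono fun m => by unfold ladderBound; linarith

theorem DerivBound.numOp {b : ℕ → ℝ} (hb : ∀ m, 0 ≤ b m) {f : 𝓢(EuclideanSpace ℝ ι, ℂ)}
    (hf : DerivBound b f) :
    DerivBound (fun m => (Fintype.card ι + 1) * ladderBound (ladderBound b) m)
      (GelfandShilov.numOp f) := by
  have h1 : GelfandShilov.numOp f =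
      f + ∑ i, GelfandShilov.creOp i (GelfandShilov.annOp i f) := by
    simp [GelfandShilov.numOp, sum_apply]
  rw [h1]
  refine (hf.add (DerivBound.sum Finset.univ fun i _ => (hf.annOp i).creOp i)).mono fun m => ?_
  -- The summand `f` of the number operator costs no more than one pair of ladder operators, since
  -- the double bound contains `2 (m + 1) b(m)`. This leads to the factor `d + 1`.
  have h2 : b m ≤ ladderBound (ladderBound b) m := by
    have e1 := hb (m + 1 + 1)
    have e2 := hb (m - 1 + 1)
    have e3 := hb (m - 1 - 1)
    have e4 := hb m
    have hm : (0 : ℝ) ≤ m := Nat.cast_nonneg m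
    have e5 : 0 ≤ (m : ℝ) * (2 * b (m - 1 + 1) + (m - 1 : ℕ) * b (m - 1 - 1)) := by positivity
    simp only [ladderBound, Nat.add_sub_cancel]
    push_cast
    nlinarith [mul_nonneg hm e4]
  rw [Finset.card_univ, add_mul, one_mul]
  linarith

end Commutators

/-! ### From Gelfand-Shilov bounds to decay of Hermite coefficients. -/

section CoefficientDecay

variable {ι : Type} [Fintype ι]

/-- The factor gained with each creation or annihilation operator. -/
def ladderFactor (s h : ℝ) (n : ℕ) : ℝ := 2 * h + 2 ^ s * h⁻¹ * ((n : ℝ) + 1) ^ (1 - 2 * s)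

/-- Divide by `h^m (m+n+1)!^s`. The term `2 b(m+1)` leaves `2h`. The commutator term leaves `h⁻¹ m /
((m+n+1)(m+n))^s`, at most `2^s h⁻¹ (m+n+1)^(1-2s)` because `m+n+1 ≤ 2(m+n)` for `m ≥ 1`. For `s ≥
1/2` this exponent is nonpositive, so `m + n + 1` may be lowered to `n + 1`. -/
theorem ladderBound_le {s h C : ℝ} (hs : 1 / 2 ≤ s) (hh : 0 < h) (hC : 0 ≤ C) (n m : ℕ) :
    ladderBound (fun m => C * h ^ m * ((m + n).factorial : ℝ) ^ s) m ≤
      C * ladderFactor s h n * h ^ m * ((m + (n + 1)).factorial : ℝ) ^ s := by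
  rcases m with _ | m
  · have h0 : 0 ≤ 2 ^ s * h⁻¹ * ((n : ℝ) + 1) ^ (1 - 2 * s) := by positivity
    have h1 : (0 : ℝ) ≤ ((n + 1).factorial : ℝ) ^ s := by positivity
    simp only [ladderBound, ladderFactor, zero_add, pow_one, pow_zero, mul_one, Nat.cast_zero,
      zero_mul, add_zero, add_comm 1 n]
    nlinarith [mul_nonneg (mul_nonneg hC h0) h1]
  · set q : ℕ := m + n with hq
    have e1 : m + 1 + 1 + n = q + 2 := by omega
    have e2 : m + n = q := rfl
    have e3 : m + 1 + (n + 1) = q + 2 := by omega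
    simp only [ladderBound, Nat.add_sub_cancel, e1, e2, e3]
    have hF : ((q + 2).factorial : ℝ) ^ s =
        (((q : ℝ) + 2) * (q + 1)) ^ s * (q.factorial : ℝ) ^ s := by
      rw [← Real.mul_rpow (by positivity) (by positivity), Nat.factorial_succ, Nat.factorial_succ]
      congr 1
      push_cast
      ring
    have h1 : ((m : ℝ) + 1) ≤
        2 ^ s * ((n : ℝ) + 1) ^ (1 - 2 * s) * (((q : ℝ) + 2) * (q + 1)) ^ s := by
      have hmq : (m : ℝ) + 1 ≤ q + 2 := by
        have : (m : ℝ) ≤ q := by exact_mod_cast Nat.le_add_right m n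
        linarith
      have hnq : (n : ℝ) + 1 ≤ q + 2 := by
        have : (n : ℝ) ≤ q := by exact_mod_cast Nat.le_add_left n m
        linarith
      calc (m : ℝ) + 1 ≤ q + 2 := hmq
        _ = ((q : ℝ) + 2) ^ (1 - 2 * s) * (((q : ℝ) + 2) ^ 2) ^ s := by
          rw [← Real.rpow_natCast_mul (by positivity), ← Real.rpow_add (by positivity)]
          norm_num
        _ ≤ ((n : ℝ) + 1) ^ (1 - 2 * s) * (2 * (((q : ℝ) + 2) * (q + 1))) ^ s := by
          refine mul_le_mul ?_ ?_ (by positivity) (by positivity)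
          · exact Real.rpow_le_rpow_of_nonpos (by positivity) hnq (by linarith)
          · refine Real.rpow_le_rpow (by positivity) ?_ (by linarith)
            nlinarith [(Nat.cast_nonneg q : (0 : ℝ) ≤ q)]
        _ = _ := by rw [Real.mul_rpow (by positivity) (by positivity)]; ring
    have hQ : (0 : ℝ) ≤ (q.factorial : ℝ) ^ s := by positivity
    rw [hF, ladderFactor]
    set Q := (q.factorial : ℝ) ^ s
    set P := (((q : ℝ) + 2) * (q + 1)) ^ s
    push_cast
    have h2 : ((m : ℝ) + 1) * (C * h ^ m * Q) ≤
        2 ^ s * ((n : ℝ) + 1) ^ (1 - 2 * s) * P * (C * h ^ m * Q) :=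
      mul_le_mul_of_nonneg_right h1 (by positivity)
    have h3 : h ^ (m + 1) * h⁻¹ = h ^ m := by
      rw [pow_succ, mul_assoc, mul_inv_cancel₀ hh.ne', mul_one]
    calc 2 * (C * h ^ (m + 1 + 1) * (P * Q)) + ((m : ℝ) + 1) * (C * h ^ m * Q)
        ≤ 2 * (C * h ^ (m + 1 + 1) * (P * Q)) +
          2 ^ s * ((n : ℝ) + 1) ^ (1 - 2 * s) * P * (C * h ^ m * Q) := by linarith
      _ = 2 * (C * h ^ (m + 1 + 1) * (P * Q)) +
          2 ^ s * ((n : ℝ) + 1) ^ (1 - 2 * s) * P * (C * (h ^ (m + 1) * h⁻¹) * Q) := by rw [h3]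
      _ = _ := by ring

theorem ladderFactor_pos {s h : ℝ} (hh : 0 < h) (n : ℕ) : 0 < ladderFactor s h n := by
  unfold ladderFactor; positivity

theorem DerivBound.numOp_pow {s h C : ℝ} (hs : 1 / 2 ≤ s) (hh : 0 < h) (hC : 0 ≤ C)
    {f : 𝓢(EuclideanSpace ℝ ι, ℂ)}
    (hf : DerivBound (fun m => C * h ^ m * (m.factorial : ℝ) ^ s) f) (N : ℕ) :
    DerivBound (fun m => C * (Fintype.card ι + 1) ^ N *
      (∏ j ∈ Finset.range (2 * N), ladderFactor s h j) * h ^ m *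
        ((m + 2 * N).factorial : ℝ) ^ s) ((GelfandShilov.numOp ^ N) f) := by
  have hp : ∀ n, 0 ≤ ∏ j ∈ Finset.range n, ladderFactor s h j := fun n =>
    Finset.prod_nonneg fun j _ => (ladderFactor_pos hh j).le
  induction N with
  | zero => simpa using hf
  | succ N ih =>
    have hpN := hp (2 * N)
    have hpN1 := hp (2 * N + 1)
    rw [pow_succ' GelfandShilov.numOp, mul_apply_eq_comp]
    refine (ih.numOp fun m => by positivity).mono fun m => ?_
    have h1 : ladderBound (ladderBound fun m => C * (Fintype.card ι + 1) ^ N *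
        (∏ j ∈ Finset.range (2 * N), ladderFactor s h j) * h ^ m *
        ((m + 2 * N).factorial : ℝ) ^ s) m ≤ _ :=
      (ladderBound_mono (fun m => ladderBound_le hs hh (by positivity) (2 * N) m) m).trans
        (ladderBound_le hs hh
          (mul_nonneg (by positivity) (ladderFactor_pos hh _).le) (2 * N + 1) m)
    refine (mul_le_mul_of_nonneg_left h1 (by positivity)).trans_eq ?_
    rw [show 2 * (N + 1) = 2 * N + 1 + 1 by ring, Finset.prod_range_succ, Finset.prod_range_succ,
      pow_succ]
    ring

theorem mfactorial_le (α : ι → ℕ) : mfactorial α ≤ (order α).factorial :=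
  Nat.le_of_dvd (Nat.factorial_pos _) (Nat.prod_factorial_dvd_factorial_sum _ _)

theorem exists_derivBound_of_mem_spaceSH {s : ℝ} (hs : 0 ≤ s) {h : ℝ≥0} (hh : 0 < h)
    {f : 𝓢(EuclideanSpace ℝ ι, ℂ)} (hf : f ∈ spaceSH s h ι) :
    ∃ C : ℝ, 0 ≤ C ∧ DerivBound (fun m => C * (h : ℝ) ^ m * (m.factorial : ℝ) ^ s) f := by
  obtain ⟨C, hC⟩ := hf
  have h0 : 0 ≤ C := (quot_nonneg _ _ _ _).trans (hC ⟨(0, 0, 0), rfl⟩)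
  refine ⟨C, h0, fun α β x => ?_⟩
  have h1 := hC ⟨(α, β, x), rfl⟩
  have hh' : (0 : ℝ) < h := hh
  have hm : 0 < mfactorial α * mfactorial β :=
    Nat.mul_pos (Finset.prod_pos fun i _ => Nat.factorial_pos _)
      (Finset.prod_pos fun i _ => Nat.factorial_pos _)
  have hm' : (0 : ℝ) < ((mfactorial α * mfactorial β : ℕ) : ℝ) := by exact_mod_cast hm
  rw [quot, div_le_iff₀ (by positivity)] at h1
  refine h1.trans ?_
  rw [← mul_assoc]
  have h2 : ((mfactorial α * mfactorial β : ℕ) : ℝ) ≤ ((order α + order β).factorial : ℝ) := by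
    have : mfactorial α * mfactorial β ≤ (order α + order β).factorial :=
      (Nat.mul_le_mul (mfactorial_le α) (mfactorial_le β)).trans
        (Nat.le_of_dvd (Nat.factorial_pos _) (Nat.factorial_mul_factorial_dvd_factorial_add _ _))
    exact_mod_cast this
  exact mul_le_mul_of_nonneg_left (Real.rpow_le_rpow hm'.le h2 hs) (by positivity)

/-- The pair `A`, `r` is left open so that a crude choice serves `𝒮_s` and a sharp one serves `Σ_s`.
In the base, `d + 1`, `r ^ 2` and one `4 ^ s` come from a single number operator; the other `4 ^ s`
comes from separating `N!` from `(N + M)!`. -/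
theorem exists_decay_of_mem_spaceSH {s : ℝ} (hs : 1 / 2 ≤ s) {h : ℝ≥0} (hh : 0 < h)
    {f : 𝓢(EuclideanSpace ℝ ι, ℂ)} (hf : f ∈ spaceSH s h ι) {A r : ℝ} (hA : 0 ≤ A) (hr : 0 < r)
    (hAr : ∀ n, ∏ j ∈ Finset.range n, ladderFactor s h j ≤ A * r ^ n) :
    ∃ C : ℝ, 0 ≤ C ∧ Decay (fun N => C * ((Fintype.card ι + 1) * 4 ^ s * 4 ^ s * r ^ 2) ^ N *
      (N.factorial : ℝ) ^ (2 * s)) fun γ => pair (hermite γ) f := by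
  have hs0 : 0 ≤ s := by linarith
  obtain ⟨C, hC, hb⟩ := exists_derivBound_of_mem_spaceSH hs0 hh hf
  obtain ⟨C', M, hC', hM⟩ := exists_norm_pair_hermite_mul_le ι
  set K : ℝ := (Fintype.card ι + 1) * r ^ 2 * 4 ^ s with hK
  have hK0 : 0 < K := by positivity
  clear_value K
  refine ⟨C' * (C * A * (K * 2 ^ (2 * s)) ^ M * (M.factorial : ℝ) ^ (2 * s)), by positivity,
    fun N γ => ?_⟩
  have key : ∀ n x, ‖(numOp ^ n) f x‖ ≤ C * A * K ^ n * (n.factorial : ℝ) ^ (2 * s) := by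
    intro n x
    have h1 := hb.numOp_pow hs (show (0 : ℝ) < h from hh) hC n 0 0 x
    have ho : order (0 : ι → ℕ) = 0 := by simp [order]
    have hmon : monomial (0 : ι → ℕ) x = 1 := by simp [monomial]
    rw [mderiv_zero, hmon, Complex.ofReal_one, one_mul, one_apply_eq_self, ho] at h1
    simp only [add_zero, pow_zero, mul_one, zero_add] at h1
    refine h1.trans ?_
    calc C * (Fintype.card ι + 1) ^ n * (∏ j ∈ Finset.range (2 * n), ladderFactor s h j) *
          ((2 * n).factorial : ℝ) ^ s
        ≤ C * (Fintype.card ι + 1) ^ n * (A * r ^ (2 * n)) *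
          (((4 : ℝ) ^ s) ^ n * (n.factorial : ℝ) ^ (2 * s)) := by
          have := hAr (2 * n)
          have := factorial_two_mul_rpow_le hs0 n
          gcongr
      _ = _ := by rw [hK, pow_mul, mul_pow, mul_pow]; ring
  refine (hM f N _ (key (N + M)) γ).trans ?_
  have h2 := factorial_add_rpow_le (s := 2 * s) (by linarith) N M
  calc C' * (C * A * K ^ (N + M) * ((N + M).factorial : ℝ) ^ (2 * s))
      ≤ C' * (C * A * K ^ (N + M) * (((2 : ℝ) ^ (2 * s)) ^ (N + M) *
        ((N.factorial : ℝ) ^ (2 * s) * (M.factorial : ℝ) ^ (2 * s)))) := by gcongr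
    _ = C' * (C * A * (K * 2 ^ (2 * s)) ^ M * (M.factorial : ℝ) ^ (2 * s)) *
        (K * 2 ^ (2 * s)) ^ N * (N.factorial : ℝ) ^ (2 * s) := by
      rw [pow_add, pow_add, mul_pow, mul_pow]; ring
    _ = _ := by
      have : (2 : ℝ) ^ (2 * s) = 4 ^ s := by
        rw [Real.rpow_mul (by norm_num)]; norm_num
      rw [this, hK]
      ring

theorem prod_ladderFactor_le {s h : ℝ} (hs : 1 / 2 ≤ s) (hh : 0 < h) (n : ℕ) :
    ∏ j ∈ Finset.range n, ladderFactor s h j ≤ 1 * (ladderFactor s h 0) ^ n := by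
  rw [one_mul]
  refine (Finset.prod_le_prod (fun j _ => (ladderFactor_pos hh j).le) fun j _ => ?_).trans_eq
    ((Finset.prod_const _).trans (by rw [Finset.card_range]))
  unfold ladderFactor
  have : ((j : ℝ) + 1) ^ (1 - 2 * s) ≤ (((0 : ℕ) : ℝ) + 1) ^ (1 - 2 * s) :=
    Real.rpow_le_rpow_of_nonpos (by norm_num) (by simp) (by linarith)
  gcongr

/-- Once the factors are at most `r`, the quotients of the products by `r ^ n` no longer increase,
so finitely many quotients bound them all; `A` is their sum. -/
theorem exists_prod_le_of_eventually_le {u : ℕ → ℝ} (hu : ∀ n, 0 < u n) {r : ℝ} (hr : 0 < r)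
    (h : ∀ᶠ n in Filter.atTop, u n ≤ r) :
    ∃ A : ℝ, 0 ≤ A ∧ ∀ n, ∏ j ∈ Finset.range n, u j ≤ A * r ^ n := by
  obtain ⟨J, hJ⟩ := Filter.eventually_atTop.1 h
  have hp : ∀ n, 0 ≤ (∏ j ∈ Finset.range n, u j) / r ^ n := fun n =>
    div_nonneg (Finset.prod_nonneg fun j _ => (hu j).le) (by positivity)
  refine ⟨∑ k ∈ Finset.range (J + 1), (∏ j ∈ Finset.range k, u j) / r ^ k,
    Finset.sum_nonneg fun k _ => hp k, fun n => ?_⟩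
  rw [← div_le_iff₀ (by positivity)]
  have hle : ∀ n ≤ J, (∏ j ∈ Finset.range n, u j) / r ^ n ≤
      ∑ k ∈ Finset.range (J + 1), (∏ j ∈ Finset.range k, u j) / r ^ k := fun n hn =>
    Finset.single_le_sum (f := fun k => (∏ j ∈ Finset.range k, u j) / r ^ k) (fun k _ => hp k)
      (Finset.mem_range.2 (Nat.lt_succ_of_le hn))
  rcases le_total n J with hn | hn
  · exact hle n hn
  · induction n, hn using Nat.le_induction with
    | base => exact hle J le_rfl
    | succ n hn ih =>
      refine le_trans ?_ ih
      rw [Finset.prod_range_succ, pow_succ, mul_div_mul_comm]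
      exact mul_le_of_le_one_right (hp n) ((div_le_one hr).2 (hJ n hn))

/-- For `s > 1/2` the commutator part of the factor tends to 0, leaving `2h`; any constant larger
than 2 would do in place of 3. A rate proportional to `h` is what `Σ_s` requires, and it fails at `s
= 1/2`, where the part in `h⁻¹` persists. -/
theorem exists_prod_ladderFactor_le {s h : ℝ} (hs : 1 / 2 < s) (hh : 0 < h) :
    ∃ A : ℝ, 0 ≤ A ∧ ∀ n, ∏ j ∈ Finset.range n, ladderFactor s h j ≤ A * (3 * h) ^ n := by
  refine exists_prod_le_of_eventually_le (ladderFactor_pos hh) (by positivity) ?_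
  have h1 : Filter.Tendsto (fun n : ℕ => ((n : ℝ) + 1) ^ (1 - 2 * s)) Filter.atTop (nhds 0) := by
    have h2 := tendsto_rpow_neg_atTop (y := 2 * s - 1) (by linarith)
    have h3 : Filter.Tendsto (fun n : ℕ => (n : ℝ) + 1) Filter.atTop Filter.atTop :=
      Filter.tendsto_atTop_add_const_right _ _ tendsto_natCast_atTop_atTop
    refine (h2.comp h3).congr fun n => ?_
    simp only [Function.comp, neg_sub]
  have h4 : Filter.Tendsto (ladderFactor s h) Filter.atTop (nhds (2 * h)) := by
    have := (h1.const_mul (2 ^ s * h⁻¹)).const_add (2 * h)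
    rw [mul_zero, add_zero] at this
    exact this
  exact (h4.eventually (gt_mem_nhds (show 2 * h < 3 * h by linarith))).mono fun _ => le_of_lt

end CoefficientDecay

/-! ### Gelfand-Shilov functions from decaying Hermite coefficients -/

section Synthesis

variable {ι : Type} [Fintype ι]

/-- A multinomial coefficient is a product of binomial coefficients, each at most a power of 2. -/
theorem order_factorial_le (α : ι → ℕ) :
    (order α).factorial ≤ (2 ^ Fintype.card ι) ^ order α * mfactorial α := by
  classical
  have H : ∀ s : Finset ι, (∑ i ∈ s, α i).factorial ≤
      (2 ^ s.card) ^ (∑ i ∈ s, α i) * ∏ i ∈ s, (α i).factorial := by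
    intro s
    induction s using Finset.induction_on with
    | empty => simp
    | insert i s hi ih =>
      rw [Finset.sum_insert hi, Finset.prod_insert hi, Finset.card_insert_of_notMem hi]
      calc (α i + ∑ j ∈ s, α j).factorial
          ≤ 2 ^ (α i + ∑ j ∈ s, α j) * ((α i).factorial * (∑ j ∈ s, α j).factorial) :=
            factorial_add_le _ _
        _ ≤ 2 ^ (α i + ∑ j ∈ s, α j) * ((α i).factorial *
            ((2 ^ s.card) ^ (α i + ∑ j ∈ s, α j) * ∏ j ∈ s, (α j).factorial)) := by
            gcongr
            refine ih.trans (Nat.mul_le_mul_right _ (Nat.pow_le_pow_right (by positivity) ?_))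
            exact Nat.le_add_left _ _
        _ = _ := by rw [pow_succ, mul_pow]; ring
  exact H Finset.univ

theorem factorial_order_add_le (α β : ι → ℕ) : (order α + order β).factorial ≤
    (2 ^ (Fintype.card ι + 1)) ^ (order α + order β) * (mfactorial α * mfactorial β) := by
  refine (factorial_add_le _ _).trans ((Nat.mul_le_mul_left _
    (Nat.mul_le_mul (order_factorial_le α) (order_factorial_le β))).trans_eq ?_)
  rw [pow_succ, mul_pow, pow_add _ (order α), pow_add _ (order α)]
  ring

theorem sqrt_pow_eq {x : ℝ} (hx : 0 ≤ x) (n : ℕ) : √(x ^ n) = √x ^ n := by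
  rw [← Real.sqrt_sq (by positivity : 0 ≤ √x ^ n), ← pow_mul, mul_comm n, pow_mul,
    Real.sq_sqrt hx]

theorem pow_self_le (n : ℕ) : (n : ℝ) ^ n ≤ 4 ^ n * n.factorial := by
  have h := Real.pow_div_factorial_le_exp (n : ℝ) (Nat.cast_nonneg n) n
  rw [div_le_iff₀ (by positivity)] at h
  refine h.trans ?_
  gcongr
  rw [← Real.exp_one_pow]
  gcongr
  linarith [Real.exp_one_lt_d9]

theorem exists_one_add_pow_le (d : ℕ) :
    ∃ A : ℝ, 0 ≤ A ∧ ∀ n : ℕ, (1 + (n : ℝ)) ^ d ≤ A * 3 ^ n := by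
  refine ⟨d.factorial * 3, by positivity, fun n => ?_⟩
  have h := Real.pow_div_factorial_le_exp (x := 1 + n) (by positivity) d
  rw [div_le_iff₀ (by positivity)] at h
  refine h.trans ?_
  have h1 : Real.exp (1 + n) ≤ 3 ^ (n + 1) := by
    have : (1 + n : ℝ) = ((n + 1 : ℕ) : ℝ) := by push_cast; ring
    rw [this, ← Real.exp_one_pow]
    gcongr
    linarith [Real.exp_one_lt_d9]
  calc Real.exp (1 + n) * d.factorial ≤ 3 ^ (n + 1) * d.factorial := by gcongr
    _ = _ := by rw [pow_succ]; ring

/-- Separates `√(g+n)^n` into a power of `1 + g`, to be compensated by the coefficients, and `√n!`,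
which does not depend on the index. The base 12 collects `2` from the words, `2` from `√(g+n) ≤ 2
max(√(1+g), √n)`, and `3` from absorbing a polynomial in `n`. -/
theorem exists_hermiteBound_le (d : ℕ) : ∃ A : ℝ, 0 ≤ A ∧ ∀ n g : ℕ, hermiteBound d n g ≤
    A * 12 ^ n * (√(1 + g) ^ n + 2 ^ n * √n.factorial) * (1 + (g : ℝ)) ^ d := by
  obtain ⟨A, hA, h⟩ := exists_one_add_pow_le d
  refine ⟨2 ^ d * A, by positivity, fun n g => ?_⟩
  have hg : (0 : ℝ) ≤ g := Nat.cast_nonneg g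
  have hn : (0 : ℝ) ≤ n := Nat.cast_nonneg n
  have h1 : √((g : ℝ) + n) ^ n ≤ 2 ^ n * (√(1 + g) ^ n + 2 ^ n * √n.factorial) := by
    have e1 : √(n : ℝ) ^ n ≤ 2 ^ n * √n.factorial := by
      rw [← sqrt_pow_eq (by positivity : (0 : ℝ) ≤ n)]
      have : (2 : ℝ) ^ n * √n.factorial = √(4 ^ n * n.factorial) := by
        rw [Real.sqrt_mul (by positivity), sqrt_pow_eq (by positivity)]
        congr 2
        rw [show (4 : ℝ) = 2 ^ 2 by norm_num, Real.sqrt_sq (by norm_num)]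
      rw [this]
      exact Real.sqrt_le_sqrt (pow_self_le n)
    have e2 : √((g : ℝ) + n) ≤ 2 * max √(1 + g) √n := by
      have e3 : √((g : ℝ) + n) ≤ √(1 + g) + √n := by
        rw [Real.sqrt_le_left (by positivity)]
        nlinarith [Real.sq_sqrt (show (0 : ℝ) ≤ 1 + g by positivity), Real.sq_sqrt hn,
          mul_nonneg (Real.sqrt_nonneg (1 + (g : ℝ))) (Real.sqrt_nonneg (n : ℝ))]
      linarith [le_max_left √(1 + (g : ℝ)) √n, le_max_right √(1 + (g : ℝ)) √n]
    calc √((g : ℝ) + n) ^ n ≤ (2 * max √(1 + g) √n) ^ n := by gcongr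
      _ = 2 ^ n * max √(1 + g) √n ^ n := mul_pow _ _ _
      _ ≤ 2 ^ n * (√(1 + g) ^ n + √n ^ n) := by
        gcongr
        rcases max_choice √(1 + (g : ℝ)) √n with hm | hm <;> rw [hm]
        · exact le_add_of_nonneg_right (by positivity)
        · exact le_add_of_nonneg_left (by positivity)
      _ ≤ _ := by gcongr
  have h2 : (2 * ((g : ℝ) + n + 1)) ^ d ≤ 2 ^ d * (1 + (g : ℝ)) ^ d * (A * 3 ^ n) := by
    calc (2 * ((g : ℝ) + n + 1)) ^ d ≤ (2 * (1 + (g : ℝ)) * (1 + n)) ^ d := by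
          refine pow_le_pow_left₀ (by positivity) ?_ d
          nlinarith [mul_nonneg hg hn]
      _ = 2 ^ d * (1 + (g : ℝ)) ^ d * (1 + n) ^ d := by rw [mul_pow, mul_pow]
      _ ≤ _ := by gcongr; exact h n
  unfold hermiteBound
  calc 2 ^ n * √((g : ℝ) + n) ^ n * (2 * ((g : ℝ) + n + 1)) ^ d
      ≤ 2 ^ n * (2 ^ n * (√(1 + g) ^ n + 2 ^ n * √n.factorial)) *
        (2 ^ d * (1 + (g : ℝ)) ^ d * (A * 3 ^ n)) := by gcongr
    _ = _ := by
      rw [show (12 : ℝ) = 2 * 2 * 3 by norm_num, mul_pow, mul_pow]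
      ring

theorem Decay.nonneg {B : ℕ → ℝ} {c : (ι → ℕ) → ℂ} (h : Decay B c) (N : ℕ) : 0 ≤ B N :=
  le_trans (by positivity) (h N 0)

/-- With `|c| = √|c| √|c|`, one root pays for `√(1+|γ|)^n` and the other for the fixed power `d`.
Thus the part of the bound that depends on `n` is exactly `√(B n)`, with no shift of the index. -/
theorem Decay.norm_mul_le {B : ℕ → ℝ} {c : (ι → ℕ) → ℂ} (h : Decay B c) (n d : ℕ) (γ : ι → ℕ) :
    ‖c γ‖ * (√(1 + order γ) ^ n * (1 + (order γ : ℝ)) ^ d) ≤ √(B n) * √(B (2 * d)) := by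
  set g : ℝ := 1 + (order γ : ℝ) with hg
  have hg0 : 0 < g := by positivity
  have h1 := Real.sqrt_le_sqrt (h n γ)
  have h2 := Real.sqrt_le_sqrt (h (2 * d) γ)
  rw [Real.sqrt_mul (norm_nonneg _), ← hg, sqrt_pow_eq hg0.le] at h1
  rw [Real.sqrt_mul (norm_nonneg _), ← hg, pow_mul', Real.sqrt_sq (by positivity)] at h2
  calc ‖c γ‖ * (√g ^ n * g ^ d) = (√‖c γ‖ * √g ^ n) * (√‖c γ‖ * g ^ d) := by
        rw [mul_mul_mul_comm, Real.mul_self_sqrt (norm_nonneg _)]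
    _ ≤ _ := by gcongr

/-- `W` and evaluation at `x` are continuous, hence pass through the Hermite series; the terms are
then summed by means of `hermiteBound`, with an exponent `M` reserved for summability. -/
theorem exists_norm_isWord_apply_le {B : ℕ → ℝ} {f : 𝓢(EuclideanSpace ℝ ι, ℂ)}
    (hf : Decay B fun γ => pair (hermite γ) f) : ∃ A : ℝ, 0 ≤ A ∧ ∀ (n : ℕ)
      (W : 𝓢(EuclideanSpace ℝ ι, ℂ) →L[ℂ] 𝓢(EuclideanSpace ℝ ι, ℂ)), IsWord n W → ∀ x,
        ‖W f x‖ ≤ A * (12 ^ n * (√(B n) + 2 ^ n * √n.factorial)) := by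
  classical
  set d := Fintype.card ι
  obtain ⟨A, hA, h⟩ := exists_hermiteBound_le d
  obtain ⟨M, hM⟩ := summable_one_add_order_pow (ι := ι)
  set S := ∑' γ : ι → ℕ, ((1 + (order γ : ℝ)) ^ M)⁻¹
  have hS : 0 ≤ S := tsum_nonneg fun γ => by positivity
  set R := √(B (2 * (d + M)))
  refine ⟨A * R * S * (1 + √(B 0)), by positivity, fun n W hW x => ?_⟩
  have h1 : HasSum (fun γ => pair (hermite γ) f * W (hermite γ) x) (W f x) := by
    have := (hasSum_pair_hermite_smul f).mapL
      ((ContinuousLinearMap.comp (BoundedContinuousFunction.evalCLM ℂ x)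
        (SchwartzMap.toBoundedContinuousFunctionCLM ℂ (EuclideanSpace ℝ ι) ℂ)).comp W)
    refine this.congr_fun fun γ => ?_
    rw [map_smul]
    rfl
  set D := A * 12 ^ n * R * (√(B n) + 2 ^ n * √n.factorial * √(B 0))
  have h2 : ∀ γ, ‖pair (hermite γ) f * W (hermite γ) x‖ ≤
      D * ((1 + (order γ : ℝ)) ^ M)⁻¹ := by
    intro γ
    rw [norm_mul, ← div_eq_mul_inv, le_div_iff₀ (by positivity)]
    have e1 := (hW.norm_apply_hermite_le γ x).trans (h n (order γ))
    have e2 := hf.norm_mul_le n (d + M) γ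
    have e3 := hf.norm_mul_le 0 (d + M) γ
    simp only [pow_zero, one_mul] at e3
    set g : ℝ := 1 + (order γ : ℝ)
    set c := ‖pair (hermite γ) f‖
    have hc : 0 ≤ c := norm_nonneg _
    have hg : 0 ≤ g := by positivity
    calc c * ‖W (hermite γ) x‖ * g ^ M
        ≤ c * (A * 12 ^ n * (√g ^ n + 2 ^ n * √n.factorial) * g ^ d) * g ^ M := by gcongr
      _ = A * 12 ^ n * (c * (√g ^ n * g ^ (d + M)) +
          2 ^ n * √n.factorial * (c * g ^ (d + M))) := by rw [pow_add]; ring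
      _ ≤ A * 12 ^ n * (√(B n) * R + 2 ^ n * √n.factorial * (√(B 0) * R)) := by gcongr
      _ = D := by ring
  have h3 := tsum_of_norm_bounded (hM.hasSum.mul_left D) h2
  rw [h1.tsum_eq] at h3
  refine h3.trans ?_
  have e4 : √(B n) + 2 ^ n * √n.factorial * √(B 0) ≤
      (1 + √(B 0)) * (√(B n) + 2 ^ n * √n.factorial) := by
    have : 0 ≤ √(B 0) * √(B n) := by positivity
    have : 0 ≤ 2 ^ n * √(n.factorial : ℝ) := by positivity
    linarith
  calc D * S = A * 12 ^ n * R * S * (√(B n) + 2 ^ n * √n.factorial * √(B 0)) := by ring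
    _ ≤ A * 12 ^ n * R * S * ((1 + √(B 0)) * (√(B n) + 2 ^ n * √n.factorial)) := by gcongr
    _ = _ := by ring

theorem mem_spaceSH_of_decay {s : ℝ} (hs : 0 ≤ s) {B : ℕ → ℝ} {f : 𝓢(EuclideanSpace ℝ ι, ℂ)}
    (hf : Decay B fun γ => pair (hermite γ) f) {C : ℝ} {h : ℝ≥0} (hC : 0 ≤ C) (hh : 0 < h)
    (hB : ∀ n, 12 ^ n * (√(B n) + 2 ^ n * √n.factorial) ≤
      C * ((h : ℝ) / (2 ^ (Fintype.card ι + 1)) ^ s) ^ n * (n.factorial : ℝ) ^ s) :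
    f ∈ spaceSH s h ι := by
  obtain ⟨A, hA, hAW⟩ := exists_norm_isWord_apply_le hf
  refine ⟨A * C, ?_⟩
  rintro _ ⟨⟨α, β, x⟩, rfl⟩
  have hh' : (0 : ℝ) < h := hh
  have hm : 0 < mfactorial α * mfactorial β :=
    Nat.mul_pos (Finset.prod_pos fun i _ => Nat.factorial_pos _)
      (Finset.prod_pos fun i _ => Nat.factorial_pos _)
  have hm' : (0 : ℝ) < ((mfactorial α * mfactorial β : ℕ) : ℝ) := by exact_mod_cast hm
  obtain ⟨W, hW, hWf⟩ := exists_isWord_monomial_mderiv α β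
  rw [quot, div_le_iff₀ (by positivity), ← hWf]
  set n := order α + order β
  -- The loss, per unit of order, in replacing `(|α|+|β|)!^s` by `(α! β!)^s`.
  set q : ℝ := (2 ^ (Fintype.card ι + 1)) ^ s with hq
  have hq0 : 0 < q := by positivity
  have h1 : (n.factorial : ℝ) ^ s ≤ q ^ n * ((mfactorial α * mfactorial β : ℕ) : ℝ) ^ s := by
    have h2 : (n.factorial : ℝ) ≤
        (2 ^ (Fintype.card ι + 1)) ^ n * ((mfactorial α * mfactorial β : ℕ) : ℝ) := by
      exact_mod_cast factorial_order_add_le α β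
    refine (Real.rpow_le_rpow (by positivity) h2 hs).trans_eq ?_
    rw [Real.mul_rpow (by positivity) (by positivity), hq, ← Real.rpow_natCast_mul (by positivity),
      ← Real.rpow_mul_natCast (by positivity), mul_comm s]
  calc ‖W f x‖ ≤ A * (12 ^ n * (√(B n) + 2 ^ n * √n.factorial)) := hAW n W hW x
    _ ≤ A * (C * (h / q) ^ n * (n.factorial : ℝ) ^ s) :=
      mul_le_mul_of_nonneg_left (hB n) hA
    _ ≤ A * (C * (h / q) ^ n * (q ^ n * ((mfactorial α * mfactorial β : ℕ) : ℝ) ^ s)) := by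
      gcongr
    _ = A * C * (((h / q) * q) ^ n * ((mfactorial α * mfactorial β : ℕ) : ℝ) ^ s) := by
      rw [mul_pow]; ring
    _ = _ := by rw [div_mul_cancel₀ _ hq0.ne']

end Synthesis

/-! ### Characterization of the Gelfand-Shilov spaces -/

section Characterization

/-- The bounds that characterize `𝒮_s`. -/
def GevreyBound (s : ℝ) (B : ℕ → ℝ) : Prop :=
  ∃ h C : ℝ, 0 < h ∧ 0 ≤ C ∧ ∀ N, B N ≤ C * h ^ N * (N.factorial : ℝ) ^ (2 * s)

/-- The bounds that characterize `Σ_s`. -/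
def BeurlingBound (s : ℝ) (B : ℕ → ℝ) : Prop :=
  ∀ h : ℝ, 0 < h → ∃ C : ℝ, 0 ≤ C ∧ ∀ N, B N ≤ C * h ^ N * (N.factorial : ℝ) ^ (2 * s)

theorem sqrt_le_of_le {s h C b : ℝ} (hh : 0 < h) (hC : 0 ≤ C) (N : ℕ)
    (hb : b ≤ C * h ^ N * (N.factorial : ℝ) ^ (2 * s)) :
    √b ≤ √C * √h ^ N * (N.factorial : ℝ) ^ s := by
  refine (Real.sqrt_le_sqrt hb).trans_eq ?_
  rw [Real.sqrt_mul (by positivity), Real.sqrt_mul hC, sqrt_pow_eq hh.le, mul_comm 2 s,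
    Real.rpow_mul (by positivity), Real.rpow_two, Real.sqrt_sq (by positivity)]

/-- The bound for the square root of a decaying sequence. -/
def halfBound (B : ℕ → ℝ) (N : ℕ) : ℝ := 2 ^ N * √(B (2 * N))

/-- The root halves the exponents and the passage from `N` to `2N` doubles them again, so only the
constants change. -/
theorem halfBound_le {s h C : ℝ} (hs : 0 ≤ s) (hh : 0 < h) (hC : 0 ≤ C) {B : ℕ → ℝ}
    (hB : ∀ N, B N ≤ C * h ^ N * (N.factorial : ℝ) ^ (2 * s)) (N : ℕ) :
    halfBound B N ≤ √C * (2 * h * 4 ^ s) ^ N * (N.factorial : ℝ) ^ (2 * s) := by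
  have h1 := sqrt_le_of_le hh hC (2 * N) (hB (2 * N))
  have h2 := factorial_two_mul_rpow_le hs N
  unfold halfBound
  calc 2 ^ N * √(B (2 * N)) ≤ 2 ^ N * (√C * √h ^ (2 * N) * ((2 * N).factorial : ℝ) ^ s) := by
        gcongr
    _ ≤ 2 ^ N * (√C * √h ^ (2 * N) * (((4 : ℝ) ^ s) ^ N * (N.factorial : ℝ) ^ (2 * s))) := by
        gcongr
    _ = _ := by rw [pow_mul, Real.sq_sqrt hh.le, mul_pow, mul_pow]; ring

theorem GevreyBound.half {s : ℝ} (hs : 0 ≤ s) {B : ℕ → ℝ} (hB : GevreyBound s B) :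
    GevreyBound s (halfBound B) := by
  obtain ⟨h, C, hh, hC, hB⟩ := hB
  exact ⟨2 * h * 4 ^ s, √C, by positivity, by positivity, halfBound_le hs hh hC hB⟩

theorem BeurlingBound.half {s : ℝ} (hs : 0 ≤ s) {B : ℕ → ℝ} (hB : BeurlingBound s B) :
    BeurlingBound s (halfBound B) := by
  intro h hh
  obtain ⟨C, hC, hB⟩ := hB (h / (2 * 4 ^ s)) (by positivity)
  refine ⟨√C, by positivity, fun N => (halfBound_le hs (by positivity) hC hB N).trans_eq ?_⟩
  congr 3
  field_simp

theorem exists_pow_le_factorial_rpow {x p : ℝ} (hx : 0 ≤ x) (hp : 0 < p) :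
    ∃ C : ℝ, 0 ≤ C ∧ ∀ n : ℕ, x ^ n ≤ C * (n.factorial : ℝ) ^ p := by
  -- The inequality `y^n ≤ n! e^y` for `y = x^(1/p)`, raised to the power `p`.
  refine ⟨Real.exp (x ^ p⁻¹) ^ p, by positivity, fun n => ?_⟩
  have h := Real.pow_div_factorial_le_exp (x := x ^ p⁻¹) (by positivity) n
  rw [div_le_iff₀ (by positivity)] at h
  have h1 := Real.rpow_le_rpow (by positivity) h hp.le
  rw [Real.mul_rpow (by positivity) (by positivity), ← Real.rpow_mul_natCast hx,
    ← Real.rpow_mul hx, mul_right_comm, inv_mul_cancel₀ hp.ne', one_mul, Real.rpow_natCast] at h1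
  exact h1

variable {ι : Type} [Fintype ι]

theorem mem_spaceS_iff {s : ℝ} (hs : 1 / 2 ≤ s) (f : 𝓢(EuclideanSpace ℝ ι, ℂ)) :
    f ∈ spaceS s ι ↔ ∃ B, GevreyBound s B ∧ Decay B fun γ => pair (hermite γ) f := by
  have hs0 : 0 ≤ s := by linarith
  constructor
  · rintro ⟨h, hh, hf⟩
    have hh' : (0 : ℝ) < h := hh
    obtain ⟨C, hC, hd⟩ := exists_decay_of_mem_spaceSH hs hh hf zero_le_one
      (ladderFactor_pos hh' 0) (prod_ladderFactor_le hs hh')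
    have := ladderFactor_pos (s := s) hh' 0
    exact ⟨_, ⟨_, C, by positivity, hC, fun N => le_rfl⟩, hd⟩
  · rintro ⟨B, ⟨h, C, hh, hC, hB⟩, hd⟩
    set q : ℝ := (2 ^ (Fintype.card ι + 1)) ^ s with hq
    have hq0 : 0 < q := by positivity
    -- The base `√h + 2` dominates both `√h` from `√(B n)` and the 2 that comes with `√n!`; the
    -- latter is at most `n!^s` since `s ≥ 1/2`.
    set R : ℝ := 12 * (√h + 2) with hR
    have hR0 : 0 < R := by positivity
    obtain ⟨k, hk⟩ : ∃ k : ℝ≥0, (k : ℝ) = R * q :=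
      ⟨(R * q).toNNReal, Real.coe_toNNReal _ (by positivity)⟩
    have hk0 : 0 < k := by rw [← NNReal.coe_pos, hk]; positivity
    refine ⟨k, hk0, mem_spaceSH_of_decay hs0 hd (C := √C + 1) (by positivity) hk0 fun n => ?_⟩
    have h1 := sqrt_le_of_le hh hC n (hB n)
    have h2 : √(n.factorial : ℝ) ≤ (n.factorial : ℝ) ^ s := by
      rw [Real.sqrt_eq_rpow]
      exact Real.rpow_le_rpow_of_exponent_le (by exact_mod_cast Nat.factorial_pos n) hs
    rw [← hq, hk, mul_div_cancel_right₀ _ hq0.ne', hR, mul_pow]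
    have e1 : √h ^ n ≤ (√h + 2) ^ n := by gcongr; linarith
    have e2 : (2 : ℝ) ^ n ≤ (√h + 2) ^ n := by gcongr; linarith [Real.sqrt_nonneg h]
    calc 12 ^ n * (√(B n) + 2 ^ n * √n.factorial)
        ≤ 12 ^ n * (√C * (√h + 2) ^ n * (n.factorial : ℝ) ^ s +
          (√h + 2) ^ n * (n.factorial : ℝ) ^ s) := by
          gcongr
          exact h1.trans (by gcongr)
      _ = _ := by ring

theorem mem_spaceSigma_iff {s : ℝ} (hs : 1 / 2 < s) (f : 𝓢(EuclideanSpace ℝ ι, ℂ)) :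
    f ∈ spaceSigma s ι ↔ ∃ B, BeurlingBound s B ∧ Decay B fun γ => pair (hermite γ) f := by
  have hs0 : 0 ≤ s := by linarith
  constructor
  · intro hf
    have hf' : ∀ h : ℝ≥0, 0 < h → f ∈ spaceSH s h ι := fun h hh => by
      have := (Submodule.mem_iInf _).1 hf h
      exact (Submodule.mem_iInf _).1 this hh
    have key : ∀ h : ℝ, 0 < h → ∃ C : ℝ, 0 ≤ C ∧ Decay
        (fun N => C * h ^ N * (N.factorial : ℝ) ^ (2 * s)) fun γ => pair (hermite γ) f := by
      intro h hh
      set K : ℝ := (Fintype.card ι + 1) * 4 ^ s * 4 ^ s with hK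
      have hK0 : 0 < K := by positivity
      -- Chosen so that `K (3 h₁)² = h`, the rate that results when the products of ladder factors
      -- grow like `(3 h₁)^n`.
      obtain ⟨h₁, hh₁⟩ : ∃ k : ℝ≥0, (k : ℝ) = √(h / K) / 3 :=
        ⟨(√(h / K) / 3).toNNReal, Real.coe_toNNReal _ (by positivity)⟩
      have hpos : (0 : ℝ) < h₁ := by
        rw [hh₁]
        positivity
      obtain ⟨A, hA, hle⟩ := exists_prod_ladderFactor_le hs hpos
      obtain ⟨C, hC, hd⟩ := exists_decay_of_mem_spaceSH hs.le (NNReal.coe_pos.1 hpos)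
        (hf' h₁ (NNReal.coe_pos.1 hpos)) hA (by positivity) hle
      refine ⟨C, hC, ?_⟩
      have : K * (3 * (h₁ : ℝ)) ^ 2 = h := by
        rw [hh₁, mul_div_cancel₀ _ (by norm_num), Real.sq_sqrt (by positivity)]
        field_simp
      rwa [← hK, this] at hd
    obtain ⟨B₀, hB₀⟩ := exists_decay_pair_hermite f
    have hbdd : ∀ N, BddAbove (Set.range fun γ : ι → ℕ =>
        ‖pair (hermite γ) f‖ * (1 + (order γ : ℝ)) ^ N) := fun N =>
      ⟨B₀ N, by rintro _ ⟨γ, rfl⟩; exact hB₀ N γ⟩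
    -- A single `B` has to serve all `h`, so the least possible one is taken.
    refine ⟨fun N => ⨆ γ : ι → ℕ, ‖pair (hermite γ) f‖ * (1 + (order γ : ℝ)) ^ N, fun h hh => ?_,
      fun N γ => le_ciSup (hbdd N) γ⟩
    obtain ⟨C, hC, hd⟩ := key h hh
    exact ⟨C, hC, fun N => ciSup_le fun γ => hd N γ⟩
  · rintro ⟨B, hB, hd⟩
    refine (Submodule.mem_iInf _).2 fun h => (Submodule.mem_iInf _).2 fun hh => ?_
    have hh' : (0 : ℝ) < h := hh
    set q : ℝ := (2 ^ (Fintype.card ι + 1)) ^ s with hq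
    have hq0 : 0 < q := by positivity
    -- The root of this rate is `h / (12 q)`, which cancels the `12 ^ n` of the synthesis bound and
    -- the loss `q`.
    obtain ⟨C, hC, hB⟩ := hB ((h / q / 12) ^ 2) (by positivity)
    -- The remaining term `24^n √n!` fits under `C' r^n n!^s` for every `r > 0` because the spare
    -- factor `n!^(s - 1/2)` outgrows every exponential; this is where `s > 1/2` enters.
    obtain ⟨C', hC', h'⟩ := exists_pow_le_factorial_rpow (x := 24 / (h / q)) (p := s - 1 / 2)
      (by positivity) (by linarith)
    refine mem_spaceSH_of_decay hs0 hd (C := √C + C') (by positivity) hh fun n => ?_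
    have h1 := sqrt_le_of_le (by positivity) hC n (hB n)
    rw [Real.sqrt_sq (by positivity)] at h1
    rw [← hq]
    set r : ℝ := h / q
    have hr : 0 < r := by positivity
    have h2 : 24 ^ n * √(n.factorial : ℝ) ≤ C' * r ^ n * (n.factorial : ℝ) ^ s := by
      have h3 := h' n
      rw [div_pow, div_le_iff₀ (by positivity)] at h3
      have h4 : (n.factorial : ℝ) ^ s = (n.factorial : ℝ) ^ (s - 1 / 2) * √(n.factorial : ℝ) := by
        rw [Real.sqrt_eq_rpow, ← Real.rpow_add (by positivity)]
        congr 1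
        ring
      rw [h4]
      calc 24 ^ n * √(n.factorial : ℝ)
          ≤ (C' * (n.factorial : ℝ) ^ (s - 1 / 2) * r ^ n) * √(n.factorial : ℝ) := by gcongr
        _ = _ := by ring
    calc 12 ^ n * (√(B n) + 2 ^ n * √n.factorial)
        = 12 ^ n * √(B n) + 24 ^ n * √n.factorial := by
          rw [show (24 : ℝ) = 12 * 2 by norm_num, mul_pow]; ring
      _ ≤ 12 ^ n * (√C * (r / 12) ^ n * (n.factorial : ℝ) ^ s) +
          C' * r ^ n * (n.factorial : ℝ) ^ s := by gcongr
      _ = _ := by rw [div_pow]; field_simp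

end Characterization

/-! ### Operators with Schwartz kernels -/

section TensorPairing

variable {ι κ τ : Type} [Fintype ι] [Fintype κ] [Fintype τ]

theorem measurePreserving_fstE_sndE (e : ι ⊕ κ ≃ τ) :
    MeasureTheory.MeasurePreserving (fun x : EuclideanSpace ℝ τ => (fstE e x, sndE e x)) := by
  have h1 := PiLp.volume_preserving_ofLp τ
  have h2 := (MeasureTheory.volume_measurePreserving_piCongrLeft (fun _ : τ => ℝ) e).symm
  have h3 := MeasureTheory.volume_measurePreserving_sumPiEquivProdPi (fun _ : ι ⊕ κ => ℝ)
  have h4 := (PiLp.volume_preserving_toLp ι).prod (PiLp.volume_preserving_toLp κ)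
  exact h4.comp (h3.comp (h2.comp h1))

theorem integral_fstE_mul_sndE (e : ι ⊕ κ ≃ τ) {F : EuclideanSpace ℝ ι → ℂ}
    {G : EuclideanSpace ℝ κ → ℂ} (hF : Continuous F) (hG : Continuous G) :
    ∫ x : EuclideanSpace ℝ τ, F (fstE e x) * G (sndE e x) = (∫ y, F y) * ∫ z, G z := by
  have h := measurePreserving_fstE_sndE e
  have hc : Continuous fun p : EuclideanSpace ℝ ι × EuclideanSpace ℝ κ => F p.1 * G p.2 := by
    fun_prop
  rw [← MeasureTheory.integral_prod_mul F G, ← MeasureTheory.Measure.volume_eq_prod, ← h.map_eq,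
    MeasureTheory.integral_map h.measurable.aemeasurable hc.aestronglyMeasurable]

theorem pair_stensor (e : ι ⊕ κ ≃ τ) (f f' : 𝓢(EuclideanSpace ℝ ι, ℂ))
    (g g' : 𝓢(EuclideanSpace ℝ κ, ℂ)) :
    pair (stensor e f g) (stensor e f' g') = pair f f' * pair g g' := by
  have h := integral_fstE_mul_sndE e (f.continuous.mul f'.continuous)
    (g.continuous.mul g'.continuous)
  refine Eq.trans ?_ h
  rw [pair_apply]
  congr 1
  funext x
  exact mul_mul_mul_comm _ _ _ _

theorem hermite_eq_stensor (e : ι ⊕ κ ≃ τ) (γ : τ → ℕ) :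
    hermite γ = stensor e (hermite fun i => γ (e (.inl i))) (hermite fun j => γ (e (.inr j))) := by
  ext x
  rw [stensor_apply, hermite_apply, hermite_apply, hermite_apply, ← Complex.ofReal_mul, hermiteFun,
    ← e.prod_comp, Fintype.prod_sum_type]
  rfl

theorem pair_hermite_stensor (e : ι ⊕ κ ≃ τ) (γ : τ → ℕ) (f : 𝓢(EuclideanSpace ℝ ι, ℂ))
    (g : 𝓢(EuclideanSpace ℝ κ, ℂ)) : pair (hermite γ) (stensor e f g) =
      pair (hermite fun i => γ (e (.inl i))) f * pair (hermite fun j => γ (e (.inr j))) g := by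
  rw [hermite_eq_stensor e, pair_stensor]

theorem stensor_add_left (e : ι ⊕ κ ≃ τ) (f f' : 𝓢(EuclideanSpace ℝ ι, ℂ))
    (g : 𝓢(EuclideanSpace ℝ κ, ℂ)) : stensor e (f + f') g = stensor e f g + stensor e f' g := by
  ext x
  simp [stensor_apply, add_mul]

theorem stensor_add_right (e : ι ⊕ κ ≃ τ) (f : 𝓢(EuclideanSpace ℝ ι, ℂ))
    (g g' : 𝓢(EuclideanSpace ℝ κ, ℂ)) : stensor e f (g + g') = stensor e f g + stensor e f g' := by
  ext x
  simp [stensor_apply, mul_add]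

theorem stensor_smul_left (e : ι ⊕ κ ≃ τ) (c : ℂ) (f : 𝓢(EuclideanSpace ℝ ι, ℂ))
    (g : 𝓢(EuclideanSpace ℝ κ, ℂ)) : stensor e (c • f) g = c • stensor e f g := by
  ext x
  simp [stensor_apply, mul_assoc]

theorem stensor_smul_right (e : ι ⊕ κ ≃ τ) (c : ℂ) (f : 𝓢(EuclideanSpace ℝ ι, ℂ))
    (g : 𝓢(EuclideanSpace ℝ κ, ℂ)) : stensor e f (c • g) = c • stensor e f g := by
  ext x
  simp [stensor_apply, mul_left_comm]

/-- All continuity statements for the kernel operators reduce to this, since sup norms are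
controlled both by the Schwartz seminorm of order `(0, 0)` and by the norms of `𝒮_{s,h}`. -/
theorem norm_pair_stensor_le (e : ι ⊕ κ ≃ τ) (K : 𝓢(EuclideanSpace ℝ τ, ℂ))
    {f : 𝓢(EuclideanSpace ℝ ι, ℂ)} {g : 𝓢(EuclideanSpace ℝ κ, ℂ)} {A B : ℝ}
    (hf : ∀ x, ‖f x‖ ≤ A) (hg : ∀ x, ‖g x‖ ≤ B) :
    ‖pair K (stensor e f g)‖ ≤ (∫ x, ‖K x‖) * (A * B) := by
  refine norm_pair_le fun x => ?_
  rw [stensor_apply, norm_mul]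
  exact mul_le_mul (hf _) (hg _) (norm_nonneg _) ((norm_nonneg _).trans (hf 0))

end TensorPairing

/-! ### Operators defined by Schwartz kernels, on `𝒮_s` and extended to the Schwartz space. -/

section KernelOperators

variable {ι κ : Type} [Fintype ι] [Fintype κ]

/-- The linear form `g ↦ ∫ K(y, x) g(y) f(x)` on `𝓢`. -/
def kernelForm (K : 𝓢(EuclideanSpace ℝ (κ ⊕ ι), ℂ)) (f : 𝓢(EuclideanSpace ℝ ι, ℂ)) :
    𝓢(EuclideanSpace ℝ κ, ℂ) →L[ℂ] ℂ :=
  SchwartzMap.mkCLMtoNormedSpace (fun g => pair K (stensor (Equiv.refl _) g f))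
    (fun g g' => by rw [stensor_add_left, map_add])
    (fun c g => by rw [stensor_smul_left, map_smul]; rfl)
    ⟨{(0, 0)}, (∫ x, ‖K x‖) * SchwartzMap.seminorm ℂ 0 0 f,
      mul_nonneg (MeasureTheory.integral_nonneg fun _ => norm_nonneg _) (apply_nonneg _ _),
      fun g => by
        refine (norm_pair_stensor_le _ K (SchwartzMap.norm_le_seminorm ℂ g)
          (SchwartzMap.norm_le_seminorm ℂ f)).trans_eq ?_
        rw [Finset.sup_singleton, SchwartzMap.schwartzSeminormFamily_apply]
        ring⟩

theorem kernelForm_apply (K : 𝓢(EuclideanSpace ℝ (κ ⊕ ι), ℂ)) (f : 𝓢(EuclideanSpace ℝ ι, ℂ))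
    (g : 𝓢(EuclideanSpace ℝ κ, ℂ)) : kernelForm K f g = pair K (stensor (Equiv.refl _) g f) := rfl

/-- The linear form `g ↦ ∫ K(y, x) g(y) f(x)` on `𝒮_{s}`. -/
def kernelDual (s : ℝ) (K : 𝓢(EuclideanSpace ℝ (κ ⊕ ι), ℂ)) (f : 𝓢(EuclideanSpace ℝ ι, ℂ)) :
    GSDual s κ :=
  show GS s κ →L[ℂ] ℂ from
  { toLinearMap := (kernelForm K f).toLinearMap.comp GS.toSchwartz
    cont := by
      rw [GS.continuous_iff]
      intro h h0
      let L : NormedSH s h κ →ₗ[ℂ] ℂ :=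
        (kernelForm K f).toLinearMap.comp (spaceSH s h κ).subtype
      refine (L.mkContinuous ((∫ x, ‖K x‖) * SchwartzMap.seminorm ℂ 0 0 f) fun g => ?_).continuous
      refine (norm_pair_stensor_le _ K g.apply_le (SchwartzMap.norm_le_seminorm ℂ f)).trans_eq ?_
      ring }

theorem kernelDual_add (s : ℝ) (K : 𝓢(EuclideanSpace ℝ (κ ⊕ ι), ℂ))
    (f f' : 𝓢(EuclideanSpace ℝ ι, ℂ)) :
    kernelDual s K (f + f') = kernelDual s K f + kernelDual s K f' := by
  refine DFunLike.ext _ _ fun g => ?_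
  change pair K _ = pair K _ + pair K _
  rw [stensor_add_right, map_add]

theorem kernelDual_smul (s : ℝ) (K : 𝓢(EuclideanSpace ℝ (κ ⊕ ι), ℂ)) (c : ℂ)
    (f : 𝓢(EuclideanSpace ℝ ι, ℂ)) : kernelDual s K (c • f) = c • kernelDual s K f := by
  refine DFunLike.ext _ _ fun g => ?_
  change pair K _ = c • pair K _
  rw [stensor_smul_right, map_smul]

theorem norm_restrict_kernelDual_le {s : ℝ} {h : ℝ≥0} (h0 : 0 < h)
    (K : 𝓢(EuclideanSpace ℝ (κ ⊕ ι), ℂ)) {f : 𝓢(EuclideanSpace ℝ ι, ℂ)} {B : ℝ}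
    (hf : ∀ x, ‖f x‖ ≤ B) : ‖(kernelDual s K f).restrict h0‖ ≤ (∫ x, ‖K x‖) * B := by
  refine ContinuousLinearMap.opNorm_le_bound _
    (mul_nonneg (MeasureTheory.integral_nonneg fun _ => norm_nonneg _)
      ((norm_nonneg _).trans (hf 0))) fun g => ?_
  refine (norm_pair_stensor_le _ K g.apply_le hf).trans_eq ?_
  ring

/-- The operator with kernel `K`, on the Schwartz space. -/
def kernelExt (s : ℝ) (K : 𝓢(EuclideanSpace ℝ (κ ⊕ ι), ℂ)) :
    𝓢(EuclideanSpace ℝ ι, ℂ) →L[ℂ] GSDual s κ where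
  toFun := kernelDual s K
  map_add' := kernelDual_add s K
  map_smul' := kernelDual_smul s K
  cont := by
    refine continuous_iInf_rng.2 fun h => continuous_iInf_rng.2 fun h0 =>
      continuous_induced_rng.2 ?_
    exact (SchwartzMap.mkCLMtoNormedSpace (𝕜 := ℂ) (σ := RingHom.id ℂ)
      (fun f => (kernelDual s K f).restrict h0)
      (fun f f' => by rw [kernelDual_add]; rfl)
      (fun c f => by rw [kernelDual_smul]; rfl)
      ⟨{(0, 0)}, ∫ x, ‖K x‖, MeasureTheory.integral_nonneg fun _ => norm_nonneg _, fun f => by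
        rw [Finset.sup_singleton, SchwartzMap.schwartzSeminormFamily_apply]
        exact norm_restrict_kernelDual_le h0 K (SchwartzMap.norm_le_seminorm ℂ f)⟩).continuous

theorem kernelExt_apply {s : ℝ} (K : 𝓢(EuclideanSpace ℝ (κ ⊕ ι), ℂ))
    (f : 𝓢(EuclideanSpace ℝ ι, ℂ)) (g : GS s κ) :
    kernelExt s K f g = pair K (stensor (Equiv.refl _) g.toSchwartz f) := rfl

/-- The operator with kernel `K`, on the Gelfand-Shilov space. -/
def kernelOp (s : ℝ) (K : 𝓢(EuclideanSpace ℝ (κ ⊕ ι), ℂ)) : GS s ι →L[ℂ] GSDual s κ where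
  toFun f := kernelDual s K f.toSchwartz
  map_add' f f' := by rw [map_add, kernelDual_add]
  map_smul' c f := by rw [map_smul, kernelDual_smul]; rfl
  cont := by
    rw [GS.continuous_iff]
    intro k k0
    refine continuous_iInf_rng.2 fun h => continuous_iInf_rng.2 fun h0 =>
      continuous_induced_rng.2 ?_
    let L : NormedSH s k ι →ₗ[ℂ] (NormedSH s h κ →L[ℂ] ℂ) :=
      { toFun := fun f => (kernelDual s K f.1).restrict h0
        map_add' := fun f f' =>
          (congrArg (GSDual.restrict h0) (kernelDual_add s K f.1 f'.1)).trans rfl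
        map_smul' := fun c f =>
          (congrArg (GSDual.restrict h0) (kernelDual_smul s K c f.1)).trans rfl }
    exact (L.mkContinuous (∫ x, ‖K x‖) fun f =>
      norm_restrict_kernelDual_le h0 K f.apply_le).continuous

theorem kernelOp_apply {s : ℝ} (K : 𝓢(EuclideanSpace ℝ (κ ⊕ ι), ℂ)) (f : GS s ι) (g : GS s κ) :
    kernelOp s K f g = pair K (stensor (Equiv.refl _) g.toSchwartz f.toSchwartz) := rfl

theorem toDual_apply {s : ℝ} (φ : 𝓢(EuclideanSpace ℝ ι, ℂ)) (f : GS s ι) :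
    toDual s φ f = pair φ f.toSchwartz := rfl

theorem hasKernel_kernelOp {d₁ d₂ : ℕ} (K : 𝓢(EuclideanSpace ℝ (Fin d₂ ⊕ Fin d₁), ℂ)) :
    HasKernel (kernelOp (1 / 2) K) (toDual (1 / 2) K) := fun _ _ => rfl

/-- The action of a kernel in terms of Hermite coefficients. -/
theorem hasSum_pair_stensor {τ I : Type} [Fintype τ] (e : κ ⊕ ι ≃ τ)
    {K : 𝓢(EuclideanSpace ℝ τ, ℂ)} {m : I → τ → ℕ} {c : I → ℂ}
    (hK : HasSum (fun i => c i • hermite (m i)) K) (g : 𝓢(EuclideanSpace ℝ κ, ℂ))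
    (f : 𝓢(EuclideanSpace ℝ ι, ℂ)) :
    HasSum (fun i => c i * (pair (hermite fun j => m i (e (.inl j))) g *
      pair (hermite fun j => m i (e (.inr j))) f)) (pair K (stensor e g f)) := by
  rw [pair_comm]
  refine (hK.mapL (pair (stensor e g f))).congr_fun fun i => ?_
  rw [map_smul, smul_eq_mul, pair_comm (stensor e g f), pair_hermite_stensor]

theorem order_sum (γ : κ ⊕ ι → ℕ) :
    order γ = order (fun j => γ (.inl j)) + order fun i => γ (.inr i) :=
  Fintype.sum_sum_type _

/-- Integration of a Schwartz kernel against a Schwartz function gives a Schwartz function. -/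
theorem exists_pair_eq_kernelForm [DecidableEq κ] (K : 𝓢(EuclideanSpace ℝ (κ ⊕ ι), ℂ))
    (f : 𝓢(EuclideanSpace ℝ ι, ℂ)) : ∃ φ : 𝓢(EuclideanSpace ℝ κ, ℂ),
      ∀ g, pair φ g = pair K (stensor (Equiv.refl _) g f) := by
  classical
  obtain ⟨B, hB⟩ := exists_decay_pair_hermite K
  obtain ⟨F, hF⟩ := exists_decay_pair_hermite f
  obtain ⟨M, hM⟩ := summable_one_add_order_pow (ι := κ ⊕ ι)
  -- The Hermite coefficients that `φ` must have. Only indices `γ = (δ, ·)` contribute to `c δ`, and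
  -- there `|δ| ≤ |γ|`, so the decay of the coefficients of `K` carries over.
  set c : (κ → ℕ) → ℂ := fun δ => kernelForm K f (hermite δ) with hc
  have hdec : Decay (fun N => ∑' γ : κ ⊕ ι → ℕ, B (N + M) * F 0 * ((1 + (order γ : ℝ)) ^ M)⁻¹)
      c := by
    intro N δ
    have h1 := (hasSum_pair_stensor (Equiv.refl _) (hasSum_pair_hermite_smul K)
      (hermite δ) f).mul_right ((1 + (order δ : ℝ)) ^ N : ℂ)
    have hn : ‖((1 + (order δ : ℝ)) ^ N : ℂ)‖ = (1 + (order δ : ℝ)) ^ N := by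
      rw [← Complex.ofReal_one, ← Complex.ofReal_add, ← Complex.ofReal_pow, Complex.norm_real,
        Real.norm_of_nonneg (by positivity)]
    rw [← hn, ← norm_mul, hc]
    dsimp only
    rw [kernelForm_apply, ← h1.tsum_eq]
    refine tsum_of_norm_bounded (hM.mul_left _).hasSum fun γ => ?_
    rw [norm_mul, hn, pair_hermite]
    have hFγ := hF 0 fun j => γ (.inr j)
    rw [pow_zero, mul_one] at hFγ
    have hF0 : 0 ≤ F 0 := hF.nonneg 0
    have hB0 : 0 ≤ B (N + M) := hB.nonneg _
    split_ifs with hδ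
    · have hle : (order δ : ℝ) ≤ order γ := by
        rw [← hδ, order_sum γ]
        exact_mod_cast Nat.le_add_right _ _
      have hBγ := hB (N + M) γ
      rw [one_mul, norm_mul, ← div_eq_mul_inv, le_div_iff₀ (by positivity)]
      calc ‖pair (hermite γ) K‖ * ‖pair (hermite fun j => γ (.inr j)) f‖ *
            (1 + (order δ : ℝ)) ^ N * (1 + (order γ : ℝ)) ^ M
          ≤ ‖pair (hermite γ) K‖ * F 0 * (1 + (order γ : ℝ)) ^ N * (1 + (order γ : ℝ)) ^ M := by
            gcongr
        _ = ‖pair (hermite γ) K‖ * (1 + (order γ : ℝ)) ^ (N + M) * F 0 := by rw [pow_add]; ring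
        _ ≤ _ := by gcongr
    · rw [zero_mul, mul_zero, norm_zero, zero_mul]
      positivity
  obtain ⟨φ, hφ⟩ := exists_hasSum_smul_hermite hdec
  refine ⟨φ, fun g => ?_⟩
  have h2 := hφ.mapL (pair g)
  have h3 := (hasSum_pair_hermite_smul g).mapL (kernelForm K f)
  rw [pair_comm, ← kernelForm_apply]
  refine h2.unique (h3.congr_fun fun δ => ?_)
  rw [map_smul, map_smul, smul_eq_mul, smul_eq_mul, pair_comm g, mul_comm]

end KernelOperators

/-! ### Kernels with prescribed Hermite coefficients -/

section Expansions

variable {ι κ δ σ τ : Type}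

/-- The extension of a multi-index by zero. -/
def pad (e : ι ⊕ δ ≃ σ) (α : ι → ℕ) : σ → ℕ := fun t => Sum.elim α 0 (e.symm t)

theorem pad_inl (e : ι ⊕ δ ≃ σ) (α : ι → ℕ) (i : ι) : pad e α (e (.inl i)) = α i := by
  simp [pad]

theorem pad_inr (e : ι ⊕ δ ≃ σ) (α : ι → ℕ) (j : δ) : pad e α (e (.inr j)) = 0 := by
  simp [pad]

theorem pad_injective (e : ι ⊕ δ ≃ σ) : Function.Injective (pad e) := fun α α' h => by
  funext i
  rw [← pad_inl e α i, h, pad_inl]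

variable [Fintype ι] [Fintype κ] [Fintype δ] [Fintype σ] [Fintype τ]

theorem order_pad (e : ι ⊕ δ ≃ σ) (α : ι → ℕ) : order (pad e α) = order α := by
  rw [order, ← e.sum_comp, Fintype.sum_sum_type]
  simp [pad_inl, pad_inr, order]

theorem order_elim (β : κ → ℕ) (α : ι → ℕ) : order (Sum.elim β α) = order β + order α :=
  order_sum _

/-- The coefficients are extended by zero to the multi-indices outside the range of `m`. -/
theorem exists_hasSum_of_injective [DecidableEq τ] {I : Type} {m : I → τ → ℕ}
    (hm : Function.Injective m) {B : ℕ → ℝ} {c : I → ℂ} (hB : ∀ N, 0 ≤ B N)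
    (hc : ∀ N i, ‖c i‖ * (1 + (order (m i) : ℝ)) ^ N ≤ B N) :
    ∃ K : 𝓢(EuclideanSpace ℝ τ, ℂ), HasSum (fun i => c i • hermite (m i)) K ∧
      Decay B fun γ => pair (hermite γ) K := by
  have hdec : Decay B (Function.extend m c 0) := by
    intro N γ
    by_cases h : ∃ i, m i = γ
    · obtain ⟨i, rfl⟩ := h
      rw [hm.extend_apply]
      exact hc N i
    · rw [Function.extend_apply' _ _ _ h, Pi.zero_apply, norm_zero, zero_mul]
      exact hB N
  obtain ⟨K, hK⟩ := exists_hasSum_smul_hermite hdec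
  refine ⟨K, ?_, ?_⟩
  · rw [← hm.hasSum_iff] at hK
    · refine hK.congr_fun fun i => ?_
      rw [Function.comp_apply, hm.extend_apply]
    · intro γ h
      rw [Function.extend_apply' _ _ _ h, Pi.zero_apply, zero_smul]
  · simpa only [pair_hermite_of_hasSum hK] using hdec

theorem hasSum_pair_hermite_elim_smul [DecidableEq ι] [DecidableEq κ]
    (K : 𝓢(EuclideanSpace ℝ (κ ⊕ ι), ℂ)) :
    HasSum (fun p : (κ → ℕ) × (ι → ℕ) =>
      pair (hermite (Sum.elim p.1 p.2)) K • hermite (Sum.elim p.1 p.2)) K :=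
  (Equiv.sumArrowEquivProdArrow κ ι ℕ).symm.hasSum_iff.2 (hasSum_pair_hermite_smul K)

end Expansions

/-- A square root factorization of coefficients that decay rapidly. -/
theorem exists_sqrt_factor {I J : Type} [Nonempty J] {k : J → I → ℂ} {p : J → ℕ} {q : I → ℕ}
    {B : ℕ → ℝ} (hk : ∀ N j i, ‖k j i‖ * (1 + ((p j + q i : ℕ) : ℝ)) ^ N ≤ B N) :
    ∃ (μ : I → ℝ) (ν : J → I → ℂ), (∀ i, 0 ≤ μ i) ∧ (∀ j i, ν j i * μ i = k j i) ∧
      (∀ N i, ‖(μ i : ℂ)‖ * (1 + ((q i + q i : ℕ) : ℝ)) ^ N ≤ halfBound B N) ∧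
      ∀ N j i, ‖ν j i‖ * (1 + ((p j + q i : ℕ) : ℝ)) ^ N ≤ halfBound B N := by
  have hq : ∀ N j i, ‖k j i‖ ≤ B N / (1 + (q i : ℝ)) ^ N := fun N j i => by
    rw [le_div_iff₀ (by positivity)]
    refine le_trans ?_ (hk N j i)
    gcongr
    exact Nat.le_add_left _ _
  have hbdd : ∀ i, BddAbove (Set.range fun j => ‖k j i‖) := fun i =>
    ⟨_, Set.forall_mem_range.2 fun j => hq 0 j i⟩
  -- The supremum over `j` makes `√|k j i| ≤ μ i`. Hence `|k / μ| ≤ √|k|`, and where `μ i = 0` the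
  -- whole family `k · i` vanishes, so the convention `0 / 0 = 0` is correct.
  set μ : I → ℝ := fun i => √(⨆ j, ‖k j i‖) with hμ
  have hkμ : ∀ j i, √‖k j i‖ ≤ μ i := fun j i => Real.sqrt_le_sqrt (le_ciSup (hbdd i) j)
  have hzero : ∀ j i, μ i = 0 → k j i = 0 := fun j i h => by
    have := hkμ j i
    rw [h, Real.sqrt_le_left le_rfl] at this
    simpa using this
  refine ⟨μ, fun j i => k j i / μ i, fun i => Real.sqrt_nonneg _, fun j i => ?_, fun N i => ?_,
    fun N j i => ?_⟩
  · by_cases h : μ i = 0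
    · rw [h, hzero j i h]; simp
    · exact div_mul_cancel₀ _ (by exact_mod_cast h)
  · have h1 : μ i ≤ √(B (2 * N) / (1 + (q i : ℝ)) ^ (2 * N)) :=
      Real.sqrt_le_sqrt (ciSup_le fun j => hq (2 * N) j i)
    have h2 : √(B (2 * N) / (1 + (q i : ℝ)) ^ (2 * N)) = √(B (2 * N)) / (1 + (q i : ℝ)) ^ N := by
      rw [Real.sqrt_div' _ (by positivity), mul_comm 2 N, pow_mul, Real.sqrt_sq (by positivity)]
    rw [h2, le_div_iff₀ (by positivity)] at h1
    rw [Complex.norm_real, Real.norm_of_nonneg (Real.sqrt_nonneg _), halfBound]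
    -- The diagonal kernel carries `μ i` at a multi-index of order `2 q i`; `1 + 2q ≤ 2 (1 + q)`
    -- accounts for the `2 ^ N` in `halfBound`.
    calc μ i * (1 + ((q i + q i : ℕ) : ℝ)) ^ N ≤ μ i * (2 * (1 + (q i : ℝ))) ^ N := by
          have : (1 + ((q i + q i : ℕ) : ℝ)) ≤ 2 * (1 + (q i : ℝ)) := by push_cast; linarith
          have h0 : 0 ≤ μ i := Real.sqrt_nonneg _
          gcongr
      _ = 2 ^ N * (μ i * (1 + (q i : ℝ)) ^ N) := by rw [mul_pow]; ring
      _ ≤ _ := by gcongr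
  · have h1 : ‖k j i / μ i‖ ≤ √‖k j i‖ := by
      rw [norm_div, Complex.norm_real, Real.norm_of_nonneg (Real.sqrt_nonneg _)]
      refine div_le_of_le_mul₀ (Real.sqrt_nonneg _) (Real.sqrt_nonneg _) ?_
      calc ‖k j i‖ = √‖k j i‖ * √‖k j i‖ := (Real.mul_self_sqrt (norm_nonneg _)).symm
        _ ≤ _ := mul_le_mul_of_nonneg_left (hkμ j i) (Real.sqrt_nonneg _)
    have h2 := Real.sqrt_le_sqrt (hk (2 * N) j i)
    rw [Real.sqrt_mul (norm_nonneg _), mul_comm 2 N, pow_mul, Real.sqrt_sq (by positivity),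
      mul_comm N 2] at h2
    calc ‖k j i / μ i‖ * (1 + ((p j + q i : ℕ) : ℝ)) ^ N
        ≤ √‖k j i‖ * (1 + ((p j + q i : ℕ) : ℝ)) ^ N := by gcongr
      _ ≤ √(B (2 * N)) := h2
      _ ≤ halfBound B N := le_mul_of_one_le_left (Real.sqrt_nonneg _) (one_le_pow₀ one_le_two)

/-! ### Compositions -/

section Compositions

variable {ι κ σ δ : Type} [Fintype ι] [Fintype κ] [Fintype σ]
  [DecidableEq σ]

theorem pair_pad (e : ι ⊕ δ ≃ σ) (α α' : ι → ℕ) :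
    pair (hermite (pad e α)) (hermite (pad e α')) = if α = α' then 1 else 0 := by
  rw [pair_hermite]
  exact if_congr (pad_injective e).eq_iff rfl rfl

variable [DecidableEq ι] [DecidableEq κ]

/-- By orthonormality the coefficient of `φ = T₁ f` at `(α, 0)` is `μ(α)` times that of `f` at `α`,
so the series for `T₂ φ` and `T f` agree term by term through `ν μ = k`. -/
theorem pair_stensor_eq_of_diagonal_right (e : ι ⊕ δ ≃ σ) {μ : (ι → ℕ) → ℝ}
    {ν : (κ → ℕ) → (ι → ℕ) → ℂ} {K : 𝓢(EuclideanSpace ℝ (κ ⊕ ι), ℂ)}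
    {K₁ : 𝓢(EuclideanSpace ℝ (σ ⊕ ι), ℂ)} {K₂ : 𝓢(EuclideanSpace ℝ (κ ⊕ σ), ℂ)}
    (hνμ : ∀ β α, ν β α * μ α = pair (hermite (Sum.elim β α)) K)
    (h₁ : HasSum (fun α => (μ α : ℂ) • hermite (Sum.elim (pad e α) α)) K₁)
    (h₂ : HasSum (fun p : (κ → ℕ) × (ι → ℕ) =>
      ν p.1 p.2 • hermite (Sum.elim p.1 (pad e p.2))) K₂)
    {f : 𝓢(EuclideanSpace ℝ ι, ℂ)} {φ : 𝓢(EuclideanSpace ℝ σ, ℂ)}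
    (hφ : ∀ g, pair φ g = pair K₁ (stensor (Equiv.refl _) g f)) (ψ : 𝓢(EuclideanSpace ℝ κ, ℂ)) :
    pair K (stensor (Equiv.refl _) ψ f) = pair K₂ (stensor (Equiv.refl _) ψ φ) := by
  have hφα : ∀ α, pair (hermite (pad e α)) φ = μ α * pair (hermite α) f := fun α => by
    rw [pair_comm, hφ]
    have h := hasSum_pair_stensor (Equiv.refl _) h₁ (hermite (pad e α)) f
    refine (h.unique (hasSum_single α fun α' hα' => ?_)).trans ?_
    · change _ * (pair (hermite (pad e α')) _ * _) = _
      rw [pair_pad, if_neg hα', zero_mul, mul_zero]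
    · change _ * (pair (hermite (pad e α)) _ * pair (hermite α) f) = _
      rw [pair_pad, if_pos rfl, one_mul]
  have h1 := hasSum_pair_stensor (Equiv.refl _) (hasSum_pair_hermite_elim_smul K) ψ f
  refine h1.unique ((hasSum_pair_stensor (Equiv.refl _) h₂ ψ φ).congr_fun fun p => ?_)
  change _ * (pair (hermite p.1) ψ * pair (hermite p.2) f) =
    _ * (pair (hermite p.1) ψ * pair (hermite (pad e p.2)) φ)
  rw [hφα, ← hνμ]
  ring

/-- Here the coefficient of `φ = T₁ f` at `(β, 0)` is the series `∑_α ν(α,β) f_α`, and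
multiplication by `μ(β)` turns it into the coefficient of `T f` at `β`. -/
theorem pair_stensor_eq_of_diagonal_left (e : κ ⊕ δ ≃ σ) {μ : (κ → ℕ) → ℝ}
    {ν : (ι → ℕ) → (κ → ℕ) → ℂ} {K : 𝓢(EuclideanSpace ℝ (κ ⊕ ι), ℂ)}
    {K₁ : 𝓢(EuclideanSpace ℝ (σ ⊕ ι), ℂ)} {K₂ : 𝓢(EuclideanSpace ℝ (κ ⊕ σ), ℂ)}
    (hνμ : ∀ α β, ν α β * μ β = pair (hermite (Sum.elim β α)) K)
    (h₁ : HasSum (fun p : (κ → ℕ) × (ι → ℕ) =>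
      ν p.2 p.1 • hermite (Sum.elim (pad e p.1) p.2)) K₁)
    (h₂ : HasSum (fun β => (μ β : ℂ) • hermite (Sum.elim β (pad e β))) K₂)
    {f : 𝓢(EuclideanSpace ℝ ι, ℂ)} {φ : 𝓢(EuclideanSpace ℝ σ, ℂ)}
    (hφ : ∀ g, pair φ g = pair K₁ (stensor (Equiv.refl _) g f)) (ψ : 𝓢(EuclideanSpace ℝ κ, ℂ)) :
    pair K (stensor (Equiv.refl _) ψ f) = pair K₂ (stensor (Equiv.refl _) ψ φ) := by
  have hφβ : ∀ β, HasSum (fun α => ν α β * pair (hermite α) f) (pair (hermite (pad e β)) φ) :=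
    fun β => by
      rw [pair_comm, hφ]
      have h := hasSum_pair_stensor (Equiv.refl _) h₁ (hermite (pad e β)) f
      have hinj : Function.Injective fun α : ι → ℕ => (β, α) := Prod.mk_right_injective β
      rw [← hinj.hasSum_iff] at h
      · refine h.congr_fun fun α => ?_
        change _ = _ * (pair (hermite (pad e β)) _ * pair (hermite α) f)
        rw [pair_pad, if_pos rfl, one_mul]
      · rintro ⟨β', α⟩ hp
        change _ * (pair (hermite (pad e β')) _ * _) = _
        rw [pair_pad, if_neg, zero_mul, mul_zero]
        rintro rfl
        exact hp ⟨α, rfl⟩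
  have h1 := hasSum_pair_stensor (Equiv.refl _) (hasSum_pair_hermite_elim_smul K) ψ f
  -- The double series for `K` is summed over `α` first, to match the single series over `β` for
  -- `K₂`.
  refine (h1.prod_fiberwise fun β => ?_).unique (hasSum_pair_stensor (Equiv.refl _) h₂ ψ φ)
  have h2 := (hφβ β).mul_left (μ β * pair (hermite β) ψ)
  rw [mul_assoc] at h2
  refine h2.congr_fun fun α => ?_
  change _ * (pair (hermite β) ψ * pair (hermite α) f) = _
  rw [← hνμ]
  ring

theorem isComposition_kernelOp {d₀ d₁ d₂ : ℕ} {T : Op d₁ d₂}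
    {K : 𝓢(EuclideanSpace ℝ (Fin d₂ ⊕ Fin d₁), ℂ)} (hK : HasKernel T (toDual (1 / 2) K))
    {K₁ : 𝓢(EuclideanSpace ℝ (Fin d₀ ⊕ Fin d₁), ℂ)} {K₂ : 𝓢(EuclideanSpace ℝ (Fin d₂ ⊕ Fin d₀), ℂ)}
    (h : ∀ (f : 𝓢(EuclideanSpace ℝ (Fin d₁), ℂ)) (φ : 𝓢(EuclideanSpace ℝ (Fin d₀), ℂ)),
      (∀ g, pair φ g = pair K₁ (stensor (Equiv.refl _) g f)) →
        ∀ ψ, pair K (stensor (Equiv.refl _) ψ f) = pair K₂ (stensor (Equiv.refl _) ψ φ)) :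
    IsComposition T (kernelOp (1 / 2) K₂) (kernelOp (1 / 2) K₁) := by
  refine ⟨kernelExt (1 / 2) K₂, fun f => rfl, fun f => ?_⟩
  obtain ⟨φ, hφ⟩ := exists_pair_eq_kernelForm K₁ f.toSchwartz
  refine ⟨φ, DFunLike.ext _ _ fun g => ?_, DFunLike.ext _ _ fun g => ?_⟩
  · rw [kernelOp_apply, toDual_apply, hφ]
  · rw [kernelExt_apply, hK f g, toDual_apply, ← h _ φ hφ]
    rfl

end Compositions

/-! ### Positive Hermite diagonal operators -/

theorem pair_hermite_sconj {ι : Type} [Fintype ι] (γ : ι → ℕ) (f : 𝓢(EuclideanSpace ℝ ι, ℂ)) :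
    pair (hermite γ) (sconj f) = (starRingEnd ℂ) (pair (hermite γ) f) := by
  rw [pair_apply, pair_apply, ← integral_conj]
  congr 1
  funext x
  rw [map_mul, hermite_apply, Complex.conj_ofReal, sconj_apply]

/-- Only one coefficient is nonzero, so a geometric bound suffices. -/
theorem hermite_mem_spaceS {ι : Type} [Fintype ι] (γ : ι → ℕ) : hermite γ ∈ spaceS (1 / 2) ι := by
  classical
  refine (mem_spaceS_iff le_rfl _).2 ⟨fun N => (1 + (order γ : ℝ)) ^ N,
    ⟨1 + order γ, 1, by positivity, zero_le_one, fun N => ?_⟩, fun N δ => ?_⟩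
  · rw [one_mul]
    refine le_mul_of_one_le_right (by positivity) (Real.one_le_rpow ?_ (by norm_num))
    exact_mod_cast Nat.one_le_iff_ne_zero.2 (Nat.factorial_ne_zero N)
  · dsimp only
    rw [pair_hermite]
    split_ifs with h
    · rw [h, norm_one, one_mul]
    · rw [norm_zero, zero_mul]
      positivity

/-- The Hermite function `h_γ`, as an element of `𝒮_{1/2}`. -/
def GS.hermite {ι : Type} [Fintype ι] (γ : ι → ℕ) : GS (1 / 2) ι :=
  ⟨GelfandShilov.hermite γ, hermite_mem_spaceS γ⟩

theorem GS.toSchwartz_hermite {ι : Type} [Fintype ι] (γ : ι → ℕ) :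
    (GS.hermite γ).toSchwartz = GelfandShilov.hermite γ := rfl

theorem GS.toSchwartz_conj {ι : Type} [Fintype ι] {s : ℝ} (f : GS s ι) :
    f.conj.toSchwartz = sconj f.toSchwartz := rfl

theorem GS.toSchwartz_tensor {ι κ τ : Type} [Fintype ι] [Fintype κ] [Fintype τ] {s : ℝ}
    (e : ι ⊕ κ ≃ τ) (f : GS s ι) (g : GS s κ) :
    (GS.tensor e f g).toSchwartz = stensor e f.toSchwartz g.toSchwartz := rfl

/-- The action of a Hermite diagonal kernel. -/
theorem hasSum_pair_stensor_elim {ι κ I : Type} [Fintype ι] [Fintype κ] {m : I → κ → ℕ}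
    {n : I → ι → ℕ} {μ : I → ℝ} {K : 𝓢(EuclideanSpace ℝ (κ ⊕ ι), ℂ)}
    (hK : HasSum (fun i => (μ i : ℂ) • hermite (Sum.elim (m i) (n i))) K)
    (g : 𝓢(EuclideanSpace ℝ κ, ℂ)) (f : 𝓢(EuclideanSpace ℝ ι, ℂ)) :
    HasSum (fun i => (μ i : ℂ) * (pair (hermite (m i)) g * pair (hermite (n i)) f))
      (pair K (stensor (Equiv.refl _) g f)) :=
  hasSum_pair_stensor (Equiv.refl _) hK g f

theorem hermiteEigen_kernelOp {d : ℕ} {μ : (Fin d → ℕ) → ℝ}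
    {K : 𝓢(EuclideanSpace ℝ (Fin d ⊕ Fin d), ℂ)}
    (hK : HasSum (fun α => (μ α : ℂ) • hermite (Sum.elim α α)) K) :
    HermiteEigen (kernelOp (1 / 2) K) := fun α => by
  refine ⟨GS.hermite α, μ α, fun x => rfl, DFunLike.ext _ _ fun g => ?_⟩
  change kernelOp (1 / 2) K (GS.hermite α) g = (μ α : ℂ) * toDual (1 / 2) _ g
  rw [kernelOp_apply, toDual_apply, GS.toSchwartz_hermite]
  have h := hasSum_pair_stensor_elim (m := fun α => α) (n := fun α => α) hK g.toSchwartz (hermite α)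
  refine (h.unique (hasSum_single α fun α' hα' => ?_)).trans ?_
  · rw [pair_hermite, if_neg hα', mul_zero, mul_zero]
  · rw [pair_hermite, if_pos rfl, mul_one]

/-- Since Hermite functions are real, `(T f, f)` equals `∑ μ(α) |f_α|²`. -/
theorem isPosSemidef_kernelOp {d : ℕ} {μ : (Fin d → ℕ) → ℝ} (hμ : ∀ α, 0 ≤ μ α)
    {K : 𝓢(EuclideanSpace ℝ (Fin d ⊕ Fin d), ℂ)}
    (hK : HasSum (fun α => (μ α : ℂ) • hermite (Sum.elim α α)) K) :
    IsPosSemidef (kernelOp (1 / 2) K) := fun f => by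
  have h := hasSum_pair_stensor_elim (m := fun α => α) (n := fun α => α) hK
    f.conj.toSchwartz f.toSchwartz
  have h' : ∀ α, (μ α : ℂ) * (pair (hermite α) f.conj.toSchwartz *
      pair (hermite α) f.toSchwartz) =
        ((μ α * Complex.normSq (pair (hermite α) f.toSchwartz) : ℝ) : ℂ) := fun α => by
    rw [GS.toSchwartz_conj, pair_hermite_sconj, ← Complex.normSq_eq_conj_mul_self,
      Complex.ofReal_mul]
  simp only [h'] at h
  rw [kernelOp_apply]
  constructor
  · exact (Complex.hasSum_re h).nonneg fun α => mul_nonneg (hμ α) (Complex.normSq_nonneg _)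
  · exact (Complex.hasSum_im h).unique (by simpa only [Complex.ofReal_im] using hasSum_zero)

/-- Padding by zeros factors `h_(α,0)` as `h_α ⊗ h_0`. Thus the operator is `T₀ ⊗ h_0`, where `T₀`
has the kernel `∑ μ(α) h_α ⊗ h_α`; the bound on `μ` makes this series converge. -/
theorem isPosHermiteDiagonal'_kernelOp {d d₁ d₂ : ℕ} (hd : d₁ + d = d₂) {μ : (Fin d₁ → ℕ) → ℝ}
    (hμ : ∀ α, 0 ≤ μ α) {B : ℕ → ℝ} (hB : ∀ N, 0 ≤ B N)
    (hμB : ∀ N α, ‖(μ α : ℂ)‖ * (1 + ((order α + order α : ℕ) : ℝ)) ^ N ≤ B N)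
    {K : 𝓢(EuclideanSpace ℝ (Fin d₂ ⊕ Fin d₁), ℂ)}
    (hK : HasSum (fun α => (μ α : ℂ) •
      hermite (Sum.elim (pad (finSumFinEquiv.trans (finCongr hd)) α) α)) K) :
    IsPosHermiteDiagonal' (kernelOp (1 / 2) K) := by
  have hinj : Function.Injective fun α : Fin d₁ → ℕ => Sum.elim α α := fun α α' h =>
    funext fun i => congrFun h (.inl i)
  obtain ⟨K₀, hK₀, -⟩ := exists_hasSum_of_injective hinj hB (c := fun α => (μ α : ℂ))
    (fun N α => by rw [order_elim]; exact hμB N α)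
  refine ⟨d, hd, kernelOp (1 / 2) K₀, 0, GS.hermite 0, hermiteEigen_kernelOp hK₀,
    isPosSemidef_kernelOp hμ hK₀, fun x => rfl, fun f φ ψ => ?_⟩
  rw [kernelOp_apply, kernelOp_apply, toDual_apply, GS.toSchwartz_hermite, GS.toSchwartz_tensor]
  have h1 := hasSum_pair_stensor_elim (m := fun α => α) (n := fun α => α) hK₀
    φ.toSchwartz f.toSchwartz
  have h2 := hasSum_pair_stensor_elim (n := fun α => α) hK
    (stensor (finSumFinEquiv.trans (finCongr hd)) φ.toSchwartz ψ.toSchwartz) f.toSchwartz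
  refine h2.unique ((h1.mul_right (pair (hermite 0) ψ.toSchwartz)).congr_fun fun α => ?_)
  rw [pair_hermite_stensor]
  simp only [pad_inl, pad_inr]
  change _ * (_ * pair (hermite 0) _ * _) = _
  ring

theorem isPosHermiteDiagonal_kernelOp {d d₁ d₂ : ℕ} (hd : d₁ + d = d₂) {μ : (Fin d₁ → ℕ) → ℝ}
    (hμ : ∀ α, 0 ≤ μ α) {B : ℕ → ℝ} (hB : ∀ N, 0 ≤ B N)
    (hμB : ∀ N α, ‖(μ α : ℂ)‖ * (1 + ((order α + order α : ℕ) : ℝ)) ^ N ≤ B N)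
    {K : 𝓢(EuclideanSpace ℝ (Fin d₂ ⊕ Fin d₁), ℂ)}
    (hK : HasSum (fun α => (μ α : ℂ) •
      hermite (Sum.elim (pad (finSumFinEquiv.trans (finCongr hd)) α) α)) K) :
    IsPosHermiteDiagonal (kernelOp (1 / 2) K) :=
  .inl ⟨hd ▸ Nat.le_add_right _ _, isPosHermiteDiagonal'_kernelOp hd hμ hB hμB hK⟩

theorem isPosHermiteDiagonal_kernelOp_of_right {d d₁ d₂ : ℕ} (hd : d₂ + d = d₁)
    {μ : (Fin d₂ → ℕ) → ℝ} (hμ : ∀ α, 0 ≤ μ α) {B : ℕ → ℝ} (hB : ∀ N, 0 ≤ B N)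
    (hμB : ∀ N α, ‖(μ α : ℂ)‖ * (1 + ((order α + order α : ℕ) : ℝ)) ^ N ≤ B N)
    {K : 𝓢(EuclideanSpace ℝ (Fin d₂ ⊕ Fin d₁), ℂ)}
    (hK : HasSum (fun α => (μ α : ℂ) •
      hermite (Sum.elim α (pad (finSumFinEquiv.trans (finCongr hd)) α))) K) :
    IsPosHermiteDiagonal (kernelOp (1 / 2) K) := by
  rcases Nat.eq_zero_or_pos d with rfl | hpos
  -- In equal dimensions the definition concerns the operator itself rather than its adjoint; the
  -- padding is then the identity and the kernel is already diagonal.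
  · subst hd
    have hpad : ∀ α : Fin d₂ → ℕ,
        pad (finSumFinEquiv.trans (finCongr (Nat.add_zero d₂))) α = α := fun α =>
      funext fun t => pad_inl (finSumFinEquiv.trans (finCongr (Nat.add_zero d₂))) α t
    refine isPosHermiteDiagonal_kernelOp (d := 0) rfl hμ hB hμB (hK.congr_fun fun α => ?_)
    rw [hpad]
  -- As `μ` and the Hermite functions are real, the adjoint has the transposed kernel, which is of
  -- the type already treated.
  · refine .inr ⟨by omega, ?_⟩
    have hinj : Function.Injective fun α : Fin d₂ → ℕ =>
        Sum.elim (pad (finSumFinEquiv.trans (finCongr hd)) α) α := fun α α' h =>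
      funext fun i => congrFun h (.inr i)
    obtain ⟨K', hK', -⟩ := exists_hasSum_of_injective hinj hB (c := fun α => (μ α : ℂ))
      (fun N α => by rw [order_elim, order_pad]; exact hμB N α)
    refine ⟨kernelOp (1 / 2) K', fun f g => ?_, isPosHermiteDiagonal'_kernelOp hd hμ hB hμB hK'⟩
    rw [kernelOp_apply, kernelOp_apply]
    have h1 := hasSum_pair_stensor_elim (m := fun α => α) hK g.conj.toSchwartz f.toSchwartz
    have h2 := (hasSum_pair_stensor_elim (n := fun α => α) hK' f.conj.toSchwartz
      g.toSchwartz).map (starRingEnd ℂ) Complex.continuous_conj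
    refine h1.unique (h2.congr_fun fun α => ?_)
    rw [Function.comp_apply, GS.toSchwartz_conj, GS.toSchwartz_conj, pair_hermite_sconj,
      pair_hermite_sconj, map_mul, map_mul, Complex.conj_conj, Complex.conj_ofReal]
    ring

/-! ### Factorizations -/

section Factorizations

variable {d₀ d₁ d₂ : ℕ}
  {X : ∀ (τ : Type) [Fintype τ], Submodule ℂ 𝓢(EuclideanSpace ℝ τ, ℂ)} {P : (ℕ → ℝ) → Prop}

theorem exists_isFactorization_left
    (hX : ∀ (τ : Type) [Fintype τ] (f : 𝓢(EuclideanSpace ℝ τ, ℂ)),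
      f ∈ X τ ↔ ∃ B, P B ∧ Decay B fun γ => pair (hermite γ) f)
    (hP : ∀ B, P B → P (halfBound B)) {T : Op d₁ d₂}
    {K : 𝓢(EuclideanSpace ℝ (Fin d₂ ⊕ Fin d₁), ℂ)} (hK : HasKernel T (toDual (1 / 2) K))
    (hKX : K ∈ X (Fin d₂ ⊕ Fin d₁)) (hd : d₁ ≤ d₀) :
    ∃ (T₁ : Op d₁ d₀) (T₂ : Op d₀ d₂), IsFactorization (X (Fin d₀ ⊕ Fin d₁)) (X (Fin d₂ ⊕ Fin d₀))
      T T₁ T₂ ∧ IsPosHermiteDiagonal T₁ := by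
  obtain ⟨d, hd⟩ := Nat.exists_eq_add_of_le hd
  set e := finSumFinEquiv.trans (finCongr hd.symm) with he
  obtain ⟨B, hPB, hB⟩ := (hX _ K).1 hKX
  obtain ⟨μ, ν, hμ, hνμ, hμB, hνB⟩ := exists_sqrt_factor (B := B) (p := order) (q := order)
    (k := fun (β : Fin d₂ → ℕ) (α : Fin d₁ → ℕ) => pair (hermite (Sum.elim β α)) K)
    (fun N β α => by rw [← order_elim]; exact hB N _)
  have hB' : ∀ N, 0 ≤ halfBound B N := fun N => by unfold halfBound; positivity
  obtain ⟨K₁, h₁, hK₁⟩ := exists_hasSum_of_injective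
    (m := fun α : Fin d₁ → ℕ => Sum.elim (pad e α) α) (c := fun α => (μ α : ℂ))
    (fun α α' h => funext fun i => congrFun h (.inr i)) hB'
    (fun N α => by rw [order_elim, order_pad]; exact hμB N α)
  obtain ⟨K₂, h₂, hK₂⟩ := exists_hasSum_of_injective
    (m := fun p : (Fin d₂ → ℕ) × (Fin d₁ → ℕ) => Sum.elim p.1 (pad e p.2))
    (c := fun p => ν p.1 p.2)
    (fun p p' h => Prod.ext (funext fun i => congrFun h (.inl i))
      (pad_injective e (funext fun i => congrFun h (.inr i)))) hB'
    (fun N p => by rw [order_elim, order_pad]; exact hνB N p.1 p.2)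
  refine ⟨kernelOp (1 / 2) K₁, kernelOp (1 / 2) K₂,
    ⟨⟨K₁, (hX _ K₁).2 ⟨_, hP B hPB, hK₁⟩, hasKernel_kernelOp K₁⟩,
      ⟨K₂, (hX _ K₂).2 ⟨_, hP B hPB, hK₂⟩, hasKernel_kernelOp K₂⟩,
      isComposition_kernelOp hK fun f φ hφ ψ =>
        pair_stensor_eq_of_diagonal_right e hνμ h₁ h₂ hφ ψ⟩,
    isPosHermiteDiagonal_kernelOp hd.symm hμ hB' hμB h₁⟩

theorem exists_isFactorization_right
    (hX : ∀ (τ : Type) [Fintype τ] (f : 𝓢(EuclideanSpace ℝ τ, ℂ)),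
      f ∈ X τ ↔ ∃ B, P B ∧ Decay B fun γ => pair (hermite γ) f)
    (hP : ∀ B, P B → P (halfBound B)) {T : Op d₁ d₂}
    {K : 𝓢(EuclideanSpace ℝ (Fin d₂ ⊕ Fin d₁), ℂ)} (hK : HasKernel T (toDual (1 / 2) K))
    (hKX : K ∈ X (Fin d₂ ⊕ Fin d₁)) (hd : d₂ ≤ d₀) :
    ∃ (T₁ : Op d₁ d₀) (T₂ : Op d₀ d₂), IsFactorization (X (Fin d₀ ⊕ Fin d₁)) (X (Fin d₂ ⊕ Fin d₀))
      T T₁ T₂ ∧ IsPosHermiteDiagonal T₂ := by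
  obtain ⟨d, hd⟩ := Nat.exists_eq_add_of_le hd
  set e := finSumFinEquiv.trans (finCongr hd.symm) with he
  obtain ⟨B, hPB, hB⟩ := (hX _ K).1 hKX
  obtain ⟨μ, ν, hμ, hνμ, hμB, hνB⟩ := exists_sqrt_factor (B := B) (p := order) (q := order)
    (k := fun (α : Fin d₁ → ℕ) (β : Fin d₂ → ℕ) => pair (hermite (Sum.elim β α)) K)
    (fun N α β => by rw [add_comm (order α), ← order_elim]; exact hB N _)
  have hB' : ∀ N, 0 ≤ halfBound B N := fun N => by unfold halfBound; positivity
  obtain ⟨K₁, h₁, hK₁⟩ := exists_hasSum_of_injective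
    (m := fun p : (Fin d₂ → ℕ) × (Fin d₁ → ℕ) => Sum.elim (pad e p.1) p.2)
    (c := fun p => ν p.2 p.1)
    (fun p p' h => Prod.ext (pad_injective e (funext fun i => congrFun h (.inl i)))
      (funext fun i => congrFun h (.inr i))) hB'
    (fun N p => by rw [order_elim, order_pad, add_comm (order p.1)]; exact hνB N p.2 p.1)
  obtain ⟨K₂, h₂, hK₂⟩ := exists_hasSum_of_injective
    (m := fun β : Fin d₂ → ℕ => Sum.elim β (pad e β)) (c := fun β => (μ β : ℂ))
    (fun β β' h => funext fun i => congrFun h (.inl i)) hB'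
    (fun N β => by rw [order_elim, order_pad]; exact hμB N β)
  refine ⟨kernelOp (1 / 2) K₁, kernelOp (1 / 2) K₂,
    ⟨⟨K₁, (hX _ K₁).2 ⟨_, hP B hPB, hK₁⟩, hasKernel_kernelOp K₁⟩,
      ⟨K₂, (hX _ K₂).2 ⟨_, hP B hPB, hK₂⟩, hasKernel_kernelOp K₂⟩,
      isComposition_kernelOp hK fun f φ hφ ψ =>
        pair_stensor_eq_of_diagonal_left e hνμ h₁ h₂ hφ ψ⟩,
    isPosHermiteDiagonal_kernelOp_of_right hd.symm hμ hB' hμB h₂⟩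

/-- Only two facts about the function class matter: it is described by a class of decay bounds, in
every dimension, and that class is stable under `halfBound`. -/
theorem hasFactorizations
    (hX : ∀ (τ : Type) [Fintype τ] (f : 𝓢(EuclideanSpace ℝ τ, ℂ)),
      f ∈ X τ ↔ ∃ B, P B ∧ Decay B fun γ => pair (hermite γ) f)
    (hP : ∀ B, P B → P (halfBound B)) {T : Op d₁ d₂}
    {K : 𝓢(EuclideanSpace ℝ (Fin d₂ ⊕ Fin d₁), ℂ)} (hK : HasKernel T (toDual (1 / 2) K))
    (hKX : K ∈ X (Fin d₂ ⊕ Fin d₁)) (hd : min d₁ d₂ ≤ d₀) :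
    HasFactorizations (X (Fin d₀ ⊕ Fin d₁)) (X (Fin d₂ ⊕ Fin d₀)) T := by
  refine ⟨?_, exists_isFactorization_left hX hP hK hKX, exists_isFactorization_right hX hP hK hKX⟩
  rcases min_le_iff.1 hd with h | h
  · obtain ⟨T₁, T₂, hT, hT₁⟩ := exists_isFactorization_left hX hP hK hKX h
    exact ⟨T₁, T₂, hT, .inl hT₁⟩
  · obtain ⟨T₁, T₂, hT, hT₂⟩ := exists_isFactorization_right hX hP hK hKX h
    exact ⟨T₁, T₂, hT, .inr hT₂⟩

end Factorizations

end GelfandShilov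

end

theorem theorem3p2 (d₀ d₁ d₂ : ℕ) (hd : min d₁ d₂ ≤ d₀)
    (T : GS (1 / 2) (Fin d₁) →L[ℂ] GSDual (1 / 2) (Fin d₂))
    (K : 𝓢(EuclideanSpace ℝ (Fin d₂ ⊕ Fin d₁), ℂ)) (hK : HasKernel T (toDual (1 / 2) K)) :
    HasFactorizations (d₀ := d₀) ⊤ ⊤ T ∧
    (∀ s : ℝ, 1 / 2 ≤ s → K ∈ spaceS s (Fin d₂ ⊕ Fin d₁) →
      HasFactorizations (spaceS s (Fin d₀ ⊕ Fin d₁)) (spaceS s (Fin d₂ ⊕ Fin d₀)) T) ∧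
    (∀ s : ℝ, 1 / 2 < s → K ∈ spaceSigma s (Fin d₂ ⊕ Fin d₁) →
      HasFactorizations (spaceSigma s (Fin d₀ ⊕ Fin d₁)) (spaceSigma s (Fin d₂ ⊕ Fin d₀)) T) := by
  classical
  -- For Schwartz kernels no growth of `B` is prescribed: every Schwartz function has rapidly
  -- decaying coefficients for some `B`.
  refine ⟨hasFactorizations (X := fun _ _ => ⊤) (P := fun _ => True) (fun τ _ f => ?_)
    (fun _ _ => trivial) hK trivial hd, fun s hs hKs => ?_, fun s hs hKs => ?_⟩
  · obtain ⟨B, hB⟩ := exists_decay_pair_hermite f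
    exact ⟨fun _ => ⟨B, trivial, hB⟩, fun _ => trivial⟩
  · exact hasFactorizations (X := fun τ _ => spaceS s τ) (P := GevreyBound s)
      (fun τ _ f => mem_spaceS_iff hs f) (fun B hB => hB.half (by linarith)) hK hKs hd
  · exact hasFactorizations (X := fun τ _ => spaceSigma s τ) (P := BeurlingBound s)
      (fun τ _ f => mem_spaceSigma_iff hs f) (fun B hB => hB.half (by linarith)) hK hKs hd
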